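/- Let $\Bbbk$ be a field and let $\phi\colon M\to N$ be a morphism of persistence modules $M,N\colon\mathbb N_0\to\mathbf{vec}_{\Bbbk}$ (functors to finite-dimensional vector spaces) such that $M(i\le j)$ and $N(i\le j)$ are isomorphisms whenever $m\le i\le j$. With respect to chosen bases, let $A_i,B_i$ ($0\le i<m$) be the matrices of $M(i\le i+1)$, $N(i\le i+1)$ and $C_i$ ($0\le i\le m$) the matrices of $\phi(i)$. A persistence module $M$ is identified with the graded $\Bbbk[t]$-module $\bigoplus_i M(i)$, on which $t$ acts by the maps $M(i\le i+1)$. Let $\mathbb I_{[a,\infty)}$ be the free graded module on one generator of degree $a$, and $\mathbb I_{[a,b)}=\mathbb I_{[a,\infty)}/\mathbb I_{[b,\infty)}$. A *canonical presentation* of $\phi$ is a commutative diagram of graded $\Bbbk[t]$-modules and degree-preserving maps with exact rows $$\begin{array}{ccccccc}0&\leftarrow& M&\leftarrow& P_0&\xleftarrow{\,p\,}& P_1\\ &&\downarrow{\scriptstyle\phi}&&\downarrow{\scriptstyle f_0}&&\downarrow{\scriptstyle f_1}\\ 0&\leftarrow& N&\leftarrow& Q_0&\xleftarrow{\,q\,}&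 Q_1\end{array}$$ in which $p$ and $q$ are direct sums of maps $\mathbb I_{[b,\infty)}\xleftarrow{\,t^{d-b}\,}\mathbb I_{[d,\infty)}$ with $b<d<\infty$ and of maps $\mathbb I_{[b,\infty)}\leftarrow 0$ (then $d=\infty$). It is stored as the matrix $f_0=(\lambda_{rc})$ over $\Bbbk$ with a birth time $b$ and a death time $d$ for every column $c$ (summand of $P_0$) and every row $r$ (summand of $Q_0$): the generator $c$ is mapped to $\sum_r\lambda_{rc}\,t^{b(c)-b(r)}\,r$. The algorithm **PresPersMod** starts with $f_0=C_0$ and all $b=0$, $d=\infty$. For $i=0,\dots,m-1$ it does the following. 1. It column reduces the current $A_i$ and $B_i$ from left to right (pivot of a column: its lowest nonzero entry) and performs the corresponding column and row operations on $f_0$. 2. It sets $d=i+1$ for the bars (columns, respectively rows, of $f_0$) of the zero columns of the reduced $A_i$ and $B_i$. Each nonzero column continues its bar in the basis element of its pivot row. 3. It transforms $A_{i+1},B_{i+1},C_{i+1}$ by the change of bases of $M(i+1)$ and $N(i+1)$ that a complete row reduction of the reduced $A_i,B_i$ would give (without performing that row reduction on $A_i,B_i$), and sorts the bases in the order of $f_0$,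 the elements of non-pivot rows last. 4. For each non-pivot row of the reduced $A_i$ (respectively $B_i$) it appends a column (respectively row) with $b=i+1$, $d=\infty$ to $f_0$. New columns are filled with the corresponding columns of the transformed $C_{i+1}$, and all other new entries are $0$. Time is counted on a random access machine on which each field operation or zero test in $\Bbbk$, each addition, subtraction or comparison of natural numbers, each memory access and each control step takes one unit of time. **Theorem.** On the input $(A_i)_{0\le i<m}$, $(B_i)_{0\le i<m}$, $(C_i)_{0\le i\le m}$ (together with $m$ and the dimensions), PresPersMod computes an annotated matrix $f_0$ that is a canonical presentation of $\phi$. In particular, there are isomorphisms $M\cong\bigoplus_c\mathbb I_{[b(c),d(c))}$ and $N\cong\bigoplus_r\mathbb I_{[b(r),d(r))}$ (the barcodes of $M$ and $N$) under which, for every index $i$, $\phi(i)$ sends each bar $c$ with $b(c)\le i<d(c)$ to $\sum_r\lambda_{rc}\,r$, the sum being over the bars $r$ with $b(r)\le i<d(r)$. The algorithm runs in $O(n^3)$ time: for every $a\in\mathbb N$ there is a constant $\kappa$, depending only on $a$, such that it takes at most $\kappa n^3$ steps whenever $n_0,\dots,n_m\in\mathbb N_0$ satisfy $\dim M(i)\le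 a\,n_i$ and $\dim N(i)\le a\,n_i$ for $0\le i\le m$, and $n=\sum_{i=0}^m n_i>m$ (which holds for instance if all $n_i\ge1$). -/

import Mathlib

open CategoryTheory Polynomial DirectSum

universe u v

/-! ## A random access machine over a field

Programs manipulate natural numbers (in registers and in one-dimensional arrays) and elements of a
field `K` (in arrays with three indices).  The machine can only add and subtract natural numbers,
compare them, perform field operations, test a field element for zero, branch, and run counted
loops.  Every single operation takes one unit of time. -/

namespace FieldRAM

/-- Index expressions: literals, registers, array entries, sums and truncated differences. -/
inductive IExp (R A : Type) : Type
  | lit (n : ℕ)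
  | reg (x : R)
  | arr (a : A) (e : IExp R A)
  | add (e e' : IExp R A)
  | sub (e e' : IExp R A)

/-- Field expressions. -/
inductive FExp (R A F : Type) : Type
  | zero
  | cell (X : F) (i r c : IExp R A)
  | add (e e' : FExp R A F)
  | sub (e e' : FExp R A F)
  | mul (e e' : FExp R A F)
  | inv (e : FExp R A F)

/-- Boolean expressions. -/
inductive BExp (R A F : Type) : Type
  | eq (e e' : IExp R A)
  | isZero (e : FExp R A F)
  | not (b : BExp R A F)
  | and (b b' : BExp R A F)

/-- Programs.  `loop x e s` evaluates `e` once, to `N` say, and then runs `s` with the register `x`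
set to `0`, `1`, ..., `N - 1`. -/
inductive Prog (R A F : Type) : Type
  | skip
  | setReg (x : R) (e : IExp R A)
  | setArr (a : A) (e v : IExp R A)
  | setCell (X : F) (i r c : IExp R A) (v : FExp R A F)
  | seq (s t : Prog R A F)
  | ite (b : BExp R A F) (s t : Prog R A F)
  | loop (x : R) (e : IExp R A) (s : Prog R A F)

/-- The memory of the machine. -/
structure Store (K R A F : Type*) where
  reg : R → ℕ
  arr : A → ℕ → ℕ
  cell : F → ℕ → ℕ → ℕ → K

section Semantics

variable {K : Type u} [Field K] {R A F : Type}

def IExp.eval (σ : Store K R A F) : IExp R A → ℕ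
  | lit n => n
  | reg x => σ.reg x
  | arr a e => σ.arr a (e.eval σ)
  | add e e' => e.eval σ + e'.eval σ
  | sub e e' => e.eval σ - e'.eval σ

/-- The number of operations in an index expression. -/
def IExp.cost : IExp R A → ℕ
  | lit _ => 1
  | reg _ => 1
  | arr _ e => e.cost + 1
  | add e e' => e.cost + e'.cost + 1
  | sub e e' => e.cost + e'.cost + 1

def FExp.eval (σ : Store K R A F) : FExp R A F → K
  | zero => 0
  | cell X i r c => σ.cell X (i.eval σ) (r.eval σ) (c.eval σ)
  | add e e' => e.eval σ + e'.eval σ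
  | sub e e' => e.eval σ - e'.eval σ
  | mul e e' => e.eval σ * e'.eval σ
  | inv e => (e.eval σ)⁻¹

/-- The number of operations in a field expression. -/
def FExp.cost : FExp R A F → ℕ
  | zero => 1
  | cell _ i r c => i.cost + r.cost + c.cost + 1
  | add e e' => e.cost + e'.cost + 1
  | sub e e' => e.cost + e'.cost + 1
  | mul e e' => e.cost + e'.cost + 1
  | inv e => e.cost + 1

def BExp.eval [DecidableEq K] (σ : Store K R A F) : BExp R A F → Bool
  | eq e e' => decide (e.eval σ = e'.eval σ)
  | isZero e => decide (e.eval σ = 0)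
  | not b => !(b.eval σ)
  | and b b' => b.eval σ && b'.eval σ

/-- The number of operations in a Boolean expression. -/
def BExp.cost : BExp R A F → ℕ
  | eq e e' => e.cost + e'.cost + 1
  | isZero e => e.cost + 1
  | not b => b.cost + 1
  | and b b' => b.cost + b'.cost + 1

variable [DecidableEq R] [DecidableEq A] [DecidableEq F]

def Store.setReg (σ : Store K R A F) (x : R) (n : ℕ) : Store K R A F :=
  { σ with reg := fun y => if y = x then n else σ.reg y }

def Store.setArr (σ : Store K R A F) (a : A) (k n : ℕ) : Store K R A F :=
  { σ with arr := fun a' k' => if a' = a ∧ k' = k then n else σ.arr a' k' }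

def Store.setCell (σ : Store K R A F) (X : F) (i r c : ℕ) (z : K) : Store K R A F :=
  { σ with cell := fun X' i' r' c' =>
      if X' = X ∧ i' = i ∧ r' = r ∧ c' = c then z else σ.cell X' i' r' c' }

/-- `iterate f n σ` is `f (n - 1) (... (f 1 (f 0 σ)))`. -/
def iterate {S : Type*} (f : ℕ → S → S) : ℕ → S → S
  | 0, σ => σ
  | n + 1, σ => f n (iterate f n σ)

variable [DecidableEq K]

/-- The memory after running a program. -/
def Prog.exec : Prog R A F → Store K R A F → Store K R A F
  | skip, σ => σ
  | setReg x e, σ => σ.setReg x (e.eval σ)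
  | setArr a e v, σ => σ.setArr a (e.eval σ) (v.eval σ)
  | setCell X i r c v, σ => σ.setCell X (i.eval σ) (r.eval σ) (c.eval σ) (v.eval σ)
  | seq s t, σ => t.exec (s.exec σ)
  | ite b s t, σ => if b.eval σ then s.exec σ else t.exec σ
  | loop x e s, σ => iterate (fun k τ => s.exec (τ.setReg x k)) (e.eval σ) σ

/-- The number of steps that a program takes: all operations in the expressions that are evaluated,
and one step for every assignment, branching, entry of a loop and iteration of a loop. -/
def Prog.time : Prog R A F → Store K R A F → ℕ
  | skip, _ => 1
  | setReg _ e, _ => e.cost + 1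
  | setArr _ e v, _ => e.cost + v.cost + 1
  | setCell _ i r c v, _ => i.cost + r.cost + c.cost + v.cost + 1
  | seq s t, σ => s.time σ + t.time (s.exec σ)
  | ite b s t, σ => b.cost + 1 + if b.eval σ then s.time σ else t.time σ
  | loop x e s, σ => e.cost + 1 + ∑ k ∈ Finset.range (e.eval σ),
      (1 + s.time ((iterate (fun k τ => s.exec (τ.setReg x k)) k σ).setReg x k))

end Semantics

end FieldRAM

/-! ## The algorithm -/

namespace PresPersMod

open FieldRAM

/-- Registers.  `m` is the last index of the input, `i` the current index, `numCols` and `numRows`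
the size of the matrix `f₀` built so far, `oldCols` and `oldRows` its size before the current step;
the others are auxiliary. -/
inductive Reg : Type
  | m | i | numCols | numRows | oldCols | oldRows | j | k | l | q | r | s | cnt
  deriving DecidableEq

/-- Index arrays.
* `dimM[i]`, `dimN[i]`: the dimensions of `M i` and `N i`;
* `aliveM[j]`: the column of `f₀` that belongs to the `j`-th basis element of `M i`,
  `aliveN[j]`: the row of `f₀` that belongs to the `j`-th basis element of `N i`;
* `pivM[l] = j + 1` if row `l` of the reduced `A i` is the pivot row of column `j`, and
  `pivM[l] = 0` if it is not a pivot row; `lowM[j] = l + 1` in the first case, and `lowM[j] = 0` if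
  column `j` is zero; likewise `pivN`, `lowN` for `B i`;
* `ordM`, `ordN`: the new order of the basis of `M (i + 1)`, `N (i + 1)`;
* `birthCol`, `deathCol`, `birthRow`, `deathRow`: the annotations of `f₀`, where a death time `0`
  stands for `∞`. -/
inductive Arr : Type
  | dimM | dimN | aliveM | aliveN | pivM | pivN | lowM | lowN | ordM | ordN
  | birthCol | deathCol | birthRow | deathRow
  deriving DecidableEq

/-- Field arrays: the matrices `A i`, `B i`, `C i` (transformed in place), the matrix `f₀` (stored
at first index `0`), a temporary matrix and a temporary scalar. -/
inductive Mat : Type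
  | A | B | C | f₀ | tmp | scalar
  deriving DecidableEq

abbrev I := IExp Reg Arr
abbrev E := FExp Reg Arr Mat
abbrev P := Prog Reg Arr Mat

instance : Coe Reg I := ⟨IExp.reg⟩
instance (n : ℕ) : OfNat I n := ⟨IExp.lit n⟩
instance : Add I := ⟨IExp.add⟩
instance : Sub I := ⟨IExp.sub⟩
instance : Zero E := ⟨FExp.zero⟩
instance : Add E := ⟨FExp.add⟩
instance : Sub E := ⟨FExp.sub⟩
instance : Mul E := ⟨FExp.mul⟩
instance : Inv E := ⟨FExp.inv⟩

/-- Array entry. -/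
abbrev at' (a : Arr) (e : I) : I := IExp.arr a e

/-- The entry in row `r` and column `c` of the `i`-th matrix of the family `X`. -/
abbrev en (X : Mat) (i r c : I) : E := FExp.cell X i r c

/-- The temporary scalar. -/
abbrev sc : E := FExp.cell Mat.scalar 0 0 0

infixr:40 " ;; " => Prog.seq

/-- The next index. -/
abbrev next : I := (Reg.i : I) + 1

/-- In `X i`, with `n` rows: add `a` times column `src` to column `dst`. -/
def addCol (X : Mat) (i n : I) (a : E) (src dst : I) : P :=
  .loop Reg.s n (.setCell X i Reg.s dst (en X i Reg.s dst + a * en X i Reg.s src))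

/-- In `X i`, with `n` rows: subtract `a` times column `src` from column `dst`. -/
def subCol (X : Mat) (i n : I) (a : E) (src dst : I) : P :=
  .loop Reg.s n (.setCell X i Reg.s dst (en X i Reg.s dst - a * en X i Reg.s src))

/-- In `X i`, with `n` columns: add `a` times row `src` to row `dst`. -/
def addRow (X : Mat) (i n : I) (a : E) (src dst : I) : P :=
  .loop Reg.s n (.setCell X i dst Reg.s (en X i dst Reg.s + a * en X i src Reg.s))

/-- In `X i`, with `n` columns: subtract `a` times row `src` from row `dst`. -/
def subRow (X : Mat) (i n : I) (a : E) (src dst : I) : P :=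
  .loop Reg.s n (.setCell X i dst Reg.s (en X i dst Reg.s - a * en X i src Reg.s))

/-- In `X i`, with `n` rows: multiply column `c` by `a`. -/
def scaleCol (X : Mat) (i n : I) (a : E) (c : I) : P :=
  .loop Reg.s n (.setCell X i Reg.s c (a * en X i Reg.s c))

/-- In `X i`, with `n` columns: multiply row `r` by `a`. -/
def scaleRow (X : Mat) (i n : I) (a : E) (r : I) : P :=
  .loop Reg.s n (.setCell X i r Reg.s (a * en X i r Reg.s))

/-- Initialization at index `0`: every basis element of `M 0` and `N 0` starts a bar, and
`f₀ = C 0`. -/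
def start : P :=
  .setReg .numCols (at' .dimM 0) ;;
  .setReg .numRows (at' .dimN 0) ;;
  .loop .j (at' .dimM 0)
    (.setArr .aliveM Reg.j Reg.j ;; .setArr .birthCol Reg.j 0 ;; .setArr .deathCol Reg.j 0) ;;
  .loop .j (at' .dimN 0)
    (.setArr .aliveN Reg.j Reg.j ;; .setArr .birthRow Reg.j 0 ;; .setArr .deathRow Reg.j 0) ;;
  .loop .r (at' .dimN 0) (.loop .s (at' .dimM 0)
    (.setCell .f₀ 0 Reg.r Reg.s (en .C 0 Reg.r Reg.s)))

/-- Column reduction from left to right of the matrix `X i`, where the pivot of a column is its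
lowest nonzero entry.  Whenever `scalar` times column `q` is subtracted from column `j`, the
corresponding operation `op` on `f₀` is performed. -/
def reduce (X : Mat) (dim piv low : Arr) (op : P) : P :=
  .loop .l (at' dim next) (.setArr piv Reg.l 0) ;;
  .loop .j (at' dim Reg.i) (
    .setArr low Reg.j 0 ;;
    .loop .k (at' dim next) (
      .setReg .l (at' dim next - (Reg.k + 1)) ;;
      .ite (.and (.eq (at' low Reg.j) 0) (.not (.isZero (en X Reg.i Reg.l Reg.j))))
        (.ite (.eq (at' piv Reg.l) 0)
          (.setArr piv Reg.l (Reg.j + 1) ;; .setArr low Reg.j (Reg.l + 1))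
          (.setReg .q (at' piv Reg.l - 1) ;;
            .setCell .scalar 0 0 0 (en X Reg.i Reg.l Reg.j * (en X Reg.i Reg.l Reg.q)⁻¹) ;;
            subCol X Reg.i (at' dim next) sc Reg.q Reg.j ;;
            op))
        .skip))

/-- Column reduction of `A i` with the corresponding column operations on `f₀`. -/
def reduceM : P :=
  reduce .A .dimM .pivM .lowM
    (subCol .f₀ 0 Reg.numRows sc (at' .aliveM Reg.q) (at' .aliveM Reg.j))

/-- Column reduction of `B i` with the corresponding row operations on `f₀`. -/
def reduceN : P :=
  reduce .B .dimN .pivN .lowN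
    (addRow .f₀ 0 Reg.numCols sc (at' .aliveN Reg.j) (at' .aliveN Reg.q))

/-- The change of basis of `M (i + 1)` that corresponds to the row reduction of the reduced matrix
`A i`, performed on the columns of `A (i + 1)` and `C (i + 1)`. -/
def changeBasisM : P :=
  .loop .k (at' .dimM next) (
    .setReg .l (at' .dimM next - (Reg.k + 1)) ;;
    .ite (.eq (at' .pivM Reg.l) 0) .skip (
      .setReg .q (at' .pivM Reg.l - 1) ;;
      scaleCol .A next (at' .dimM (next + 1)) (en .A Reg.i Reg.l Reg.q) Reg.l ;;
      scaleCol .C next (at' .dimN next) (en .A Reg.i Reg.l Reg.q) Reg.l ;;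
      .loop .r Reg.l (
        addCol .A next (at' .dimM (next + 1)) (en .A Reg.i Reg.r Reg.q) Reg.r Reg.l ;;
        addCol .C next (at' .dimN next) (en .A Reg.i Reg.r Reg.q) Reg.r Reg.l)))

/-- The change of basis of `N (i + 1)` that corresponds to the row reduction of the reduced matrix
`B i`, performed on the columns of `B (i + 1)` and the rows of `C (i + 1)`. -/
def changeBasisN : P :=
  .loop .k (at' .dimN next) (
    .setReg .l (at' .dimN next - (Reg.k + 1)) ;;
    .ite (.eq (at' .pivN Reg.l) 0) .skip (
      .setReg .q (at' .pivN Reg.l - 1) ;;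
      scaleCol .B next (at' .dimN (next + 1)) (en .B Reg.i Reg.l Reg.q) Reg.l ;;
      scaleRow .C next (at' .dimM next) (en .B Reg.i Reg.l Reg.q)⁻¹ Reg.l ;;
      .loop .r Reg.l (
        addCol .B next (at' .dimN (next + 1)) (en .B Reg.i Reg.r Reg.q) Reg.r Reg.l ;;
        subRow .C next (at' .dimM next) (en .B Reg.i Reg.r Reg.q) Reg.l Reg.r)))

/-- Update of the bars: a zero column of the reduced matrix ends its bar at index `i + 1`, a nonzero
column continues its bar in the basis element of its pivot row, and every non-pivot row starts a
new bar at index `i + 1`.  This records the new order of the basis at index `i + 1`. -/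
def updateBars (dim alive piv low ord birth death : Arr) (num : Reg) : P :=
  .setReg .cnt 0 ;;
  .loop .j (at' dim Reg.i) (
    .ite (.eq (at' low Reg.j) 0)
      (.setArr death (at' alive Reg.j) next)
      (.setArr ord Reg.cnt (at' low Reg.j - 1) ;;
        .setArr alive Reg.cnt (at' alive Reg.j) ;;
        .setReg .cnt (Reg.cnt + 1))) ;;
  .loop .l (at' dim next) (
    .ite (.eq (at' piv Reg.l) 0)
      (.setArr ord Reg.cnt Reg.l ;;
        .setArr alive Reg.cnt num ;;
        .setArr birth num next ;;
        .setArr death num 0 ;;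
        .setReg num (num + 1) ;;
        .setReg .cnt (Reg.cnt + 1))
      .skip)

/-- Replace the `X (i + 1)`, of size `nr × nc`, by the matrix whose entry `(r, s)` is the old entry
`(row, col)`, where `row` and `col` are expressions in the registers `r` and `s`. -/
def permute (X : Mat) (nr nc row col : I) : P :=
  .loop .r nr (.loop .s nc (.setCell .tmp 0 Reg.r Reg.s (en X next row col))) ;;
  .loop .r nr (.loop .s nc (.setCell X next Reg.r Reg.s (en .tmp 0 Reg.r Reg.s)))

/-- Sort the bases of `M (i + 1)` and `N (i + 1)` by the order of `f₀`. -/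
def sortBases : P :=
  permute .A (at' .dimM (next + 1)) (at' .dimM next) Reg.r (at' .ordM Reg.s) ;;
  permute .B (at' .dimN (next + 1)) (at' .dimN next) Reg.r (at' .ordN Reg.s) ;;
  permute .C (at' .dimN next) (at' .dimM next) (at' .ordN Reg.r) (at' .ordM Reg.s)

/-- Append to `f₀` the rows and columns of the new bars.  The new rows vanish on the old columns;
the new columns are the last columns of the transformed `C (i + 1)`. -/
def extend : P :=
  .loop .j (Reg.numCols - Reg.oldCols) (.loop .s Reg.numRows
    (.setCell .f₀ 0 Reg.s (Reg.oldCols + Reg.j) 0)) ;;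
  .loop .j (Reg.numRows - Reg.oldRows) (.loop .s Reg.numCols
    (.setCell .f₀ 0 (Reg.oldRows + Reg.j) Reg.s 0)) ;;
  .loop .j (Reg.numCols - Reg.oldCols) (.loop .s (at' .dimN next)
    (.setCell .f₀ 0 (at' .aliveN Reg.s) (Reg.oldCols + Reg.j)
      (en .C next Reg.s (at' .dimM next - (Reg.numCols - Reg.oldCols) + Reg.j))))

/-- Moving from `i` to `i + 1`. -/
def step : P :=
  reduceM ;;
  reduceN ;;
  changeBasisM ;;
  changeBasisN ;;
  .setReg .oldCols Reg.numCols ;;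
  .setReg .oldRows Reg.numRows ;;
  updateBars .dimM .aliveM .pivM .lowM .ordM .birthCol .deathCol .numCols ;;
  updateBars .dimN .aliveN .pivN .lowN .ordN .birthRow .deathRow .numRows ;;
  sortBases ;;
  extend

/-- The algorithm **PresPersMod**. -/
def algorithm : P := start ;; .loop .i Reg.m step

/-- The initial memory: the number `m`, the dimensions `dM i`, `dN i` and the matrices `C i` for
`i ≤ m`, and the matrices `A i`, `B i` for `i < m`.  Everything else is zero. -/
def input {K : Type u} [Field K] (m : ℕ) (dM dN : ℕ → ℕ)
    (A : ∀ i, Matrix (Fin (dM (i + 1))) (Fin (dM i)) K)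
    (B : ∀ i, Matrix (Fin (dN (i + 1))) (Fin (dN i)) K)
    (C : ∀ i, Matrix (Fin (dN i)) (Fin (dM i)) K) : Store K Reg Arr Mat where
  reg
    | .m => m
    | _ => 0
  arr
    | .dimM, i => if i ≤ m then dM i else 0
    | .dimN, i => if i ≤ m then dN i else 0
    | _, _ => 0
  cell
    | .A, i, r, c => if h : i < m ∧ r < dM (i + 1) ∧ c < dM i
        then A i ⟨r, h.2.1⟩ ⟨c, h.2.2⟩ else 0
    | .B, i, r, c => if h : i < m ∧ r < dN (i + 1) ∧ c < dN i
        then B i ⟨r, h.2.1⟩ ⟨c, h.2.2⟩ else 0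
    | .C, i, r, c => if h : i ≤ m ∧ r < dN i ∧ c < dM i
        then C i ⟨r, h.2.1⟩ ⟨c, h.2.2⟩ else 0
    | _, _, _, _ => 0

end PresPersMod

/-- A matrix `f₀` over `K` in which every column and every row carries a birth time and a death
time. -/
structure AnnotatedMatrix (K : Type u) where
  cols : ℕ
  rows : ℕ
  f₀ : Matrix (Fin rows) (Fin cols) K
  birthCol : Fin cols → ℕ
  deathCol : Fin cols → ℕ∞
  birthRow : Fin rows → ℕ
  deathRow : Fin rows → ℕ∞

namespace PresPersMod

open FieldRAM

/-- A stored death time `0` stands for `∞`. -/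
def decodeDeath (n : ℕ) : ℕ∞ := if n = 0 then ⊤ else n

/-- The annotated matrix in the memory at the end of the algorithm. -/
def output {K : Type u} (σ : Store K Reg Arr Mat) : AnnotatedMatrix K where
  cols := σ.reg .numCols
  rows := σ.reg .numRows
  f₀ := Matrix.of fun r c => σ.cell .f₀ 0 r c
  birthCol c := σ.arr .birthCol c
  deathCol c := decodeDeath (σ.arr .deathCol c)
  birthRow r := σ.arr .birthRow r
  deathRow r := decodeDeath (σ.arr .deathRow r)

end PresPersMod

/-! ## Persistence modules and graded modules -/

namespace Persistence

noncomputable section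

variable {K : Type u} [Field K]

/-- A persistence module `M` is of finite type, with all maps from index `m` on being
isomorphisms. -/
def IsStableFrom (M : ℕ ⥤ FGModuleCat.{v} K) (m : ℕ) : Prop :=
  ∀ i j : ℕ, m ≤ i → ∀ h : i ≤ j, IsIso (M.map (homOfLE h))

/-- The linear map `M(i ≤ i + 1)`. -/
def stepMap (M : ℕ ⥤ FGModuleCat.{v} K) (i : ℕ) : M.obj i →ₗ[K] M.obj (i + 1) :=
  (M.map (homOfLE (Nat.le_succ i))).hom.hom

/-- The linear map `φ(i)`. -/
def component {M N : ℕ ⥤ FGModuleCat.{v} K} (φ : M ⟶ N) (i : ℕ) : M.obj i →ₗ[K] N.obj i :=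
  (φ.app i).hom.hom

theorem component_stepMap {M N : ℕ ⥤ FGModuleCat.{v} K} (φ : M ⟶ N) (i : ℕ) (x : M.obj i) :
    component φ (i + 1) (stepMap M i x) = stepMap N i (component φ i x) := by
  have h := congrArg (fun f => f.hom.hom x) (φ.naturality (homOfLE (Nat.le_succ i)))
  exact h

/-- Multiplication by `t` on `⨁ i, M i`. -/
def shift (M : ℕ ⥤ FGModuleCat.{v} K) : Module.End K (⨁ i, M.obj i) :=
  DirectSum.toModule K ℕ _ fun i => DirectSum.lof K ℕ (fun i => M.obj i) (i + 1) ∘ₗ stepMap M i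

/-- The graded `K[t]`-module `⨁ i, M i` of a persistence module `M`. -/
abbrev GradedModule (M : ℕ ⥤ FGModuleCat.{v} K) : Type v :=
  Module.AEval K (⨁ i, M.obj i) (shift M)

/-- The homogeneous elements of degree `i` of `⨁ i, M i`. -/
def degreePart (M : ℕ ⥤ FGModuleCat.{v} K) (i : ℕ) : Set (GradedModule M) :=
  Set.range fun x : M.obj i =>
    Module.AEval.of K (⨁ i, M.obj i) (shift M) (DirectSum.lof K ℕ (fun i => M.obj i) i x)

theorem lmap_shift {M N : ℕ ⥤ FGModuleCat.{v} K} (φ : M ⟶ N) (x : ⨁ i, M.obj i) :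
    DirectSum.lmap (component φ) (shift M x) = shift N (DirectSum.lmap (component φ) x) := by
  have h : DirectSum.lmap (component φ) ∘ₗ shift M = shift N ∘ₗ DirectSum.lmap (component φ) := by
    refine DirectSum.linearMap_ext K fun i => ?_
    ext x : 1
    simp [shift, component_stepMap]
  exact LinearMap.congr_fun h x

/-- The morphism of graded `K[t]`-modules of a morphism of persistence modules. -/
def gradedMap {M N : ℕ ⥤ FGModuleCat.{v} K} (φ : M ⟶ N) :
    GradedModule M →ₗ[K[X]] GradedModule N :=
  LinearMap.ofAEval (shift M)
    ((Module.AEval.of K (⨁ i, N.obj i) (shift N)).toLinearMap ∘ₗ DirectSum.lmap (component φ))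
    (fun x => by
      rw [LinearMap.comp_apply, LinearMap.comp_apply, LinearEquiv.coe_coe, Module.AEval.X_smul_of]
      exact congrArg _ (lmap_shift φ x))

/-- The homogeneous elements of degree `i` of the free graded `K[t]`-module `ι → K[t]` in which the
`j`-th generator has degree `b j`. -/
def freeDegreePart {ι : Type*} (b : ι → ℕ) (i : ℕ) : Set (ι → K[X]) :=
  {x | ∀ j k, (x j).coeff k ≠ 0 → b j + k = i}

/-- A map between graded modules that preserves the degree. -/
def IsHomogeneous {V W : Type*} (G : ℕ → Set V) (H : ℕ → Set W) (f : V → W) : Prop :=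
  ∀ i, ∀ x ∈ G i, f x ∈ H i

/-- The initial memory of **PresPersMod** for a morphism `φ : M ⟶ N` of persistence modules that is
given up to index `m` by matrices with respect to bases of the `M i` and `N i`. -/
def matrixInput {M N : ℕ ⥤ FGModuleCat.{v} K} (φ : M ⟶ N) (m : ℕ) {dM dN : ℕ → ℕ}
    (βM : ∀ i, Module.Basis (Fin (dM i)) K (M.obj i))
    (βN : ∀ i, Module.Basis (Fin (dN i)) K (N.obj i)) :
    FieldRAM.Store K PresPersMod.Reg PresPersMod.Arr PresPersMod.Mat :=
  PresPersMod.input m dM dN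
    (fun i => LinearMap.toMatrix (βM i) (βM (i + 1)) (stepMap M i))
    (fun i => LinearMap.toMatrix (βN i) (βN (i + 1)) (stepMap N i))
    (fun i => LinearMap.toMatrix (βM i) (βN i) (component φ i))

end

end Persistence

/-! ## Canonical presentations -/

namespace AnnotatedMatrix

open Persistence

noncomputable section

variable {K : Type u} [Field K] (F : AnnotatedMatrix K)

/-- The columns and rows with a relation, that is, with a finite death time. -/
abbrev FiniteCol : Type := {c : Fin F.cols // F.deathCol c ≠ ⊤}
abbrev FiniteRow : Type := {r : Fin F.rows // F.deathRow r ≠ ⊤}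

/-- Generators `P₀`, `Q₀` and relations `P₁`, `Q₁`. -/
abbrev P₀ : Type u := Fin F.cols → K[X]
abbrev P₁ : Type u := F.FiniteCol → K[X]
abbrev Q₀ : Type u := Fin F.rows → K[X]
abbrev Q₁ : Type u := F.FiniteRow → K[X]

abbrev degP₀ : ℕ → Set F.P₀ := freeDegreePart F.birthCol
abbrev degP₁ : ℕ → Set F.P₁ := freeDegreePart fun g => (F.deathCol g.1).toNat
abbrev degQ₀ : ℕ → Set F.Q₀ := freeDegreePart F.birthRow
abbrev degQ₁ : ℕ → Set F.Q₁ := freeDegreePart fun h => (F.deathRow h.1).toNat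

/-- The relation of the column `c` is mapped to `t ^ (d c - b c)` times the generator `c`. -/
def p : F.P₁ →ₗ[K[X]] F.P₀ :=
  Matrix.toLin' (Matrix.of fun c g =>
    if c = g.1 then X ^ ((F.deathCol g.1).toNat - F.birthCol g.1) else 0)

def q : F.Q₁ →ₗ[K[X]] F.Q₀ :=
  Matrix.toLin' (Matrix.of fun r h =>
    if r = h.1 then X ^ ((F.deathRow h.1).toNat - F.birthRow h.1) else 0)

/-- The generator `c` is mapped to the sum of `f₀ r c * t ^ (b c - b r)` times the generator `r`. -/
def genMap : F.P₀ →ₗ[K[X]] F.Q₀ :=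
  Matrix.toLin' (Matrix.of fun r c => C (F.f₀ r c) * X ^ (F.birthCol c - F.birthRow r))

/-- `P₀ ← P₁` and `Q₀ ← Q₁`, which are direct sums of elementary presentations
`𝕀[b,∞) ← 𝕀[d,∞)` (or `𝕀[b,∞) ← 0` if `d = ∞`) with `b < d`, together with `f₀` and some `f₁` form a
commutative diagram of graded `K[t]`-modules

`0 ← M ← P₀ ← P₁`
`    ↓    ↓    ↓`
`0 ← N ← Q₀ ← Q₁`

with exact rows, whose left vertical map is `φ`. -/
def IsCanonicalPresentation {M N : ℕ ⥤ FGModuleCat.{v} K} (φ : M ⟶ N) : Prop :=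
  (∀ c, (F.birthCol c : ℕ∞) < F.deathCol c) ∧
  (∀ r, (F.birthRow r : ℕ∞) < F.deathRow r) ∧
  IsHomogeneous F.degP₁ F.degP₀ F.p ∧
  IsHomogeneous F.degQ₁ F.degQ₀ F.q ∧
  IsHomogeneous F.degP₀ F.degQ₀ F.genMap ∧
  ∃ (f₁ : F.P₁ →ₗ[K[X]] F.Q₁) (μ : F.P₀ →ₗ[K[X]] GradedModule M)
    (ν : F.Q₀ →ₗ[K[X]] GradedModule N),
    IsHomogeneous F.degP₁ F.degQ₁ f₁ ∧
    IsHomogeneous F.degP₀ (degreePart M) μ ∧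
    IsHomogeneous F.degQ₀ (degreePart N) ν ∧
    F.genMap ∘ₗ F.p = F.q ∘ₗ f₁ ∧
    gradedMap φ ∘ₗ μ = ν ∘ₗ F.genMap ∧
    Function.Surjective μ ∧ Function.Exact F.p μ ∧
    Function.Surjective ν ∧ Function.Exact F.q ν

/-- The bars (columns, rows) that are present at index `i`. -/
abbrev ActiveCol (i : ℕ) : Type :=
  {c : Fin F.cols // F.birthCol c ≤ i ∧ (i : ℕ∞) < F.deathCol c}
abbrev ActiveRow (i : ℕ) : Type :=
  {r : Fin F.rows // F.birthRow r ≤ i ∧ (i : ℕ∞) < F.deathRow r}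

/-- `M` and `N` are isomorphic to the direct sums of the interval modules `𝕀[b,d)` of the columns
and of the rows, and under such isomorphisms `φ` maps bars to bars with the coefficients `f₀`. -/
def IsBarDecomposition {M N : ℕ ⥤ FGModuleCat.{v} K} (φ : M ⟶ N) : Prop :=
  ∃ (eM : ∀ i, M.obj i ≃ₗ[K] (F.ActiveCol i → K)) (eN : ∀ i, N.obj i ≃ₗ[K] (F.ActiveRow i → K)),
    (∀ i (x : M.obj i) (c : F.ActiveCol (i + 1)), eM (i + 1) (stepMap M i x) c =
      if h : F.birthCol c.1 ≤ i ∧ (i : ℕ∞) < F.deathCol c.1 then eM i x ⟨c.1, h⟩ else 0) ∧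
    (∀ i (y : N.obj i) (r : F.ActiveRow (i + 1)), eN (i + 1) (stepMap N i y) r =
      if h : F.birthRow r.1 ≤ i ∧ (i : ℕ∞) < F.deathRow r.1 then eN i y ⟨r.1, h⟩ else 0) ∧
    (∀ i (x : M.obj i) (r : F.ActiveRow i), eN i (component φ i x) r =
      ∑ c : F.ActiveCol i, F.f₀ r.1 c.1 * eM i x c)

end

end AnnotatedMatrix

set_option linter.unusedSectionVars false

/-! ## Reasoning about programs -/

namespace FieldRAM

section Programs

variable {K : Type u} [Field K] {R A F : Type}
variable [DecidableEq R] [DecidableEq A] [DecidableEq F]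

/-! Every bar `c` is represented by its generator, a family `G c k` of elements of all the `M k`
that vanishes before the birth, is carried along by the structure maps and vanishes from the death
on. When the algorithm has reached index `i`, three facts hold (`Bars`, `Relates`, `SideInvariant`).
At each index `k ≤ i` the generators span, and as many bars are present as the dimension says. From
the birth of `c` on, `φ` sends `G c k` to `∑ r, f₀ r c • H r k`. The current matrices describe the
next structure maps on the living generators, while the later matrices still refer to the given
bases. Independence is not carried along: at the end it follows from spanning and counting
(`Bars.isBarBasis`), and beyond `m` the basis is transported by isomorphisms.

A column operation subtracts a multiple of a living bar `q` from a living bar `j` further right.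
Living bars are listed by age, so `q` already exists when `j` is born, and the difference is a
legitimate generator (`Bars.subBar`). On `f₀` this is the same column operation for `M`
(`Relates.subCol`) and the contragredient row operation for `N` (`Relates.addRow`). After the
reduction the zero columns are the dying bars, and the nonzero columns have distinct lowest entries.
Replacing the basis vector of each pivot row by its column is therefore a triangular change of basis
at `i + 1`, whose members are continuations of old bars and generators of new ones
(`appendBars_alive`, `Bars.append`). Transforming the matrices at `i + 1` accordingly
(`iterate_colStep`, `iterate_cStep`) restores the invariant (`Invariant.step`). Old columns of `f₀`
stay valid by naturality, and the new columns are read off from the transformed `C (i + 1)`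
(`Relates.advance`).

A barcode with generators yields a presentation: the generators of bars generate, and the only
relations are `t ^ (d - b)` times a generator (`IsBarBasis.exact`). Lifting `φ` to relations needs
`d r ≤ d c` whenever `f₀ r c ≠ 0`. This is automatic: evaluate the formula for `φ` at the death of
`c` (`deathRow_le`). Then `f₁` has the same scalars as `f₀`.

For the running time, the loops of a step are nested at most three deep. The outermost one is
bounded by the dimensions near `i` and the inner ones by the total dimension `S`, which also bounds
the size of `f₀`. The outer bounds add up to `O(S + m)` over all steps, which gives a cubic bound.
Programs are handled by three general tools: a frame rule (`Frame.exec`), an induction rule for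
loops (`Prog.exec_loop_induction`) and a syntactic time bound (`Prog.Bounded.exec_time`). -/

@[simp] theorem Store.setReg_reg (σ : Store K R A F) (x : R) (n : ℕ) (y : R) :
    (σ.setReg x n).reg y = if y = x then n else σ.reg y := rfl
@[simp] theorem Store.setReg_arr (σ : Store K R A F) (x : R) (n : ℕ) :
    (σ.setReg x n).arr = σ.arr := rfl
@[simp] theorem Store.setReg_cell (σ : Store K R A F) (x : R) (n : ℕ) :
    (σ.setReg x n).cell = σ.cell := rfl
@[simp] theorem Store.setArr_reg (σ : Store K R A F) (a : A) (k n : ℕ) :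
    (σ.setArr a k n).reg = σ.reg := rfl
@[simp] theorem Store.setArr_arr (σ : Store K R A F) (a : A) (k n : ℕ) (a' : A) (k' : ℕ) :
    (σ.setArr a k n).arr a' k' = if a' = a ∧ k' = k then n else σ.arr a' k' := rfl
@[simp] theorem Store.setArr_cell (σ : Store K R A F) (a : A) (k n : ℕ) :
    (σ.setArr a k n).cell = σ.cell := rfl
@[simp] theorem Store.setCell_reg (σ : Store K R A F) (X : F) (i r c : ℕ) (z : K) :
    (σ.setCell X i r c z).reg = σ.reg := rfl
@[simp] theorem Store.setCell_arr (σ : Store K R A F) (X : F) (i r c : ℕ) (z : K) :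
    (σ.setCell X i r c z).arr = σ.arr := rfl
@[simp] theorem Store.setCell_cell (σ : Store K R A F) (X : F) (i r c : ℕ) (z : K)
    (X' : F) (i' r' c' : ℕ) : (σ.setCell X i r c z).cell X' i' r' c' =
      if X' = X ∧ i' = i ∧ r' = r ∧ c' = c then z else σ.cell X' i' r' c' := rfl

/-- Whether a program may write to a given register. -/
def Prog.wReg : Prog R A F → R → Bool
  | .setReg x _, y => decide (y = x)
  | .seq s t, y => s.wReg y || t.wReg y
  | .ite _ s t, y => s.wReg y || t.wReg y
  | .loop x _ s, y => decide (y = x) || s.wReg y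
  | _, _ => false

/-- Whether a program may write to a given index array. -/
def Prog.wArr : Prog R A F → A → Bool
  | .setArr a _ _, b => decide (b = a)
  | .seq s t, b => s.wArr b || t.wArr b
  | .ite _ s t, b => s.wArr b || t.wArr b
  | .loop _ _ s, b => s.wArr b
  | _, _ => false

/-- Whether a program may write to a given field array. -/
def Prog.wCell : Prog R A F → F → Bool
  | .setCell X _ _ _ _, Y => decide (Y = X)
  | .seq s t, Y => s.wCell Y || t.wCell Y
  | .ite _ s t, Y => s.wCell Y || t.wCell Y
  | .loop _ _ s, Y => s.wCell Y
  | _, _ => false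

/-- Two memories agree on everything that the program does not write to. -/
structure Frame (p : Prog R A F) (σ τ : Store K R A F) : Prop where
  reg : ∀ y, p.wReg y = false → τ.reg y = σ.reg y
  arr : ∀ a, p.wArr a = false → τ.arr a = σ.arr a
  cell : ∀ X, p.wCell X = false → τ.cell X = σ.cell X

theorem Frame.refl (p : Prog R A F) (σ : Store K R A F) : Frame p σ σ :=
  ⟨fun _ _ => rfl, fun _ _ => rfl, fun _ _ => rfl⟩

theorem Frame.trans {p : Prog R A F} {σ τ ρ : Store K R A F} (h : Frame p σ τ)
    (h' : Frame p τ ρ) : Frame p σ ρ :=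
  ⟨fun y hy => (h'.reg y hy).trans (h.reg y hy), fun y hy => (h'.arr y hy).trans (h.arr y hy),
    fun y hy => (h'.cell y hy).trans (h.cell y hy)⟩

theorem iterate_succ {S : Type*} (f : ℕ → S → S) (n : ℕ) (σ : S) :
    iterate f (n + 1) σ = f n (iterate f n σ) := rfl

theorem iterate_induction {S : Type*} (f : ℕ → S → S) (I : ℕ → S → Prop) {N : ℕ} {σ : S}
    (h0 : I 0 σ) (hs : ∀ k < N, ∀ τ, I k τ → I (k + 1) (f k τ)) : I N (iterate f N σ) := by
  induction N with
  | zero => exact h0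
  | succ n ih =>
    exact hs n n.lt_succ_self _ (ih fun k hk => hs k (hk.trans n.lt_succ_self))

variable [DecidableEq K]

theorem Prog.exec_seq (s t : Prog R A F) (σ : Store K R A F) :
    (Prog.seq s t).exec σ = t.exec (s.exec σ) := rfl
theorem Prog.exec_setReg (x : R) (e : IExp R A) (σ : Store K R A F) :
    (Prog.setReg x e : Prog R A F).exec σ = σ.setReg x (e.eval σ) := rfl
theorem Prog.exec_setArr (a : A) (e v : IExp R A) (σ : Store K R A F) :
    (Prog.setArr a e v : Prog R A F).exec σ = σ.setArr a (e.eval σ) (v.eval σ) := rfl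
theorem Prog.exec_setCell (X : F) (i r c : IExp R A) (v : FExp R A F) (σ : Store K R A F) :
    (Prog.setCell X i r c v).exec σ =
      σ.setCell X (i.eval σ) (r.eval σ) (c.eval σ) (v.eval σ) := rfl
theorem Prog.exec_ite (b : BExp R A F) (s t : Prog R A F) (σ : Store K R A F) :
    (Prog.ite b s t).exec σ = if b.eval σ then s.exec σ else t.exec σ := rfl
theorem Prog.time_seq (s t : Prog R A F) (σ : Store K R A F) :
    (Prog.seq s t).time σ = s.time σ + t.time (s.exec σ) := rfl

/-- Since the sets of written registers and arrays are computed from the syntax, the question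
whether some piece of the algorithm leaves a datum alone is settled later by `rfl`. -/
theorem Frame.exec (p : Prog R A F) (σ : Store K R A F) : Frame p σ (p.exec σ) := by
  induction p generalizing σ with
  | skip => exact Frame.refl _ _
  | setReg x e =>
    refine ⟨fun y hy => ?_, fun _ _ => rfl, fun _ _ => rfl⟩
    simp [Prog.wReg] at hy
    simp [Prog.exec, hy]
  | setArr a e v =>
    refine ⟨fun _ _ => rfl, fun y hy => ?_, fun _ _ => rfl⟩
    simp [Prog.wArr] at hy
    funext k
    simp [Prog.exec, hy]
  | setCell X i r c v =>
    refine ⟨fun _ _ => rfl, fun _ _ => rfl, fun y hy => ?_⟩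
    simp [Prog.wCell] at hy
    funext i r c
    simp [Prog.exec, hy]
  | seq s t hs ht =>
    refine ⟨fun y hy => ?_, fun y hy => ?_, fun y hy => ?_⟩
    · simp [Prog.wReg] at hy
      exact ((ht _).reg y hy.2).trans ((hs _).reg y hy.1)
    · simp [Prog.wArr] at hy
      exact ((ht _).arr y hy.2).trans ((hs _).arr y hy.1)
    · simp [Prog.wCell] at hy
      exact ((ht _).cell y hy.2).trans ((hs _).cell y hy.1)
  | ite b s t hs ht =>
    refine ⟨fun y hy => ?_, fun y hy => ?_, fun y hy => ?_⟩
    · simp [Prog.wReg] at hy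
      simp only [Prog.exec]
      split_ifs
      exacts [(hs _).reg y hy.1, (ht _).reg y hy.2]
    · simp [Prog.wArr] at hy
      simp only [Prog.exec]
      split_ifs
      exacts [(hs _).arr y hy.1, (ht _).arr y hy.2]
    · simp [Prog.wCell] at hy
      simp only [Prog.exec]
      split_ifs
      exacts [(hs _).cell y hy.1, (ht _).cell y hy.2]
  | loop x e s hs =>
    refine iterate_induction _ (fun _ τ => Frame (Prog.loop x e s) σ τ) (Frame.refl _ _)
      fun k _ τ hτ => hτ.trans ⟨fun y hy => ?_, fun y hy => ?_, fun y hy => ?_⟩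
    · simp [Prog.wReg] at hy
      exact ((hs _).reg y hy.2).trans (by simp [hy.1])
    · exact (hs _).arr y hy
    · exact (hs _).cell y hy

/-- The induction rule for loops. -/
theorem Prog.exec_loop_induction {x : R} {e : IExp R A} {s : Prog R A F} {σ : Store K R A F}
    (I : ℕ → Store K R A F → Prop) {N : ℕ} (hN : e.eval σ = N) (h0 : I 0 σ)
    (hs : ∀ k < N, ∀ τ, Frame (Prog.loop x e s) σ τ → I k τ → I (k + 1) (s.exec (τ.setReg x k))) :
    I N ((Prog.loop x e s).exec σ) := by
  subst hN
  have key := iterate_induction (fun k (τ : Store K R A F) => s.exec (τ.setReg x k))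
    (fun k τ => Frame (Prog.loop x e s) σ τ ∧ I k τ) (N := e.eval σ) (σ := σ) ⟨Frame.refl _ _, h0⟩
    fun k hk τ hτ => ⟨hτ.1.trans ⟨fun y hy => ?_, fun y hy => ?_, fun y hy => ?_⟩,
      hs k hk τ hτ.1 hτ.2⟩
  · exact key.2
  · simp [Prog.wReg] at hy
    exact ((Frame.exec s _).reg y hy.2).trans (by simp [hy.1])
  · exact (Frame.exec s _).arr y hy
  · exact (Frame.exec s _).cell y hy

/-- A loop that assigns cells at pairwise different positions of one matrix. -/
theorem Prog.exec_loop_setCell {x : R} {e : IExp R A} {X : F} {i r c : IExp R A}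
    {w : FExp R A F} {σ : Store K R A F} {N : ℕ} (hN : e.eval σ = N) (i₀ : ℕ) (ρ γ : ℕ → ℕ)
    (val : ℕ → K)
    (h : ∀ k < N, ∀ τ : Store K R A F, (∀ y, y ≠ x → τ.reg y = σ.reg y) → τ.reg x = k →
      τ.arr = σ.arr →
      (∀ Y j a b, (∀ k' < k, ¬ (Y = X ∧ j = i₀ ∧ a = ρ k' ∧ b = γ k')) →
        τ.cell Y j a b = σ.cell Y j a b) →
      i.eval τ = i₀ ∧ r.eval τ = ρ k ∧ c.eval τ = γ k ∧ w.eval τ = val k)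
    (hinj : ∀ k k', k < k' → k' < N → ¬ (ρ k = ρ k' ∧ γ k = γ k')) :
    (∀ k < N, ((Prog.loop x e (.setCell X i r c w)).exec σ).cell X i₀ (ρ k) (γ k) = val k) ∧
    (∀ Y j a b, (∀ k' < N, ¬ (Y = X ∧ j = i₀ ∧ a = ρ k' ∧ b = γ k')) →
      ((Prog.loop x e (.setCell X i r c w)).exec σ).cell Y j a b = σ.cell Y j a b) := by
  have key := Prog.exec_loop_induction (x := x) (e := e) (s := .setCell X i r c w) (σ := σ)
    (fun n τ => (∀ k < n, τ.cell X i₀ (ρ k) (γ k) = val k) ∧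
      ∀ Y j a b, (∀ k' < n, ¬ (Y = X ∧ j = i₀ ∧ a = ρ k' ∧ b = γ k')) →
      τ.cell Y j a b = σ.cell Y j a b) hN ⟨by simp, by simp⟩ ?_
  · exact key
  intro n hn τ hF hτ
  obtain ⟨h1, h2, h3, h4⟩ := h n hn (τ.setReg x n)
    (fun y hy => by simpa [hy] using hF.reg y (by simp [Prog.wReg, hy])) (by simp)
    (by funext a; simpa using hF.arr a rfl) (by simpa using hτ.2)
  simp only [Prog.exec, h1, h2, h3, h4]
  refine ⟨fun k hk => ?_, fun Y j a b hb => ?_⟩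
  · rcases Nat.lt_succ_iff_lt_or_eq.1 hk with hk | rfl
    -- The positions are distinct, so this round does not overwrite an earlier result.
    · have := hinj k n hk hn
      simp [this, hτ.1 k hk]
    · simp
  · have := hb n n.lt_succ_self
    simp only [Store.setCell_cell, this, if_false, Store.setReg_cell]
    exact hτ.2 _ _ _ _ fun k' hk' => hb k' (hk'.trans n.lt_succ_self)

/-! ### Time bounds -/

/-- The time of a program if every loop were run at most once. -/
def Prog.size : Prog R A F → ℕ
  | .skip => 1
  | .setReg _ e => e.cost + 1
  | .setArr _ e v => e.cost + v.cost + 1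
  | .setCell _ i r c v => i.cost + r.cost + c.cost + v.cost + 1
  | .seq s t => s.size + t.size
  | .ite b s t => b.cost + 1 + (s.size + t.size)
  | .loop _ e s => e.cost + 1 + (1 + s.size)

theorem Prog.size_seq (s t : Prog R A F) : (Prog.seq s t).size = s.size + t.size := rfl

/-- `I` is an invariant of the program, and under this invariant loops of nesting depth `k` run at
most `L[k]` times. -/
def Prog.Bounded (I : Store K R A F → Prop) : List ℕ → Prog R A F → Prop
  | _, .skip => True
  | _, .setReg x e => ∀ σ, I σ → I (σ.setReg x (e.eval σ))
  | _, .setArr a e v => ∀ σ, I σ → I (σ.setArr a (e.eval σ) (v.eval σ))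
  | _, .setCell X i r c v =>
      ∀ σ, I σ → I (σ.setCell X (i.eval σ) (r.eval σ) (c.eval σ) (v.eval σ))
  | L, .seq s t => s.Bounded I L ∧ t.Bounded I L
  | L, .ite _ s t => s.Bounded I L ∧ t.Bounded I L
  | L, .loop x e s => s.Bounded I L.tail ∧
      ∀ σ, I σ → e.eval σ ≤ L.headD 0 ∧ ∀ k < L.headD 0, I (σ.setReg x k)

/-- Each level of nesting contributes one factor: the rounds and the entry of a loop together cost
at most `L[k] + 1` times the body with its overhead. Sequencing and branching keep this factor, so
the static `size` is the only other constant. -/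
theorem Prog.Bounded.exec_time {I : Store K R A F → Prop} {L : List ℕ} {p : Prog R A F}
    (hp : p.Bounded I L) {σ : Store K R A F} (hσ : I σ) :
    I (p.exec σ) ∧ p.time σ ≤ p.size * (L.map (· + 1)).prod := by
  have one_le : ∀ L : List ℕ, 1 ≤ (L.map (· + 1)).prod := fun L =>
    Nat.one_le_iff_ne_zero.2 (by simp [List.prod_eq_zero_iff])
  induction p generalizing σ L with
  | skip => exact ⟨hσ, by simpa [Prog.time, Prog.size] using one_le L⟩
  | setReg x e => exact ⟨hp σ hσ, Nat.le_mul_of_pos_right _ (one_le L)⟩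
  | setArr a e w => exact ⟨hp σ hσ, Nat.le_mul_of_pos_right _ (one_le L)⟩
  | setCell X i r c w => exact ⟨hp σ hσ, Nat.le_mul_of_pos_right _ (one_le L)⟩
  | seq s t hs ht =>
    have h1 := hs hp.1 hσ
    have h2 := ht hp.2 h1.1
    refine ⟨h2.1, ?_⟩
    simp only [Prog.time, Prog.size, add_mul]
    exact add_le_add h1.2 h2.2
  | ite b s t hs ht =>
    have h1 := hs hp.1 hσ
    have h2 := ht hp.2 hσ
    refine ⟨by simp only [Prog.exec]; split_ifs; exacts [h1.1, h2.1], ?_⟩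
    simp only [Prog.time, Prog.size]
    have h3 : b.cost + 1 ≤ (b.cost + 1) * (L.map (· + 1)).prod :=
      Nat.le_mul_of_pos_right _ (one_le L)
    rw [add_mul, add_mul s.size]
    split_ifs
    · have := h1.2; omega
    · have := h2.2; omega
  | loop x e s hs =>
    have hN := (hp.2 σ hσ).1
    have hI : ∀ k ≤ e.eval σ,
        I (iterate (fun k (τ : Store K R A F) => s.exec (τ.setReg x k)) k σ) := fun k hk =>
      iterate_induction _ (fun _ τ => I τ) hσ fun k' hk' τ hτ =>
        (hs hp.1 ((hp.2 τ hτ).2 k' (by omega))).1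
    refine ⟨hI _ le_rfl, ?_⟩
    simp only [Prog.time, Prog.size]
    have hsum : ∑ k ∈ Finset.range (e.eval σ), (1 + s.time
        ((iterate (fun k (τ : Store K R A F) => s.exec (τ.setReg x k)) k σ).setReg x k)) ≤
        e.eval σ * (1 + s.size * (L.tail.map (· + 1)).prod) := by
      refine (Finset.sum_le_card_nsmul _ _ (1 + s.size * (L.tail.map (· + 1)).prod)
        fun k hk => ?_).trans_eq (by simp)
      have hk := Finset.mem_range.1 hk
      exact Nat.add_le_add_left (hs hp.1 ((hp.2 _ (hI k hk.le)).2 k (by omega))).2 1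
    have h1 := one_le L.tail
    cases L with
    -- If no bound is left, `headD` defaults to `0` and the loop performs no round.
    | nil =>
      simp only [List.headD_nil, Nat.le_zero] at hN
      simp [hN]
    | cons a L =>
      simp only [List.headD_cons, List.tail_cons, List.map_cons, List.prod_cons] at *
      generalize (L.map (· + 1)).prod = q at *
      have : e.eval σ * (1 + s.size * q) ≤ a * (1 + s.size * q) := Nat.mul_le_mul_right _ hN
      nlinarith [Nat.zero_le (e.cost * q), Nat.zero_le (a * (q - 1)), Nat.mul_le_mul_left a h1,
        Nat.mul_le_mul_left e.cost h1, Nat.zero_le (e.cost * a * q), Nat.zero_le (s.size * q)]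

end Programs

end FieldRAM

/-! ### Evaluation of expressions, and a uniform treatment of the two modules -/

namespace PresPersMod

open FieldRAM

variable {K : Type u} [Field K] [DecidableEq K]

@[simp] theorem eval_lit (σ : Store K Reg Arr Mat) (n : ℕ) :
    IExp.eval σ (IExp.lit n : I) = n := rfl
@[simp] theorem eval_zero (σ : Store K Reg Arr Mat) : IExp.eval σ (0 : I) = 0 := rfl
@[simp] theorem eval_one (σ : Store K Reg Arr Mat) : IExp.eval σ (1 : I) = 1 := rfl
@[simp] theorem eval_reg (σ : Store K Reg Arr Mat) (x : Reg) :
    IExp.eval σ (IExp.reg x : I) = σ.reg x := rfl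
@[simp] theorem eval_arr (σ : Store K Reg Arr Mat) (a : Arr) (e : I) :
    IExp.eval σ (IExp.arr a e : I) = σ.arr a (e.eval σ) := rfl
@[simp] theorem eval_add (σ : Store K Reg Arr Mat) (e e' : I) :
    IExp.eval σ (e + e') = e.eval σ + e'.eval σ := rfl
@[simp] theorem eval_sub (σ : Store K Reg Arr Mat) (e e' : I) :
    IExp.eval σ (e - e') = e.eval σ - e'.eval σ := rfl
@[simp] theorem feval_zero (σ : Store K Reg Arr Mat) : FExp.eval σ (0 : E) = 0 := rfl
@[simp] theorem feval_cell (σ : Store K Reg Arr Mat) (X : Mat) (i r c : I) :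
    FExp.eval σ (FExp.cell X i r c : E) = σ.cell X (i.eval σ) (r.eval σ) (c.eval σ) := rfl
@[simp] theorem feval_add (σ : Store K Reg Arr Mat) (e e' : E) :
    FExp.eval σ (e + e') = e.eval σ + e'.eval σ := rfl
@[simp] theorem feval_sub (σ : Store K Reg Arr Mat) (e e' : E) :
    FExp.eval σ (e - e') = e.eval σ - e'.eval σ := rfl
@[simp] theorem feval_mul (σ : Store K Reg Arr Mat) (e e' : E) :
    FExp.eval σ (e * e') = e.eval σ * e'.eval σ := rfl
@[simp] theorem feval_inv (σ : Store K Reg Arr Mat) (e : E) :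
    FExp.eval σ (e⁻¹) = (e.eval σ)⁻¹ := rfl

/-- The two persistence modules. -/
inductive Side : Type
  | M | N

namespace Side

def X : Side → Mat | M => .A | N => .B
def dim : Side → Arr | M => .dimM | N => .dimN
def alive : Side → Arr | M => .aliveM | N => .aliveN
def piv : Side → Arr | M => .pivM | N => .pivN
def low : Side → Arr | M => .lowM | N => .lowN
def ord : Side → Arr | M => .ordM | N => .ordN
def birth : Side → Arr | M => .birthCol | N => .birthRow
def death : Side → Arr | M => .deathCol | N => .deathRow
def num : Side → Reg | M => .numCols | N => .numRows

/-- The operation on `f₀` that corresponds to a column operation on the matrix. -/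
def op : Side → P
  | M => subCol .f₀ 0 Reg.numRows sc (at' .aliveM Reg.q) (at' .aliveM Reg.j)
  | N => addRow .f₀ 0 Reg.numCols sc (at' .aliveN Reg.j) (at' .aliveN Reg.q)

def reduce (sd : Side) : P := PresPersMod.reduce sd.X sd.dim sd.piv sd.low sd.op

/-- The first loop of the update of the bars. -/
def keepBars (sd : Side) : P :=
  .loop .j (at' sd.dim Reg.i) (
    .ite (.eq (at' sd.low Reg.j) 0)
      (.setArr sd.death (at' sd.alive Reg.j) next)
      (.setArr sd.ord Reg.cnt (at' sd.low Reg.j - 1) ;;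
        .setArr sd.alive Reg.cnt (at' sd.alive Reg.j) ;;
        .setReg .cnt (Reg.cnt + 1)))

/-- The second loop of the update of the bars. -/
def newBars (sd : Side) : P :=
  .loop .l (at' sd.dim next) (
    .ite (.eq (at' sd.piv Reg.l) 0)
      (.setArr sd.ord Reg.cnt Reg.l ;;
        .setArr sd.alive Reg.cnt sd.num ;;
        .setArr sd.birth sd.num next ;;
        .setArr sd.death sd.num 0 ;;
        .setReg sd.num (sd.num + 1) ;;
        .setReg .cnt (Reg.cnt + 1))
      .skip)

def updateBars (sd : Side) : P := .setReg .cnt 0 ;; sd.keepBars ;; sd.newBars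

end Side

theorem step_eq : step = (Side.M.reduce ;; Side.N.reduce ;; changeBasisM ;; changeBasisN ;;
    .setReg .oldCols Reg.numCols ;; .setReg .oldRows Reg.numRows ;;
    Side.M.updateBars ;; Side.N.updateBars ;; sortBases ;; extend) := rfl

end PresPersMod

namespace PresPersMod

open FieldRAM

variable {K : Type u} [Field K] [DecidableEq K]

/-! ### Running time -/

/-- The quantities that bound the numbers of iterations of the loops in a step. -/
structure LoopBounds (dm dn : ℕ → ℕ) (i₀ e S : ℕ) (σ : Store K Reg Arr Mat) : Prop where
  dimM : σ.arr .dimM = dm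
  dimN : σ.arr .dimN = dn
  idx : σ.reg .i = i₀
  l : σ.reg .l ≤ S
  numCols : σ.reg .numCols ≤ S
  numRows : σ.reg .numRows ≤ S
  newCols : σ.reg .numCols - σ.reg .oldCols ≤ e
  newRows : σ.reg .numRows - σ.reg .oldRows ≤ e

theorem LoopBounds.setCell {dm dn : ℕ → ℕ} {i₀ e S : ℕ} {σ : Store K Reg Arr Mat}
    (h : LoopBounds dm dn i₀ e S σ) (X : Mat) (i r c : ℕ) (z : K) :
    LoopBounds dm dn i₀ e S (σ.setCell X i r c z) :=
  ⟨h.dimM, h.dimN, h.idx, h.l, h.numCols, h.numRows, h.newCols, h.newRows⟩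

theorem LoopBounds.setArr {dm dn : ℕ → ℕ} {i₀ e S : ℕ} {σ : Store K Reg Arr Mat}
    (h : LoopBounds dm dn i₀ e S σ) {a : Arr} (ha : a ≠ .dimM ∧ a ≠ .dimN) (k n : ℕ) :
    LoopBounds dm dn i₀ e S (σ.setArr a k n) :=
  ⟨by rw [← h.dimM]; funext k'; simp [ha.1.symm], by rw [← h.dimN]; funext k'; simp [ha.2.symm],
    h.idx, h.l, h.numCols, h.numRows, h.newCols, h.newRows⟩

theorem LoopBounds.setReg {dm dn : ℕ → ℕ} {i₀ e S : ℕ} {σ : Store K Reg Arr Mat}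
    (h : LoopBounds dm dn i₀ e S σ) {x : Reg} (hx : x ≠ .i ∧ x ≠ .l ∧ x ≠ .numCols ∧
      x ≠ .numRows ∧ x ≠ .oldCols ∧ x ≠ .oldRows) (n : ℕ) :
    LoopBounds dm dn i₀ e S (σ.setReg x n) := by
  obtain ⟨h1, h2, h3, h4, h5, h6⟩ := hx
  constructor <;> simp [h1.symm, h2.symm, h3.symm, h4.symm, h5.symm, h6.symm, h.dimM, h.dimN,
    h.idx, h.l, h.numCols, h.numRows, -tsub_le_iff_right, h.newCols, h.newRows]

theorem LoopBounds.setReg_l {dm dn : ℕ → ℕ} {i₀ e S : ℕ} {σ : Store K Reg Arr Mat}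
    (h : LoopBounds dm dn i₀ e S σ) {n : ℕ} (hn : n ≤ S) :
    LoopBounds dm dn i₀ e S (σ.setReg .l n) :=
  ⟨h.dimM, h.dimN, h.idx, hn, h.numCols, h.numRows, h.newCols, h.newRows⟩

variable {dm dn : ℕ → ℕ} {i₀ e w S : ℕ}

/-- All steps except for the update of the bars. -/
theorem bounded_step_parts (hwS : w ≤ S) (h0 : dm i₀ ≤ w ∧ dn i₀ ≤ w)
    (h1 : dm (i₀ + 1) ≤ w ∧ dn (i₀ + 1) ≤ w) (h2 : dm (i₀ + 1 + 1) ≤ w ∧ dn (i₀ + 1 + 1) ≤ w) :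
    ((Side.M.reduce ;; Side.N.reduce ;; changeBasisM ;; changeBasisN).Bounded
      (LoopBounds (K := K) dm dn i₀ e S) [w, S, S]) ∧
    ((sortBases ;; extend).Bounded (LoopBounds (K := K) dm dn i₀ w S) [w, S, S]) := by
  simp only [Side.reduce, reduce, Side.X, Side.dim, Side.piv, Side.low, Side.op, changeBasisM,
    changeBasisN, sortBases, permute, extend,
    Prog.Bounded, subCol, addCol, scaleCol, addRow, subRow, scaleRow, List.tail, List.headD, next,
    eval_arr, eval_add, eval_reg, eval_sub, eval_zero, eval_one]
  refine ⟨?_, ?_⟩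
  all_goals
    repeat' apply And.intro
  all_goals first
    | trivial
    | (intro σ h
       first
       | exact h.setCell _ _ _ _ _
       | exact h.setArr (by decide) _ _
       | exact h.setReg (by decide) _
       | (refine h.setReg_l ?_
          simp only [h.dimM, h.dimN, h.idx]
          omega)
       | (refine ⟨?_, ?_⟩
          · simp only [h.dimM, h.dimN, h.idx, h.newCols, h.newRows, h.numCols, h.numRows, h.l]
            try omega
          · intro k hk
            first
            | exact h.setReg (by decide) _
            | exact h.setReg_l (hk.le.trans (by omega))))

/-- The numbers of bars grow here, so `LoopBounds` is not an invariant. The weaker invariant keeps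
only what bounds these loops and the later ones, and the growth is left to `updateBars_num_le`. -/
theorem bounded_updateBars (sd : Side) (hwS : w ≤ S) (h0 : dm i₀ ≤ w ∧ dn i₀ ≤ w)
    (h1 : dm (i₀ + 1) ≤ w ∧ dn (i₀ + 1) ≤ w) :
    sd.updateBars.Bounded (fun σ : Store K Reg Arr Mat =>
      σ.arr .dimM = dm ∧ σ.arr .dimN = dn ∧ σ.reg .i = i₀ ∧ σ.reg .l ≤ S) [w] := by
  cases sd
  all_goals
    simp only [Side.updateBars, Side.keepBars, Side.newBars, Prog.Bounded, List.headD, next,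
      eval_arr, eval_add, eval_reg, eval_sub, eval_zero, eval_one, Side.dim]
    repeat' apply And.intro
  all_goals first
    | trivial
    | (rintro σ ⟨hM, hN, hi, hl⟩
       first
       | exact ⟨hM, hN, hi, hl⟩
       | exact ⟨by rw [hM, hi]; omega, fun k _ => ⟨hM, hN, hi, hl⟩⟩
       | exact ⟨by rw [hN, hi]; omega, fun k _ => ⟨hM, hN, hi, hl⟩⟩
       | exact ⟨by rw [hM, hi]; omega, fun k hk => ⟨hM, hN, hi, hk.le.trans hwS⟩⟩
       | exact ⟨by rw [hN, hi]; omega, fun k hk => ⟨hM, hN, hi, hk.le.trans hwS⟩⟩)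

/-- Only the second loop creates bars, at most one per round. -/
theorem updateBars_num_le (sd : Side) (σ : Store K Reg Arr Mat) :
    (sd.updateBars.exec σ).reg sd.num ≤ σ.reg sd.num + σ.arr sd.dim (σ.reg .i + 1) := by
  have hF := Frame.exec (.seq (.setReg .cnt 0) sd.keepBars) σ
  have h1 := hF.reg .i (by cases sd <;> rfl)
  have h2 := hF.reg sd.num (by cases sd <;> rfl)
  have h3 := hF.arr sd.dim (by cases sd <;> rfl)
  change (sd.newBars.exec ((.seq (.setReg .cnt 0) sd.keepBars : P).exec σ)).reg _ ≤ _
  generalize Prog.exec (.seq (.setReg .cnt 0) sd.keepBars) σ = τ at *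
  rw [← h1, ← h2, ← h3]
  refine Prog.exec_loop_induction (fun k ρ => ρ.reg sd.num ≤ τ.reg sd.num + k)
    (by simp) (by simp) fun k hk ρ hρ h => ?_
  rw [Prog.exec]
  cases sd <;> split_ifs <;> simp [Prog.exec, Side.num] at h ⊢ <;> omega

theorem exec_step (σ : Store K Reg Arr Mat) : step.exec σ = extend.exec (sortBases.exec
    (Side.N.updateBars.exec (Side.M.updateBars.exec ((Prog.setReg .oldRows Reg.numRows : P).exec
      ((Prog.setReg .oldCols Reg.numCols : P).exec (changeBasisN.exec (changeBasisM.exec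
        (Side.N.reduce.exec (Side.M.reduce.exec σ))))))))) := by
  simp only [step_eq, Prog.exec_seq]

/-- The bounds on the sizes of `f₀` are part of the conclusion because they are needed as hypotheses
of the following step. -/
theorem time_step_le {σ : Store K Reg Arr Mat} (hwS : w ≤ S) (h0 : dm i₀ ≤ w ∧ dn i₀ ≤ w)
    (h1 : dm (i₀ + 1) ≤ w ∧ dn (i₀ + 1) ≤ w) (h2 : dm (i₀ + 1 + 1) ≤ w ∧ dn (i₀ + 1 + 1) ≤ w)
    (hM : σ.arr .dimM = dm) (hN : σ.arr .dimN = dn) (hi : σ.reg .i = i₀) (hl : σ.reg .l ≤ S)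
    (hc : σ.reg .numCols + dm (i₀ + 1) ≤ S) (hr : σ.reg .numRows + dn (i₀ + 1) ≤ S) :
    step.time σ ≤ step.size * ((w + 1) * ((S + 1) * (S + 1))) ∧ (step.exec σ).reg .l ≤ S ∧
      (step.exec σ).reg .numCols ≤ σ.reg .numCols + dm (i₀ + 1) ∧
      (step.exec σ).reg .numRows ≤ σ.reg .numRows + dn (i₀ + 1) := by
  -- At this moment `oldCols` and `oldRows` are stale, so only the trivial bound `S` on the numbers
  -- of new bars is at hand. The parts before the update do not need a better one.
  have hb : LoopBounds dm dn i₀ S S σ := ⟨hM, hN, hi, hl, by omega, by omega, by omega, by omega⟩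
  obtain ⟨b1, b2⟩ := bounded_step_parts (K := K) (e := S) hwS h0 h1 h2
  obtain ⟨-, b2'⟩ := bounded_step_parts (K := K) (e := w) hwS h0 h1 h2
  clear b2
  have e1 := b1.1.exec_time hb
  have e2 := b1.2.1.exec_time e1.1
  have e3 := b1.2.2.1.exec_time e2.1
  have e4 := b1.2.2.2.exec_time e3.1
  have f := Frame.exec (Side.M.reduce ;; Side.N.reduce ;; changeBasisM ;; changeBasisN) σ
  rw [exec_step, step_eq]
  simp only [Prog.exec_seq, Prog.time_seq, Prog.size_seq] at f ⊢
  generalize Side.M.reduce.exec σ = ρ₁ at *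
  generalize Side.N.reduce.exec ρ₁ = ρ₂ at *
  generalize changeBasisM.exec ρ₂ = ρ₃ at *
  generalize changeBasisN.exec ρ₃ = σ₁ at *
  have g1 : ∀ τ : Store K Reg Arr Mat, (Prog.setReg .oldCols Reg.numCols : P).time τ = 2 :=
    fun _ => rfl
  have g2 : ∀ τ : Store K Reg Arr Mat, (Prog.setReg .oldRows Reg.numRows : P).time τ = 2 :=
    fun _ => rfl
  have g3 : (Prog.setReg .oldCols Reg.numCols : P).size = 2 := rfl
  have g4 : (Prog.setReg .oldRows Reg.numRows : P).size = 2 := rfl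
  rw [g1, g2, g3, g4]
  obtain ⟨σ₂, hσ₂⟩ : ∃ σ₂, (Prog.setReg .oldRows Reg.numRows : P).exec
    ((Prog.setReg .oldCols Reg.numCols : P).exec σ₁) = σ₂ := ⟨_, rfl⟩
  have k1 : σ₂.arr = σ₁.arr := hσ₂ ▸ rfl
  have k2 : ∀ y, y ≠ .oldCols → y ≠ .oldRows → σ₂.reg y = σ₁.reg y := fun y h1 h2 => by
    rw [← hσ₂]; simp [Prog.exec, h1, h2]
  have k3 : σ₂.reg .oldCols = σ₁.reg .numCols ∧ σ₂.reg .oldRows = σ₁.reg .numRows := by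
    rw [← hσ₂]; simp [Prog.exec]
  rw [hσ₂]
  clear hσ₂
  have u1 := (bounded_updateBars (K := K) .M hwS h0 h1).exec_time (σ := σ₂)
    ⟨by rw [k1, e4.1.dimM], by rw [k1, e4.1.dimN], by rw [k2 _ (by decide) (by decide), e4.1.idx],
      by rw [k2 _ (by decide) (by decide)]; exact e4.1.l⟩
  have u2 := (bounded_updateBars (K := K) .N hwS h0 h1).exec_time u1.1
  have n1 := updateBars_num_le .M σ₂
  have n2 := updateBars_num_le .N (Side.M.updateBars.exec σ₂)
  have fM := Frame.exec Side.M.updateBars σ₂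
  have fN := Frame.exec Side.N.updateBars (Side.M.updateBars.exec σ₂)
  generalize Side.M.updateBars.exec σ₂ = σ₃ at *
  generalize Side.N.updateBars.exec σ₃ = σ₄ at *
  have c1 : σ₂.reg .numCols = σ.reg .numCols :=
    (k2 _ (by decide) (by decide)).trans (f.reg .numCols rfl)
  have c2 : σ₂.reg .numRows = σ.reg .numRows :=
    (k2 _ (by decide) (by decide)).trans (f.reg .numRows rfl)
  have c3 : σ₄.reg .numCols = σ₃.reg .numCols := fN.reg .numCols rfl
  have c4 : σ₃.reg .numRows = σ₂.reg .numRows := fM.reg .numRows rfl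
  have c5 : σ₄.reg .oldCols = σ₂.reg .numCols :=
    (fN.reg .oldCols rfl).trans ((fM.reg .oldCols rfl).trans
      (k3.1.trans (k2 _ (by decide) (by decide)).symm))
  have c6 : σ₄.reg .oldRows = σ₂.reg .numRows :=
    (fN.reg .oldRows rfl).trans ((fM.reg .oldRows rfl).trans
      (k3.2.trans (k2 _ (by decide) (by decide)).symm))
  have d1 : σ₂.arr Side.M.dim (σ₂.reg .i + 1) = dm (i₀ + 1) := by
    rw [k2 .i (by decide) (by decide), e4.1.idx, k1, show σ₁.arr Side.M.dim = dm from e4.1.dimM]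
  have d2 : σ₃.arr Side.N.dim (σ₃.reg .i + 1) = dn (i₀ + 1) := by
    rw [u1.1.2.2.1, show σ₃.arr Side.N.dim = dn from u1.1.2.1]
  rw [d1] at n1
  rw [d2] at n2
  change σ₃.reg .numCols ≤ σ₂.reg .numCols + _ at n1
  change σ₄.reg .numRows ≤ σ₃.reg .numRows + _ at n2
  -- Now the numbers of new bars are at most the dimensions at `i₀ + 1`, hence at most `w`. This
  -- bounds the outer loops of `extend`.
  have hb4 : LoopBounds dm dn i₀ w S σ₄ :=
    ⟨u2.1.1, u2.1.2.1, u2.1.2.2.1, u2.1.2.2.2, by omega, by omega, by omega, by omega⟩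
  have e5 := b2'.1.exec_time hb4
  have e6 := b2'.2.exec_time e5.1
  have f' := Frame.exec (sortBases ;; extend) σ₄
  simp only [Prog.exec_seq] at f'
  refine ⟨?_, e6.1.l, ?_, ?_⟩
  · have hZ : ([w].map (· + 1)).prod ≤ (w + 1) * ((S + 1) * (S + 1)) := by
      simp
    have hZ' : ([w, S, S].map (· + 1)).prod = (w + 1) * ((S + 1) * (S + 1)) := by simp
    have h1Z : 1 ≤ (w + 1) * ((S + 1) * (S + 1)) := Nat.succ_le_of_lt (by positivity)
    have u1' := u1.2.trans (Nat.mul_le_mul_left _ hZ)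
    have u2' := u2.2.trans (Nat.mul_le_mul_left _ hZ)
    rw [hZ'] at e1 e2 e3 e4 e5 e6
    generalize (w + 1) * ((S + 1) * (S + 1)) = Z at *
    simp only [add_mul]
    have := e1.2; have := e2.2; have := e3.2; have := e4.2; have := e5.2; have := e6.2
    omega
  · rw [f'.reg .numCols rfl]; omega
  · rw [f'.reg .numRows rfl]; omega

/-- The bars created so far are at most as many as the sum of the dimensions so far, so `S` bounds
the size of `f₀` throughout. The outermost bound of step `k` is a sum of three consecutive `D`, and
these add up to at most `3 * S`. Bounding each step separately by `S` would lose a factor. -/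
theorem time_algorithm_le {σ : Store K Reg Arr Mat} {m : ℕ} {D : ℕ → ℕ}
    (hm : σ.reg .m = m) (hl : σ.reg .l = 0)
    (hD : ∀ k, D k = σ.arr .dimM k + σ.arr .dimN k) (hD0 : ∀ k, m < k → D k = 0)
    (hS : S = ∑ k ∈ Finset.range (m + 1), D k) :
    algorithm.time σ ≤ start.size * ((S + 1) * (S + 1)) + 2 + m +
      step.size * ((3 * S + m) * ((S + 1) * (S + 1))) := by
  have hDS : ∀ k, D k ≤ S := fun k => by
    by_cases hk : k ≤ m
    · rw [hS]
      exact Finset.single_le_sum (f := D) (fun _ _ => Nat.zero_le _)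
        (Finset.mem_range.2 (Nat.lt_succ_of_le hk))
    · simp [hD0 k (by omega)]
  -- This is needed beyond `m + 1` too: the last step reads the dimension at `m + 1`, which is
  -- stored as zero.
  have hSk : ∀ k, ∑ j ∈ Finset.range k, D j ≤ S := fun k => by
    rw [hS]
    rcases le_total k (m + 1) with h | h
    · exact Finset.sum_le_sum_of_subset (Finset.range_subset_range.2 h)
    · rw [← Finset.sum_subset (Finset.range_subset_range.2 h)]
      intro x _ hx
      exact hD0 x (by simpa using hx)
  have bs : start.Bounded (fun τ : Store K Reg Arr Mat => τ.arr .dimM = σ.arr .dimM ∧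
      τ.arr .dimN = σ.arr .dimN) [S, S] := by
    have h1 := hDS 0
    rw [hD] at h1
    simp only [start, Prog.Bounded, List.tail, List.headD, eval_arr, eval_reg, eval_zero]
    repeat' apply And.intro
    all_goals
      rintro τ ⟨hM, hN⟩
      first
      | exact ⟨hM, hN⟩
      | exact ⟨by rw [hM]; omega, fun k _ => ⟨hM, hN⟩⟩
      | exact ⟨by rw [hN]; omega, fun k _ => ⟨hM, hN⟩⟩
  have es := bs.exec_time ⟨rfl, rfl⟩
  set τ := start.exec σ with hτ
  have fs : Frame start σ τ := Frame.exec start σ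
  have t0 : τ.reg .numCols = σ.arr .dimM 0 ∧ τ.reg .numRows = σ.arr .dimN 0 := by
    rw [hτ, start, Prog.exec_seq, Prog.exec_seq]
    have f := Frame.exec (K := K) (.loop .j (at' .dimM 0)
        (.setArr .aliveM Reg.j Reg.j ;; .setArr .birthCol Reg.j 0 ;; .setArr .deathCol Reg.j 0) ;;
      .loop .j (at' .dimN 0)
        (.setArr .aliveN Reg.j Reg.j ;; .setArr .birthRow Reg.j 0 ;; .setArr .deathRow Reg.j 0) ;;
      .loop .r (at' .dimN 0) (.loop .s (at' .dimM 0)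
        (.setCell .f₀ 0 Reg.r Reg.s (en .C 0 Reg.r Reg.s))))
      ((Prog.setReg .numRows (at' .dimN 0)).exec ((Prog.setReg .numCols (at' .dimM 0)).exec σ))
    rw [f.reg .numCols rfl, f.reg .numRows rfl]
    simp [Prog.exec]
  have hmτ : τ.reg .m = m := (fs.reg .m rfl).trans hm
  have hlτ : τ.reg .l = 0 := (fs.reg .l rfl).trans hl
  clear_value τ
  have hinv : ∀ i, ∀ ρ, ρ = iterate (fun k (τ : Store K Reg Arr Mat) =>
      step.exec (τ.setReg .i k)) i τ →
      (ρ.arr .dimM = σ.arr .dimM ∧ ρ.arr .dimN = σ.arr .dimN ∧ ρ.reg .l ≤ S ∧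
      ρ.reg .numCols + ρ.reg .numRows ≤ ∑ k ∈ Finset.range (i + 1), D k) := by
    intro i
    induction i with
    | zero =>
      rintro ρ rfl
      refine ⟨es.1.1, es.1.2, by simp [hlτ], ?_⟩
      simp [t0.1, t0.2, hD]
    | succ i ih =>
      rintro ρ' hρ'
      obtain ⟨h1, h2, h3, h4⟩ := ih _ rfl
      rw [iterate_succ] at hρ'
      generalize iterate (fun k (τ : Store K Reg Arr Mat) => step.exec (τ.setReg .i k)) i τ = ρ at *
      have h5 := hSk (i + 1 + 1)
      have h6 := hSk (i + 1 + 1 + 1)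
      have h7 := hD i
      have h8 := hD (i + 1)
      have h9 := hD (i + 1 + 1)
      rw [Finset.sum_range_succ] at h5 ⊢
      rw [show ∑ j ∈ Finset.range (i + 1 + 1 + 1), D j = ∑ j ∈ Finset.range i, D j + D i + D (i + 1) +
        D (i + 1 + 1) by rw [Finset.sum_range_succ, Finset.sum_range_succ, Finset.sum_range_succ]] at h6
      have := time_step_le (σ := ρ.setReg .i i) (dm := σ.arr .dimM) (dn := σ.arr .dimN) (S := S)
        (i₀ := i) (w := D i + D (i + 1) + D (i + 1 + 1)) (by omega) (by omega) (by omega)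
        (by omega) h1 h2 (by simp) (by simpa using h3) (by simp; omega) (by simp; omega)
      have f := Frame.exec step (ρ.setReg .i i)
      rw [← hρ'] at this f
      clear hρ'
      refine ⟨(f.arr .dimM rfl).trans h1, (f.arr .dimN rfl).trans h2, this.2.1, ?_⟩
      have t1 := this.2.2.1
      have t2 := this.2.2.2
      simp only [Store.setReg_reg, reduceCtorEq, if_false] at t1 t2
      omega
  have htime : ∀ i, step.time ((iterate (fun k (τ : Store K Reg Arr Mat) =>
      step.exec (τ.setReg .i k)) i τ).setReg .i i) ≤
        step.size * ((D i + D (i + 1) + D (i + 1 + 1) + 1) * ((S + 1) * (S + 1))) := by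
    intro i
    obtain ⟨h1, h2, h3, h4⟩ := hinv i _ rfl
    generalize iterate (fun k (τ : Store K Reg Arr Mat) => step.exec (τ.setReg .i k)) i τ = ρ at *
    have h5 := hSk (i + 1 + 1)
    have h6 := hSk (i + 1 + 1 + 1)
    have h7 := hD i
    have h8 := hD (i + 1)
    have h9 := hD (i + 1 + 1)
    rw [Finset.sum_range_succ] at h5
    rw [show ∑ j ∈ Finset.range (i + 1 + 1 + 1), D j = ∑ j ∈ Finset.range i, D j + D i + D (i + 1) +
      D (i + 1 + 1) by rw [Finset.sum_range_succ, Finset.sum_range_succ, Finset.sum_range_succ]] at h6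
    exact (time_step_le (σ := ρ.setReg .i i) (dm := σ.arr .dimM) (dn := σ.arr .dimN) (S := S)
        (i₀ := i) (w := D i + D (i + 1) + D (i + 1 + 1)) (by omega) (by omega) (by omega)
        (by omega) h1 h2 (by simp) (by simpa using h3) (by simp; omega) (by simp; omega)).1
  -- The `2` pays for evaluating the bound of the outer loop and entering it.
  have hal : algorithm.time σ = start.time σ + (2 + ∑ k ∈ Finset.range m, (1 + step.time
      ((iterate (fun k (τ : Store K Reg Arr Mat) => step.exec (τ.setReg .i k)) k τ).setReg
        .i k))) := by
    rw [algorithm, Prog.time_seq, ← hτ, Prog.time, eval_reg, hmτ]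
    rfl
  have hsum : ∑ k ∈ Finset.range m, (D k + D (k + 1) + D (k + 1 + 1) + 1) ≤ 3 * S + m := by
    have s1 := hSk m
    have s2 := hSk (m + 1)
    have s3 := hSk (m + 1 + 1)
    rw [Finset.sum_range_succ'] at s2
    rw [Finset.sum_range_succ', Finset.sum_range_succ'] at s3
    simp only [Finset.sum_add_distrib, Finset.sum_const, Finset.card_range, smul_eq_mul, mul_one]
    omega
  have hloop : ∑ k ∈ Finset.range m, (1 + step.time
      ((iterate (fun k (τ : Store K Reg Arr Mat) => step.exec (τ.setReg .i k)) k τ).setReg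
        .i k)) ≤ m + step.size * ((3 * S + m) * ((S + 1) * (S + 1))) := by
    rw [Finset.sum_add_distrib]
    refine add_le_add (by simp) ((Finset.sum_le_sum fun k _ => htime k).trans ?_)
    rw [← Finset.mul_sum, ← Finset.sum_mul]
    exact Nat.mul_le_mul_left _ (Nat.mul_le_mul_right _ hsum)
  have e0 : start.time σ ≤ start.size * ((S + 1) * (S + 1)) := by simpa using es.2
  rw [hal, add_assoc (start.size * _) 2 m, add_assoc _ (2 + m), add_assoc 2 m]
  exact Nat.add_le_add e0 (Nat.add_le_add_left hloop 2)

end PresPersMod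

/-! ## Barcodes and canonical presentations -/

theorem Fintype.sum_eq_sum_subtype {ι A : Type*} [Fintype ι] [AddCommMonoid A] (p : ι → Prop)
    [DecidablePred p] {f : ι → A} (h : ∀ c, ¬ p c → f c = 0) :
    ∑ c, f c = ∑ c : {c // p c}, f c.1 := by
  rw [← Finset.sum_subtype (Finset.univ.filter p) (by simp) f, Finset.sum_filter]
  exact Finset.sum_congr rfl fun c _ => by
    split_ifs with hc
    exacts [rfl, h c hc]

namespace Persistence

noncomputable section

variable {K : Type u} [Field K]

/-- The elements `G c k` with `b c ≤ k < d c` form a basis of `V k` for every `k`, and the maps of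
the persistence module `V` send bars to bars. -/
structure IsBarBasis {V : ℕ → Type v} [∀ i, AddCommGroup (V i)] [∀ i, Module K (V i)]
    (T : ∀ i, V i →ₗ[K] V (i + 1)) {ι : Type*} (b : ι → ℕ) (d : ι → ℕ∞) (G : ι → ∀ k, V k) :
    Prop where
  lt : ∀ c, (b c : ℕ∞) < d c
  map : ∀ c k, b c ≤ k → T k (G c k) = G c (k + 1)
  eq_zero : ∀ c k, d c ≤ (k : ℕ) → G c k = 0
  indep : ∀ k : ℕ, LinearIndependent K
    (fun c : {c // b c ≤ k ∧ (k : ℕ∞) < d c} => G c.1 k)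
  span : ∀ k : ℕ, ⊤ ≤ Submodule.span K
    (Set.range fun c : {c // b c ≤ k ∧ (k : ℕ∞) < d c} => G c.1 k)

/-! ### The two-term resolution given by a barcode -/

section Presentation

variable {M : ℕ ⥤ FGModuleCat.{v} K} {ι : Type} [Fintype ι] [DecidableEq ι]
  {b : ι → ℕ} {d : ι → ℕ∞} {G : ι → ∀ k, M.obj k}

variable (M) in
/-- The homogeneous element of the graded module given by an element of `M i`. -/
def homogeneous (i : ℕ) : M.obj i →ₗ[K] GradedModule M :=
  (Module.AEval.of K (⨁ i, M.obj i) (shift M)).toLinearMap ∘ₗ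
    DirectSum.lof K ℕ (fun i => M.obj i) i

variable (M) in
/-- The component of degree `i` of an element of the graded module. -/
def degreeComponent (i : ℕ) : GradedModule M →ₗ[K] M.obj i :=
  DirectSum.component K ℕ (fun i => M.obj i) i ∘ₗ
    (Module.AEval.of K (⨁ i, M.obj i) (shift M)).symm.toLinearMap

theorem degreeComponent_homogeneous (i j : ℕ) (x : M.obj i) :
    degreeComponent M j (homogeneous M i x) = if h : i = j then h ▸ x else 0 := by
  simp only [degreeComponent, homogeneous, LinearMap.comp_apply, LinearEquiv.coe_coe,
    LinearEquiv.symm_apply_apply]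
  exact DirectSum.component.of (R := K) (M := fun i => M.obj i) j i x

theorem degreeComponent_homogeneous_self (i : ℕ) (x : M.obj i) :
    degreeComponent M i (homogeneous M i x) = x := by
  simp [degreeComponent_homogeneous]

theorem degreeComponent_homogeneous_of_ne {i j : ℕ} (h : i ≠ j) (x : M.obj i) :
    degreeComponent M j (homogeneous M i x) = 0 := by
  simp [degreeComponent_homogeneous, h]

/-- Identities in the graded modules are verified below degree by degree. -/
theorem GradedModule.ext {x y : GradedModule M}
    (h : ∀ i, degreeComponent M i x = degreeComponent M i y) : x = y := by
  apply (Module.AEval.of K (⨁ i, M.obj i) (shift M)).symm.injective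
  exact DFinsupp.ext fun i => h i

theorem degreeComponent_gradedMap {N : ℕ ⥤ FGModuleCat.{v} K} (φ : M ⟶ N) (x : GradedModule M)
    (i : ℕ) : degreeComponent N i (gradedMap φ x) = component φ i (degreeComponent M i x) := by
  rfl

theorem X_smul_homogeneous (i : ℕ) (x : M.obj i) :
    (X : K[X]) • homogeneous M i x = homogeneous M (i + 1) (stepMap M i x) := by
  simp only [homogeneous, LinearMap.comp_apply, LinearEquiv.coe_coe]
  rw [Module.AEval.X_smul_of]
  congr 1
  simp [shift]

theorem X_pow_smul_homogeneous (hmap : ∀ c k, b c ≤ k → stepMap M k (G c k) = G c (k + 1))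
    (c : ι) (k : ℕ) : (X ^ k : K[X]) • homogeneous M (b c) (G c (b c)) =
      homogeneous M (b c + k) (G c (b c + k)) := by
  induction k with
  | zero => simp
  | succ k ih =>
    rw [pow_succ', mul_smul, ih, X_smul_homogeneous, hmap _ _ (Nat.le_add_right _ _)]
    rfl

variable (b G) in
/-- The map from the free graded module that sends generators to generators of bars. -/
def generatorMap : (ι → K[X]) →ₗ[K[X]] GradedModule M :=
  Fintype.linearCombination K[X] fun c => homogeneous M (b c) (G c (b c))

/-- Monomials suffice, and `t ^ n` moves the generator to degree `b c + n`. Death times play no role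
yet. -/
theorem degreeComponent_smul (hmap : ∀ c k, b c ≤ k → stepMap M k (G c k) = G c (k + 1))
    (c : ι) (y : K[X]) (i : ℕ) :
    degreeComponent M i (y • homogeneous M (b c) (G c (b c))) =
      if b c ≤ i then y.coeff (i - b c) • G c i else 0 := by
  induction y using Polynomial.induction_on' with
  | add p q hp hq =>
    rw [add_smul, map_add, hp, hq]
    split_ifs <;> simp [add_smul]
  | monomial n a =>
    rw [← C_mul_X_pow_eq_monomial, mul_smul, X_pow_smul_homogeneous hmap, C_eq_algebraMap,
      algebraMap_smul, map_smul]
    by_cases h : b c + n = i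
    · subst h
      simp [degreeComponent_homogeneous_self]
    · rw [degreeComponent_homogeneous_of_ne h, smul_zero]
      split_ifs with h'
      · rw [← C_eq_algebraMap, coeff_C_mul, coeff_X_pow, if_neg (by omega)]
        simp
      · rfl

theorem degreeComponent_generatorMap
    (hmap : ∀ c k, b c ≤ k → stepMap M k (G c k) = G c (k + 1)) (y : ι → K[X]) (i : ℕ) :
    degreeComponent M i (generatorMap b G y) =
      ∑ c, if b c ≤ i then (y c).coeff (i - b c) • G c i else 0 := by
  rw [generatorMap, Fintype.linearCombination_apply, map_sum]
  exact Finset.sum_congr rfl fun c _ => degreeComponent_smul hmap c (y c) i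

theorem generatorMap_isHomogeneous
    (hmap : ∀ c k, b c ≤ k → stepMap M k (G c k) = G c (k + 1)) :
    IsHomogeneous (freeDegreePart b) (degreePart M) (generatorMap b G) := by
  intro i x hx
  refine ⟨degreeComponent M i (generatorMap b G x), ?_⟩
  change homogeneous M i _ = _
  refine GradedModule.ext fun j => ?_
  by_cases hj : i = j
  · subst hj
    rw [degreeComponent_homogeneous_self]
  · rw [degreeComponent_homogeneous_of_ne hj, degreeComponent_generatorMap hmap]
    refine (Finset.sum_eq_zero fun c _ => ?_).symm
    split_ifs with h
    · have : (x c).coeff (j - b c) = 0 := by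
        by_contra h'
        have := hx c _ h'
        omega
      rw [this, zero_smul]
    · rfl

/-- Each degree is spanned by living bars, and these are powers of `t` times generators. -/
theorem IsBarBasis.generatorMap_surjective (h : IsBarBasis (stepMap M) b d G) :
    Function.Surjective (generatorMap b G) := by
  have key : ∀ i (x : M.obj i), homogeneous M i x ∈
      (LinearMap.range (generatorMap b G)).restrictScalars K := by
    intro i x
    have : ⊤ ≤ ((LinearMap.range (generatorMap b G)).restrictScalars K).comap
        (homogeneous M i) := by
      refine (h.span i).trans (Submodule.span_le.2 ?_)
      rintro _ ⟨c, rfl⟩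
      refine ⟨Pi.single c.1 (X ^ (i - b c.1)), ?_⟩
      have hc := c.2.1
      -- This transports along an equality of degrees, since the two elements lie in different
      -- spaces `M.obj j`.
      have hG : ∀ j, b c.1 + (i - b c.1) = j → homogeneous M (b c.1 + (i - b c.1))
          (G c.1 (b c.1 + (i - b c.1))) = homogeneous M j (G c.1 j) := by rintro j rfl; rfl
      rw [generatorMap, Fintype.linearCombination_apply_single, X_pow_smul_homogeneous h.map]
      exact hG i (by omega)
    exact this trivial
  intro x
  obtain ⟨x, rfl⟩ := (Module.AEval.of K (⨁ i, M.obj i) (shift M)).surjective x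
  change _ ∈ (LinearMap.range (generatorMap b G)).restrictScalars K
  induction x using DirectSum.induction_on with
  | zero => rw [map_zero]; exact Submodule.zero_mem _
  | of i x => exact key i x
  | add x y hx hy => rw [map_add]; exact Submodule.add_mem _ hx hy

variable (b d) in
/-- The map from the relations to the generators. -/
def relationMap : ({c // d c ≠ ⊤} → K[X]) →ₗ[K[X]] (ι → K[X]) :=
  Matrix.toLin' (Matrix.of fun c g => if c = g.1 then X ^ ((d g.1).toNat - b g.1) else 0)

theorem relationMap_apply (z : {c // d c ≠ ⊤} → K[X]) (c : ι) :
    relationMap b d z c = if h : d c ≠ ⊤ then X ^ ((d c).toNat - b c) * z ⟨c, h⟩ else 0 := by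
  simp only [relationMap, Matrix.toLin'_apply, Matrix.mulVec, dotProduct, Matrix.of_apply, ite_mul,
    zero_mul]
  split_ifs with h
  · rw [Finset.sum_eq_single ⟨c, h⟩]
    · simp
    · rintro ⟨g, hg⟩ _ hne
      rw [if_neg]
      rintro rfl
      exact hne rfl
    · simp
  · refine Finset.sum_eq_zero fun g _ => if_neg ?_
    rintro rfl
    exact h g.2

theorem relationMap_isHomogeneous (h : ∀ c, (b c : ℕ∞) < d c) :
    IsHomogeneous (freeDegreePart fun g : {c // d c ≠ ⊤} => (d g.1).toNat) (freeDegreePart b)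
      (relationMap (K := K) b d) := by
  intro i x hx c k hk
  rw [relationMap_apply] at hk
  split_ifs at hk with hd
  · rw [coeff_X_pow_mul'] at hk
    split_ifs at hk with hle
    · have := hx ⟨c, hd⟩ _ hk
      have hlt := h c
      simp only at this
      lift d c to ℕ using hd with e he
      simp only [ENat.toNat_natCast, Nat.cast_lt] at *
      omega
    · exact absurd rfl hk
  · simp at hk

/-- In degree `b c + k` the coefficient of `X ^ k` in the component `c` is a coordinate with respect
to the living bars, as long as `c` is alive. An element of the kernel thus has coefficients only in
degrees from the death on, that is, its components are divisible by `t ^ (d - b)`. Conversely these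
multiples vanish because the generators do. -/
theorem IsBarBasis.exact (h : IsBarBasis (stepMap M) b d G) :
    Function.Exact (relationMap b d) (generatorMap b G) := by
  intro y
  constructor
  · intro hy
    have hcoeff : ∀ c k, (y c).coeff k ≠ 0 → d c ≤ (b c + k : ℕ) := by
      intro c k hck
      by_contra hlt
      rw [not_le] at hlt
      have h0 := congrArg (degreeComponent M (b c + k)) hy
      rw [map_zero, degreeComponent_generatorMap h.map] at h0
      -- Unborn bars do not occur in this degree and dead bars are zero, so only members of the
      -- basis remain.
      have h1 : ∑ c' : {c' // b c' ≤ b c + k ∧ ((b c + k : ℕ) : ℕ∞) < d c'},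
          (y c'.1).coeff (b c + k - b c'.1) • G c'.1 (b c + k) = 0 := by
        rw [← h0, Fintype.sum_eq_sum_subtype
          (fun c' => b c' ≤ b c + k ∧ ((b c + k : ℕ) : ℕ∞) < d c')]
        · exact Finset.sum_congr rfl fun c' _ => by rw [if_pos c'.2.1]
        · intro c' hc'
          split_ifs with hb
          · rw [h.eq_zero c' _ (not_lt.1 fun hlt => hc' ⟨hb, hlt⟩), smul_zero]
          · rfl
      have h2 := Fintype.linearIndependent_iff.1 (h.indep (b c + k)) _ h1 ⟨c, by omega, hlt⟩
      simp at h2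
      exact hck h2
    have hdvd : ∀ g : {c // d c ≠ ⊤}, ∃ z, y g.1 = X ^ ((d g.1).toNat - b g.1) * z := by
      intro g
      suffices hX : X ^ ((d g.1).toNat - b g.1) ∣ y g.1 from hX
      rw [X_pow_dvd_iff]
      intro k hk
      by_contra hne
      have := hcoeff _ _ hne
      have hg := g.2
      lift d g.1 to ℕ using hg with e he
      simp only [ENat.toNat_natCast, Nat.cast_le] at *
      omega
    choose z hz using hdvd
    refine ⟨z, funext fun c => ?_⟩
    rw [relationMap_apply]
    split_ifs with hd
    · exact (hz ⟨c, hd⟩).symm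
    -- For an immortal bar every nonzero coefficient would have to lie in a degree at least `⊤`.
    · ext k
      by_contra hne
      have := hcoeff c k (Ne.symm hne)
      simp only [ne_eq, not_not] at hd
      simp [hd] at this
  · rintro ⟨z, rfl⟩
    refine GradedModule.ext fun i => ?_
    rw [degreeComponent_generatorMap h.map, map_zero]
    refine Finset.sum_eq_zero fun c _ => ?_
    split_ifs with hb
    · by_cases hi : d c ≤ i
      · rw [h.eq_zero c i hi, smul_zero]
      · rw [relationMap_apply]
        split_ifs with hd
        · rw [coeff_X_pow_mul', if_neg, zero_smul]
          have := h.lt c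
          lift d c to ℕ using hd with e he
          simp only [ENat.toNat_natCast, Nat.cast_le, Nat.cast_lt] at *
          omega
        · simp
    · rfl

end Presentation

/-! ### Coordinates with respect to the bars -/

section Decomposition

variable {V : ℕ → Type v} [∀ i, AddCommGroup (V i)] [∀ i, Module K (V i)]
  {T : ∀ i, V i →ₗ[K] V (i + 1)} {ι : Type} [Fintype ι] {b : ι → ℕ} {d : ι → ℕ∞}
  {G : ι → ∀ k, V k}

/-- The basis of `V i` given by the bars at index `i`. -/
def IsBarBasis.basis (h : IsBarBasis T b d G) (i : ℕ) :
    Module.Basis {c // b c ≤ i ∧ (i : ℕ∞) < d c} K (V i) :=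
  Module.Basis.mk (h.indep i) (h.span i)

theorem IsBarBasis.sum_equivFun (h : IsBarBasis T b d G) (i : ℕ) (x : V i) :
    ∑ c, (h.basis i).equivFun x c • G c.1 i = x := by
  simpa [IsBarBasis.basis, Module.Basis.mk_apply] using (h.basis i).sum_equivFun x

/-- Dead bars contribute zero vectors and unborn bars have zero coefficients, so the sum over all
bars is already the expansion in the basis. -/
theorem IsBarBasis.equivFun_sum (h : IsBarBasis T b d G) (i : ℕ) (y : ι → K)
    (c : {c // b c ≤ i ∧ (i : ℕ∞) < d c}) (hy : ∀ c, i < b c → y c = 0) :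
    (h.basis i).equivFun (∑ c, y c • G c i) c = y c.1 := by
  have : ∑ c, y c • G c i = ∑ c : {c // b c ≤ i ∧ (i : ℕ∞) < d c}, y c.1 • h.basis i c := by
    rw [Fintype.sum_eq_sum_subtype (fun c => b c ≤ i ∧ (i : ℕ∞) < d c)]
    · exact Finset.sum_congr rfl fun c _ => by simp [IsBarBasis.basis, Module.Basis.mk_apply]
    · intro c hc
      by_cases hb : b c ≤ i
      · rw [h.eq_zero c _ (not_lt.1 fun hlt => hc ⟨hb, hlt⟩), smul_zero]
      · rw [hy c (not_le.1 hb), zero_smul]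
  rw [this, ← Module.Basis.equivFun_symm_apply, LinearEquiv.apply_symm_apply]

/-- A bar alive at `i` continues as itself or becomes zero, and nothing is sent to a bar born at `i
+ 1`. -/
theorem IsBarBasis.equivFun_map (h : IsBarBasis T b d G) (i : ℕ) (x : V i)
    (c : {c // b c ≤ i + 1 ∧ ((i + 1 : ℕ) : ℕ∞) < d c}) :
    (h.basis (i + 1)).equivFun (T i x) c =
      if hc : b c.1 ≤ i ∧ (i : ℕ∞) < d c.1 then (h.basis i).equivFun x ⟨c.1, hc⟩ else 0 := by
  have : T i x = ∑ c, (if hc : b c ≤ i ∧ (i : ℕ∞) < d c then (h.basis i).equivFun x ⟨c, hc⟩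
      else 0) • G c (i + 1) := by
    rw [Fintype.sum_eq_sum_subtype (fun c => b c ≤ i ∧ (i : ℕ∞) < d c)]
    · conv_lhs => rw [← h.sum_equivFun i x, map_sum]
      refine Finset.sum_congr rfl fun c _ => ?_
      rw [map_smul, h.map _ _ c.2.1, dif_pos c.2]
    · intro c hc
      rw [dif_neg hc, zero_smul]
  rw [this, h.equivFun_sum (i + 1) _ c]
  intro c hc
  rw [dif_neg]
  rintro ⟨h1, -⟩
  omega

end Decomposition

end

end Persistence

/-! ### From bars related by `f₀` to presentations of morphisms -/

namespace AnnotatedMatrix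

open Persistence

variable {K : Type u} [Field K] {F : AnnotatedMatrix K} {M N : ℕ ⥤ FGModuleCat.{v} K} {φ : M ⟶ N}
  {G : Fin F.cols → ∀ k, M.obj k} {H : Fin F.rows → ∀ k, N.obj k}

/-- The sum over all rows reduces to the active ones: dead rows vanish, and by `hb` an unborn row
has coefficient zero in every active column. -/
theorem isBarDecomposition (hG : IsBarBasis (stepMap M) F.birthCol F.deathCol G)
    (hH : IsBarBasis (stepMap N) F.birthRow F.deathRow H)
    (hb : ∀ r c, F.f₀ r c ≠ 0 → F.birthRow r ≤ F.birthCol c)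
    (hφ : ∀ c k, F.birthCol c ≤ k → component φ k (G c k) = ∑ r, F.f₀ r c • H r k) :
    F.IsBarDecomposition φ := by
  refine ⟨fun i => (hG.basis i).equivFun, fun i => (hH.basis i).equivFun, hG.equivFun_map,
    hH.equivFun_map, fun i x r => ?_⟩
  have : component φ i x =
      ∑ r, (∑ c : F.ActiveCol i, F.f₀ r c.1 * (hG.basis i).equivFun x c) • H r i := by
    conv_lhs => rw [← hG.sum_equivFun i x, map_sum]
    simp_rw [Finset.sum_smul]
    rw [Finset.sum_comm]
    refine Finset.sum_congr rfl fun c _ => ?_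
    rw [map_smul, hφ _ _ c.2.1, Finset.smul_sum]
    exact Finset.sum_congr rfl fun r _ => by rw [smul_smul, mul_comm]
  rw [this, hH.equivFun_sum i _ r]
  intro r hr
  refine Finset.sum_eq_zero fun c _ => ?_
  have : F.f₀ r c.1 = 0 := by
    by_contra h
    have h1 := hb _ _ h
    have h2 := c.2.1
    omega
  rw [this, zero_mul]

/-- At the death `e` of `c` the generator is zero, so `∑ r, f₀ r c • H r e = 0`. If the row `r` were
still alive at `e`, it would belong to the basis there, and its coefficient would vanish. -/
theorem deathRow_le (hG : IsBarBasis (stepMap M) F.birthCol F.deathCol G)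
    (hH : IsBarBasis (stepMap N) F.birthRow F.deathRow H)
    (hb : ∀ r c, F.f₀ r c ≠ 0 → F.birthRow r ≤ F.birthCol c)
    (hφ : ∀ c k, F.birthCol c ≤ k → component φ k (G c k) = ∑ r, F.f₀ r c • H r k)
    {r : Fin F.rows} {c : Fin F.cols} (hrc : F.f₀ r c ≠ 0) : F.deathRow r ≤ F.deathCol c := by
  by_contra hlt
  rw [not_le] at hlt
  have hd : F.deathCol c ≠ ⊤ := (hlt.trans_le le_top).ne
  have hbd := hG.lt c
  obtain ⟨e, he⟩ := ENat.ne_top_iff_exists.1 hd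
  rw [← he] at hlt hbd
  have hbd : F.birthCol c ≤ e := (Nat.cast_lt.1 hbd).le
  have h0 := hφ c e hbd
  rw [hG.eq_zero c e he.symm.le, map_zero] at h0
  have h1 := hH.equivFun_sum e (fun r => F.f₀ r c) ⟨r, (hb r c hrc).trans hbd, hlt⟩ (by
    intro r' hr'
    by_contra h
    have := hb _ _ h
    omega)
  rw [← h0] at h1
  simp at h1
  exact hrc h1.symm

/-- Wherever the scalar is nonzero, the truncated difference in the exponent is a true one. This
serves for the generators with birth times and for the relations with death times. -/
theorem monomialMatrix_isHomogeneous {ι κ : Type} [Fintype ι] [DecidableEq ι] {b : ι → ℕ}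
    {b' : κ → ℕ} (f : κ → ι → K) (hb : ∀ r c, f r c ≠ 0 → b' r ≤ b c) :
    IsHomogeneous (freeDegreePart b) (freeDegreePart b')
      (Matrix.toLin' (Matrix.of fun r c => C (f r c) * X ^ (b c - b' r)) :
        (ι → K[X]) →ₗ[K[X]] (κ → K[X])) := by
  intro i x hx r k hk
  simp only [Matrix.toLin'_apply, Matrix.mulVec, dotProduct, Matrix.of_apply, finsetSum_coeff]
    at hk
  obtain ⟨c, -, hc⟩ := Finset.exists_ne_zero_of_sum_ne_zero hk
  rw [mul_assoc, coeff_C_mul, coeff_X_pow_mul'] at hc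
  have h1 := hb _ _ (left_ne_zero_of_mul hc)
  have h2 := right_ne_zero_of_mul hc
  split_ifs at h2 with h3
  · have := hx c _ h2
    omega
  · exact absurd rfl h2

/-- Rows and surjections come from `IsBarBasis`. What is left is to lift `f₀` to the relations,
where `deathRow_le` enters. -/
theorem isCanonicalPresentation (hG : IsBarBasis (stepMap M) F.birthCol F.deathCol G)
    (hH : IsBarBasis (stepMap N) F.birthRow F.deathRow H)
    (hb : ∀ r c, F.f₀ r c ≠ 0 → F.birthRow r ≤ F.birthCol c)
    (hφ : ∀ c k, F.birthCol c ≤ k → component φ k (G c k) = ∑ r, F.f₀ r c • H r k) :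
    F.IsCanonicalPresentation φ := by
  have hd := fun {r c} => deathRow_le hG hH hb hφ (r := r) (c := c)
  have hgen : ∀ x r, F.genMap x r =
      ∑ c, C (F.f₀ r c) * X ^ (F.birthCol c - F.birthRow r) * x c := fun x r => by
    simp [genMap, Matrix.toLin'_apply, Matrix.mulVec, dotProduct]
  have hp : ∀ z c, F.p z c = _ := relationMap_apply (b := F.birthCol) (d := F.deathCol)
  have hq : ∀ z c, F.q z c = _ := relationMap_apply (b := F.birthRow) (d := F.deathRow)
  refine ⟨hG.lt, hH.lt, relationMap_isHomogeneous hG.lt, relationMap_isHomogeneous hH.lt, ?_,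
    -- The map `f₁` has the scalars of `f₀`, with exponents prescribed by the degrees of the
    -- relations, which are the death times.
    Matrix.toLin' (Matrix.of fun h g =>
      C (F.f₀ h.1 g.1) * X ^ ((F.deathCol g.1).toNat - (F.deathRow h.1).toNat)),
    generatorMap F.birthCol G, generatorMap F.birthRow H, ?_,
    generatorMap_isHomogeneous hG.map, generatorMap_isHomogeneous hH.map, ?_, ?_,
    hG.generatorMap_surjective, hG.exact, hH.generatorMap_surjective, hH.exact⟩
  · exact monomialMatrix_isHomogeneous F.f₀ hb
  · refine monomialMatrix_isHomogeneous (fun (h : F.FiniteRow) (g : F.FiniteCol) => F.f₀ h.1 g.1)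
      fun r c h => ENat.toNat_le_toNat (hd h) c.2
  · refine LinearMap.ext fun z => funext fun r => ?_
    rw [LinearMap.comp_apply, LinearMap.comp_apply, hgen, hq,
      Fintype.sum_eq_sum_subtype (fun c => F.deathCol c ≠ ⊤)
        (fun c hc => by rw [hp, dif_neg hc, mul_zero])]
    split_ifs with hr
    · simp only [Matrix.toLin'_apply, Matrix.mulVec, dotProduct, Matrix.of_apply, Finset.mul_sum]
      refine Finset.sum_congr rfl fun c _ => ?_
      rw [hp, dif_pos c.2]
      by_cases h0 : F.f₀ r c.1 = 0
      · simp [h0]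
      have h1 := hb _ _ h0
      have h2 := ENat.toNat_le_toNat (hd h0) c.2
      have h3 := hG.lt c.1
      have h4 := hH.lt r
      rw [← ENat.natCast_toNat c.2, Nat.cast_lt] at h3
      rw [← ENat.natCast_toNat hr, Nat.cast_lt] at h4
      -- Both exponents equal `d c - b r`. With truncated subtraction this uses `b r ≤ b c < d c`
      -- and `b r < d r ≤ d c`.
      have h5 : (X : K[X]) ^ (F.birthCol c.1 - F.birthRow r) *
          X ^ ((F.deathCol c.1).toNat - F.birthCol c.1) =
          X ^ ((F.deathRow r).toNat - F.birthRow r) *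
          X ^ ((F.deathCol c.1).toNat - (F.deathRow r).toNat) := by
        rw [← pow_add, ← pow_add]
        congr 1
        omega
      linear_combination C (F.f₀ r c.1) * z c * h5
    -- The row `r` has no relation, so a column of finite death time cannot meet it: its scalar
    -- would contradict `d r ≤ d c`.
    · refine Finset.sum_eq_zero fun c _ => ?_
      have h0 : F.f₀ r c.1 = 0 := by
        by_contra h0
        exact c.2 (top_le_iff.1 ((not_not.1 hr).symm.le.trans (hd h0)))
      simp [h0]
  · refine LinearMap.ext fun x => GradedModule.ext fun i => ?_
    rw [LinearMap.comp_apply, LinearMap.comp_apply, degreeComponent_gradedMap,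
      degreeComponent_generatorMap hG.map, degreeComponent_generatorMap hH.map, map_sum]
    have h1 : ∀ c, component φ i (if F.birthCol c ≤ i then
        (x c).coeff (i - F.birthCol c) • G c i else 0) = ∑ r, (if F.birthCol c ≤ i then
        (x c).coeff (i - F.birthCol c) * F.f₀ r c else 0) • H r i := fun c => by
      split_ifs with h
      · rw [map_smul, hφ c i h, Finset.smul_sum]
        exact Finset.sum_congr rfl fun r _ => by rw [smul_smul]
      · simp
    simp_rw [h1]
    rw [Finset.sum_comm]
    refine Finset.sum_congr rfl fun r _ => ?_
    rw [← Finset.sum_smul]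
    split_ifs with hr
    · congr 1
      rw [hgen, finsetSum_coeff]
      refine Finset.sum_congr rfl fun c _ => ?_
      rw [mul_assoc, coeff_C_mul, coeff_X_pow_mul']
      by_cases h0 : F.f₀ r c = 0
      · simp [h0]
      have h2 := hb _ _ h0
      split_ifs with h3 h4 h4
      · rw [mul_comm]
        congr 2
        omega
      · omega
      · omega
      · rw [mul_zero]
    -- The row is not yet born at `i`, hence has zero entries in all columns born by then.
    · rw [Finset.sum_eq_zero, zero_smul]
      intro c _
      split_ifs with h3
      · have : F.f₀ r c = 0 := by
          by_contra h0
          have := hb _ _ h0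
          omega
        rw [this, mul_zero]
      · rfl

end AnnotatedMatrix

/-! ## Effect of the parts of the algorithm -/

namespace FieldRAM

variable {K : Type u} [Field K] {R A F : Type}
variable [DecidableEq R] [DecidableEq A] [DecidableEq F]

/-- Two memories agree except for the register `x` and the matrix `X i`. -/
structure AgreeOff (x : R) (X : F) (i : ℕ) (σ τ : Store K R A F) : Prop where
  reg : ∀ y, y ≠ x → τ.reg y = σ.reg y
  arr : τ.arr = σ.arr
  cell : ∀ Y j, ¬ (Y = X ∧ j = i) → τ.cell Y j = σ.cell Y j

variable [DecidableEq K]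

/-- A loop that overwrites a column. -/
theorem Prog.exec_colLoop {x : R} {e : IExp R A} {X : F} {i dst : IExp R A} {w : FExp R A F}
    {σ : Store K R A F} {N : ℕ} (hN : e.eval σ = N) (i₀ j : ℕ) (val : ℕ → K)
    (h : ∀ k < N, ∀ τ : Store K R A F, AgreeOff x X i₀ σ τ → τ.reg x = k →
      (∀ c, τ.cell X i₀ k c = σ.cell X i₀ k c) →
      i.eval τ = i₀ ∧ dst.eval τ = j ∧ w.eval τ = val k) (Y : F) (i' : ℕ) :
    ((Prog.loop x e (.setCell X i (.reg x) dst w)).exec σ).cell Y i' =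
      if Y = X ∧ i' = i₀ then fun r c => if r < N ∧ c = j then val r else σ.cell Y i' r c
      else σ.cell Y i' := by
  have key := Prog.exec_loop_setCell (x := x) (e := e) (X := X) (i := i) (r := .reg x) (c := dst)
    (w := w) hN i₀ (fun k => k) (fun _ => j) val ?_ (by omega)
  · split_ifs with hY
    · obtain ⟨rfl, rfl⟩ := hY
      funext r c
      split_ifs with hr
      · rw [hr.2]
        exact key.1 r hr.1
      · refine key.2 _ _ _ _ fun k' hk' hh => hr ⟨by omega, hh.2.2.2⟩
    · funext r c
      exact key.2 _ _ _ _ fun k' hk' hh => hY ⟨hh.1, hh.2.1⟩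
  · intro k hk τ hreg hx harr hcell
    obtain ⟨h1, h2, h3⟩ := h k hk τ ⟨hreg, harr, fun Y j hY => by
      funext r c
      exact hcell _ _ _ _ fun k' _ hh => hY ⟨hh.1, hh.2.1⟩⟩ hx
      fun c => hcell _ _ _ _ fun k' hk' hh => by omega
    exact ⟨h1, hx, h2, h3⟩

/-- A loop that overwrites a row. -/
theorem Prog.exec_rowLoop {x : R} {e : IExp R A} {X : F} {i dst : IExp R A} {w : FExp R A F}
    {σ : Store K R A F} {N : ℕ} (hN : e.eval σ = N) (i₀ j : ℕ) (val : ℕ → K)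
    (h : ∀ k < N, ∀ τ : Store K R A F, AgreeOff x X i₀ σ τ → τ.reg x = k →
      (∀ r, τ.cell X i₀ r k = σ.cell X i₀ r k) →
      i.eval τ = i₀ ∧ dst.eval τ = j ∧ w.eval τ = val k) (Y : F) (i' : ℕ) :
    ((Prog.loop x e (.setCell X i dst (.reg x) w)).exec σ).cell Y i' =
      if Y = X ∧ i' = i₀ then fun r c => if c < N ∧ r = j then val c else σ.cell Y i' r c
      else σ.cell Y i' := by
  have key := Prog.exec_loop_setCell (x := x) (e := e) (X := X) (i := i) (r := dst) (c := .reg x)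
    (w := w) hN i₀ (fun _ => j) (fun k => k) val ?_ (by omega)
  · split_ifs with hY
    · obtain ⟨rfl, rfl⟩ := hY
      funext r c
      split_ifs with hr
      · rw [hr.2]
        exact key.1 c hr.1
      · refine key.2 _ _ _ _ fun k' hk' hh => hr ⟨by omega, hh.2.2.1⟩
    · funext r c
      exact key.2 _ _ _ _ fun k' hk' hh => hY ⟨hh.1, hh.2.1⟩
  · intro k hk τ hreg hx harr hcell
    obtain ⟨h1, h2, h3⟩ := h k hk τ ⟨hreg, harr, fun Y j hY => by
      funext r c
      exact hcell _ _ _ _ fun k' _ hh => hY ⟨hh.1, hh.2.1⟩⟩ hx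
      fun c => hcell _ _ _ _ fun k' hk' hh => by omega
    exact ⟨h1, h2, hx, h3⟩

end FieldRAM

namespace PresPersMod

open FieldRAM

variable {K : Type u} [Field K]

/-! ### Elementary operations on matrices -/

def addColF (n : ℕ) (s : K) (src dst : ℕ) (f : ℕ → ℕ → K) : ℕ → ℕ → K :=
  fun r c => if r < n ∧ c = dst then f r dst + s * f r src else f r c

def subColF (n : ℕ) (s : K) (src dst : ℕ) (f : ℕ → ℕ → K) : ℕ → ℕ → K :=
  fun r c => if r < n ∧ c = dst then f r dst - s * f r src else f r c

def scaleColF (n : ℕ) (s : K) (dst : ℕ) (f : ℕ → ℕ → K) : ℕ → ℕ → K :=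
  fun r c => if r < n ∧ c = dst then s * f r dst else f r c

def addRowF (n : ℕ) (s : K) (src dst : ℕ) (f : ℕ → ℕ → K) : ℕ → ℕ → K :=
  fun r c => if c < n ∧ r = dst then f dst c + s * f src c else f r c

def subRowF (n : ℕ) (s : K) (src dst : ℕ) (f : ℕ → ℕ → K) : ℕ → ℕ → K :=
  fun r c => if c < n ∧ r = dst then f dst c - s * f src c else f r c

def scaleRowF (n : ℕ) (s : K) (dst : ℕ) (f : ℕ → ℕ → K) : ℕ → ℕ → K :=
  fun r c => if c < n ∧ r = dst then s * f dst c else f r c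

variable [DecidableEq K]

/-- The operands of an elementary operation on the matrix `X i` have values that do not change when
this matrix or the register `s` are modified. -/
structure Operands (X : Mat) (i n : I) (a : E) (src dst : I) (σ : Store K Reg Arr Mat)
    (i₀ N : ℕ) (s : K) (q j : ℕ) : Prop where
  bound : n.eval σ = N
  index : ∀ τ, AgreeOff .s X i₀ σ τ → i.eval τ = i₀
  coeff : ∀ τ, AgreeOff .s X i₀ σ τ → a.eval τ = s
  src : ∀ τ, AgreeOff .s X i₀ σ τ → src.eval τ = q
  dst : ∀ τ, AgreeOff .s X i₀ σ τ → dst.eval τ = j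

variable {X : Mat} {i n : I} {a : E} {src dst : I} {σ : Store K Reg Arr Mat}
    {i₀ N : ℕ} {s : K} {q j : ℕ}

/-- Although the column is overwritten while it is read, round `k` reads only row `k`, which earlier
rounds have left alone. The other five operations work in the same way. -/
theorem exec_addCol (h : Operands X i n a src dst σ i₀ N s q j) (Y : Mat) (i' : ℕ) :
    ((addCol X i n a src dst).exec σ).cell Y i' =
      if Y = X ∧ i' = i₀ then addColF N s q j (σ.cell Y i') else σ.cell Y i' := by
  rw [addCol, Prog.exec_colLoop h.bound i₀ j (fun r => σ.cell X i₀ r j + s * σ.cell X i₀ r q)]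
  · split_ifs with hY
    · rw [hY.1, hY.2]; rfl
    · rfl
  · intro k _ τ hτ hk hc
    refine ⟨h.index _ hτ, h.dst _ hτ, ?_⟩
    simp [h.index _ hτ, h.dst _ hτ, h.src _ hτ, h.coeff _ hτ, hk, hc]

theorem exec_subCol (h : Operands X i n a src dst σ i₀ N s q j) (Y : Mat) (i' : ℕ) :
    ((subCol X i n a src dst).exec σ).cell Y i' =
      if Y = X ∧ i' = i₀ then subColF N s q j (σ.cell Y i') else σ.cell Y i' := by
  rw [subCol, Prog.exec_colLoop h.bound i₀ j (fun r => σ.cell X i₀ r j - s * σ.cell X i₀ r q)]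
  · split_ifs with hY
    · rw [hY.1, hY.2]; rfl
    · rfl
  · intro k _ τ hτ hk hc
    refine ⟨h.index _ hτ, h.dst _ hτ, ?_⟩
    simp [h.index _ hτ, h.dst _ hτ, h.src _ hτ, h.coeff _ hτ, hk, hc]

theorem exec_scaleCol (h : Operands X i n a dst dst σ i₀ N s j j) (Y : Mat) (i' : ℕ) :
    ((scaleCol X i n a dst).exec σ).cell Y i' =
      if Y = X ∧ i' = i₀ then scaleColF N s j (σ.cell Y i') else σ.cell Y i' := by
  rw [scaleCol, Prog.exec_colLoop h.bound i₀ j (fun r => s * σ.cell X i₀ r j)]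
  · split_ifs with hY
    · rw [hY.1, hY.2]; rfl
    · rfl
  · intro k _ τ hτ hk hc
    refine ⟨h.index _ hτ, h.dst _ hτ, ?_⟩
    simp [h.index _ hτ, h.dst _ hτ, h.coeff _ hτ, hk, hc]

theorem exec_addRow (h : Operands X i n a src dst σ i₀ N s q j) (Y : Mat) (i' : ℕ) :
    ((addRow X i n a src dst).exec σ).cell Y i' =
      if Y = X ∧ i' = i₀ then addRowF N s q j (σ.cell Y i') else σ.cell Y i' := by
  rw [addRow, Prog.exec_rowLoop h.bound i₀ j (fun r => σ.cell X i₀ j r + s * σ.cell X i₀ q r)]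
  · split_ifs with hY
    · rw [hY.1, hY.2]; rfl
    · rfl
  · intro k _ τ hτ hk hc
    refine ⟨h.index _ hτ, h.dst _ hτ, ?_⟩
    simp [h.index _ hτ, h.dst _ hτ, h.src _ hτ, h.coeff _ hτ, hk, hc]

theorem exec_subRow (h : Operands X i n a src dst σ i₀ N s q j) (Y : Mat) (i' : ℕ) :
    ((subRow X i n a src dst).exec σ).cell Y i' =
      if Y = X ∧ i' = i₀ then subRowF N s q j (σ.cell Y i') else σ.cell Y i' := by
  rw [subRow, Prog.exec_rowLoop h.bound i₀ j (fun r => σ.cell X i₀ j r - s * σ.cell X i₀ q r)]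
  · split_ifs with hY
    · rw [hY.1, hY.2]; rfl
    · rfl
  · intro k _ τ hτ hk hc
    refine ⟨h.index _ hτ, h.dst _ hτ, ?_⟩
    simp [h.index _ hτ, h.dst _ hτ, h.src _ hτ, h.coeff _ hτ, hk, hc]

theorem exec_scaleRow (h : Operands X i n a dst dst σ i₀ N s j j) (Y : Mat) (i' : ℕ) :
    ((scaleRow X i n a dst).exec σ).cell Y i' =
      if Y = X ∧ i' = i₀ then scaleRowF N s j (σ.cell Y i') else σ.cell Y i' := by
  rw [scaleRow, Prog.exec_rowLoop h.bound i₀ j (fun r => s * σ.cell X i₀ j r)]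
  · split_ifs with hY
    · rw [hY.1, hY.2]; rfl
    · rfl
  · intro k _ τ hτ hk hc
    refine ⟨h.index _ hτ, h.dst _ hτ, ?_⟩
    simp [h.index _ hτ, h.dst _ hτ, h.coeff _ hτ, hk, hc]

/-! ### Column reduction -/

/-- The first `J` columns of the matrix `a` with `n` rows are reduced, with pivots recorded in `piv`
and `low`. -/
structure Reduced (a : ℕ → ℕ → K) (piv low : ℕ → ℕ) (n J : ℕ) : Prop where
  pivot : ∀ l < n, piv l ≠ 0 → ∃ j < J, piv l = j + 1 ∧ low j = l + 1
  lowest : ∀ j < J, low j ≠ 0 → ∃ l < n, low j = l + 1 ∧ piv l = j + 1 ∧ a l j ≠ 0 ∧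
    ∀ r < n, l < r → a r j = 0
  zero : ∀ j < J, low j = 0 → ∀ r < n, a r j = 0

/-- The first `J` columns are reduced, and column `J` is either reduced or vanishes in the last `k`
rows. -/
structure PartlyReduced (a : ℕ → ℕ → K) (piv low : ℕ → ℕ) (n J k : ℕ) : Prop where
  pivot : ∀ l < n, piv l ≠ 0 → ∃ j < J + 1, piv l = j + 1 ∧ low j = l + 1
  lowest : ∀ j < J + 1, low j ≠ 0 → ∃ l < n, low j = l + 1 ∧ piv l = j + 1 ∧ a l j ≠ 0 ∧
    ∀ r < n, l < r → a r j = 0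
  zero : ∀ j < J, low j = 0 → ∀ r < n, a r j = 0
  last : low J = 0 → ∀ r < n, n ≤ r + k → a r J = 0

theorem PartlyReduced.reduced {a : ℕ → ℕ → K} {piv low : ℕ → ℕ} {n J : ℕ}
    (h : PartlyReduced a piv low n J n) : Reduced a piv low n (J + 1) := by
  refine ⟨h.pivot, h.lowest, fun j hj h0 r hr => ?_⟩
  rcases Nat.lt_succ_iff_lt_or_eq.1 hj with hj | rfl
  · exact h.zero j hj h0 r hr
  · exact h.last h0 r hr (by omega)

/-- The stored value of `low J` may stem from an earlier index. It is reset before column `J` is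
scanned. -/
theorem Reduced.partlyReduced {a : ℕ → ℕ → K} {piv low : ℕ → ℕ} {n J : ℕ}
    (h : Reduced a piv low n J) :
    PartlyReduced a piv (fun j => if j = J then 0 else low j) n J 0 := by
  refine ⟨fun l hl hp => ?_, fun j hj hp => ?_, fun j hj h0 r hr => ?_, fun _ r _ _ => by omega⟩
  · obtain ⟨j, hj, h1, h2⟩ := h.pivot l hl hp
    exact ⟨j, by omega, h1, by rw [if_neg (by omega), h2]⟩
  · split_ifs at hp with h1
    · exact absurd rfl hp
    · simpa [h1] using h.lowest j (by omega) hp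
  · simp only [if_neg hj.ne] at h0
    exact h.zero j hj h0 r hr

theorem PartlyReduced.skip {a : ℕ → ℕ → K} {piv low : ℕ → ℕ} {n J k : ℕ}
    (h : PartlyReduced a piv low n J k) (h' : low J = 0 → a (n - (k + 1)) J = 0) :
    PartlyReduced a piv low n J (k + 1) := by
  refine ⟨h.pivot, h.lowest, h.zero, fun h0 r hr hk => ?_⟩
  by_cases hr' : n ≤ r + k
  · exact h.last h0 r hr hr'
  · obtain rfl : r = n - (k + 1) := by omega
    exact h' h0

/-- The scan goes upwards, so everything below row `l` already vanishes. No earlier pivot is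
disturbed since row `l` and column `J` had none. -/
theorem PartlyReduced.newPivot {a : ℕ → ℕ → K} {piv low : ℕ → ℕ} {n J k l : ℕ}
    (h : PartlyReduced a piv low n J k) (hk : k < n) (hl : l = n - (k + 1)) (h0 : low J = 0)
    (hp : piv l = 0) (ha : a l J ≠ 0) :
    PartlyReduced a (fun l' => if l' = l then J + 1 else piv l')
      (fun j => if j = J then l + 1 else low j) n J (k + 1) := by
  refine ⟨fun l' hl' hp' => ?_, fun j hj hp' => ?_, fun j hj hz r hr => ?_, fun hz => ?_⟩
  · split_ifs at hp' ⊢ with h1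
    · exact ⟨J, by omega, rfl, by simp [h1]⟩
    · obtain ⟨j, hj, h2, h3⟩ := h.pivot l' hl' hp'
      refine ⟨j, hj, h2, ?_⟩
      rw [if_neg, h3]
      rintro rfl
      omega
  · split_ifs at hp' ⊢ with h1
    · subst h1
      refine ⟨l, by omega, rfl, by simp, ha, fun r hr hlr => h.last h0 r hr (by omega)⟩
    · obtain ⟨l', hl', h2, h3, h4, h5⟩ := h.lowest j hj hp'
      refine ⟨l', hl', h2, ?_, h4, h5⟩
      rw [if_neg, h3]
      rintro rfl
      omega
  · simp only [if_neg hj.ne] at hz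
    exact h.zero j hj hz r hr
  · simp at hz

/-- The column with pivot in row `l` is different from `J`, because `J` has no pivot yet, and it
vanishes below `l`. The subtraction thus clears the entry in row `l` and keeps the zeros below it.
-/
theorem PartlyReduced.eliminate {a : ℕ → ℕ → K} {piv low : ℕ → ℕ} {n J k l : ℕ}
    (h : PartlyReduced a piv low n J k) (hk : k < n) (hl : l = n - (k + 1)) (h0 : low J = 0)
    (hp : piv l ≠ 0) :
    piv l - 1 < J ∧ PartlyReduced
      (subColF n (a l J * (a l (piv l - 1))⁻¹) (piv l - 1) J a) piv low n J (k + 1) := by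
  obtain ⟨q, hq, hpq, hlow⟩ := h.pivot l (by omega) hp
  have hqJ : q < J := by
    rcases Nat.lt_succ_iff_lt_or_eq.1 hq with hq | rfl
    · exact hq
    · omega
  obtain ⟨l', hl', h1, h2, h3, h4⟩ := h.lowest q hq (by omega)
  obtain rfl : l' = l := by omega
  rw [hpq, Nat.add_sub_cancel]
  refine ⟨hqJ, h.pivot, fun j hj hp' => ?_, fun j hj hz r hr => ?_, fun _ r hr hrk => ?_⟩
  · have hjJ : j ≠ J := by rintro rfl; exact hp' h0
    simpa [subColF, hjJ] using h.lowest j hj hp'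
  · simpa [subColF, hj.ne] using h.zero j hj hz r hr
  · simp only [subColF, hr, true_and, if_true]
    by_cases hrl : r = l'
    · subst hrl
      field_simp
      ring
    · rw [h.last h0 r hr (by omega), h4 r hr (by omega)]
      simp

end PresPersMod

/-! ### The column reduction as a program -/

namespace PresPersMod

open FieldRAM

variable {K : Type u} [Field K]

namespace Side

@[simp] theorem X_ne_scalar (sd : Side) : sd.X ≠ .scalar := by cases sd <;> decide
@[simp] theorem X_ne_f₀ (sd : Side) : sd.X ≠ .f₀ := by cases sd <;> decide
@[simp] theorem f₀_ne_X (sd : Side) : Mat.f₀ ≠ sd.X := by cases sd <;> decide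
@[simp] theorem piv_ne_low (sd : Side) : sd.piv ≠ sd.low := by cases sd <;> decide
@[simp] theorem low_ne_piv (sd : Side) : sd.low ≠ sd.piv := by cases sd <;> decide

/-- The register with the length of the columns, respectively rows, of `f₀`. -/
def len : Side → Reg | M => .numRows | N => .numCols

/-- The operation on `f₀` as a function on matrices. -/
def opF (sd : Side) (n : ℕ) (alive : ℕ → ℕ) (s : K) (q j : ℕ) (f : ℕ → ℕ → K) : ℕ → ℕ → K :=
  match sd with
  | M => subColF n s (alive q) (alive j) f
  | N => addRowF n s (alive j) (alive q) f

/-- The body of the inner loop of the column reduction. -/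
def reduceBody (sd : Side) : P :=
  .setReg .l (at' sd.dim next - (Reg.k + 1)) ;;
  .ite (.and (.eq (at' sd.low Reg.j) 0) (.not (.isZero (en sd.X Reg.i Reg.l Reg.j))))
    (.ite (.eq (at' sd.piv Reg.l) 0)
      (.setArr sd.piv Reg.l (Reg.j + 1) ;; .setArr sd.low Reg.j (Reg.l + 1))
      (.setReg .q (at' sd.piv Reg.l - 1) ;;
        .setCell .scalar 0 0 0 (en sd.X Reg.i Reg.l Reg.j * (en sd.X Reg.i Reg.l Reg.q)⁻¹) ;;
        subCol sd.X Reg.i (at' sd.dim next) sc Reg.q Reg.j ;;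
        sd.op))
    .skip

theorem reduce_eq (sd : Side) : sd.reduce =
    (.loop .l (at' sd.dim next) (.setArr sd.piv Reg.l 0) ;;
      .loop .j (at' sd.dim Reg.i) (.setArr sd.low Reg.j 0 ;;
        .loop .k (at' sd.dim next) sd.reduceBody)) := rfl

variable [DecidableEq K]

theorem exec_op (sd : Side) (τ : Store K Reg Arr Mat) (Y : Mat) (i' : ℕ) :
    (sd.op.exec τ).cell Y i' = if Y = .f₀ ∧ i' = 0 then
      sd.opF (τ.reg sd.len) (τ.arr sd.alive) (τ.cell .scalar 0 0 0) (τ.reg .q) (τ.reg .j)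
        (τ.cell Y i') else τ.cell Y i' := by
  cases sd
  · refine exec_subCol ⟨rfl, fun _ _ => rfl, fun ρ hρ => ?_, fun ρ hρ => ?_, fun ρ hρ => ?_⟩ Y i'
    · simp [hρ.cell .scalar 0 (by simp)]
    · simp [hρ.arr, hρ.reg .q (by simp), alive]
    · simp [hρ.arr, hρ.reg .j (by simp), alive]
  · refine exec_addRow ⟨rfl, fun _ _ => rfl, fun ρ hρ => ?_, fun ρ hρ => ?_, fun ρ hρ => ?_⟩ Y i'
    · simp [hρ.cell .scalar 0 (by simp)]
    · simp [hρ.arr, hρ.reg .j (by simp), alive]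
    · simp [hρ.arr, hρ.reg .q (by simp), alive]

/-- The relation `Inv` between the matrix and `f₀` is arbitrary, required only to survive a
simultaneous column operation and its counterpart on `f₀`. This separates the bookkeeping of pivots
from the meaning of the operations, which is supplied in `SideInvariant.reduce`. -/
theorem exec_reduceBody (sd : Side) {τ : Store K Reg Arr Mat} {i₀ n J k : ℕ}
    (Inv : (ℕ → ℕ → K) → (ℕ → ℕ → K) → Prop) (hi : τ.reg .i = i₀) (hj : τ.reg .j = J)
    (hk : τ.reg .k = k) (hkn : k < n) (hn : τ.arr sd.dim (i₀ + 1) = n)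
    (hInv : ∀ a f s q, q < J → Inv a f → Inv (subColF n s q J a)
      (sd.opF (τ.reg sd.len) (τ.arr sd.alive) s q J f))
    (hP : PartlyReduced (τ.cell sd.X i₀) (τ.arr sd.piv) (τ.arr sd.low) n J k)
    (h0 : Inv (τ.cell sd.X i₀) (τ.cell .f₀ 0)) :
    PartlyReduced ((sd.reduceBody.exec τ).cell sd.X i₀) ((sd.reduceBody.exec τ).arr sd.piv)
      ((sd.reduceBody.exec τ).arr sd.low) n J (k + 1) ∧
    Inv ((sd.reduceBody.exec τ).cell sd.X i₀) ((sd.reduceBody.exec τ).cell .f₀ 0) ∧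
    ∀ i', i' ≠ i₀ → (sd.reduceBody.exec τ).cell sd.X i' = τ.cell sd.X i' := by
  obtain ⟨l, hl⟩ : ∃ l, l = n - (k + 1) := ⟨_, rfl⟩
  rw [reduceBody, Prog.exec_seq, Prog.exec_setReg, Prog.exec_ite]
  simp only [eval_sub, eval_add, eval_arr, eval_reg, eval_one, hi, hk, hn, ← hl]
  split_ifs with h1
  · simp [BExp.eval, hi, hj] at h1
    rw [Prog.exec_ite]
    split_ifs with h2
    · simp [BExp.eval] at h2
      simp only [Prog.exec_seq, Prog.exec_setArr, Store.setArr_cell, Store.setReg_cell]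
      refine ⟨?_, h0, fun _ _ => trivial⟩
      convert hP.newPivot hkn hl h1.1 h2 h1.2 using 1
      · funext x; simp [hj]
      · funext x; simp [hj]
    · simp [BExp.eval] at h2
      obtain ⟨hq, hP'⟩ := hP.eliminate hkn hl h1.1 h2
      simp only [Prog.exec_seq, Prog.exec_setReg, Prog.exec_setCell]
      set ρ := ((τ.setReg .l l).setReg .q _).setCell .scalar _ _ _ _ with hρ
      have hsub := exec_subCol (K := K) (X := sd.X) (i := Reg.i) (n := at' sd.dim next) (a := sc)
        (src := Reg.q) (dst := Reg.j) (σ := ρ) (i₀ := i₀) (N := n)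
        (s := τ.cell sd.X i₀ l J * (τ.cell sd.X i₀ l (τ.arr sd.piv l - 1))⁻¹)
        (q := τ.arr sd.piv l - 1) (j := J) ⟨by simp [hρ, hi, hn],
          fun μ hμ => by simp [hμ.reg .i (by simp), hρ, hi],
          fun μ hμ => by simp [hμ.cell .scalar 0 (by simp [(X_ne_scalar sd).symm]), hρ, hi, hj],
          fun μ hμ => by simp [hμ.reg .q (by simp), hρ],
          fun μ hμ => by simp [hμ.reg .j (by simp), hρ, hj]⟩
      have hfr := Frame.exec (subCol sd.X Reg.i (at' sd.dim next) sc Reg.q Reg.j) ρ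
      set μ := (subCol sd.X Reg.i (at' sd.dim next) sc Reg.q Reg.j).exec ρ with hμ
      have hop := exec_op sd μ
      have hfr' := Frame.exec sd.op μ
      have hr1 : μ.reg sd.len = τ.reg sd.len := by
        rw [hfr.reg _ (by cases sd <;> rfl), hρ]; cases sd <;> simp [len]
      have hr2 : μ.arr = τ.arr := by
        funext a; rw [hfr.arr _ (by cases sd <;> rfl), hρ]; rfl
      have hr3 : μ.reg .q = τ.arr sd.piv l - 1 := by
        rw [hfr.reg _ (by cases sd <;> rfl), hρ]; simp
      have hr4 : μ.reg .j = J := by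
        rw [hfr.reg _ (by cases sd <;> rfl), hρ]; simp [hj]
      have hr5 : μ.cell .scalar 0 0 0 =
          τ.cell sd.X i₀ l J * (τ.cell sd.X i₀ l (τ.arr sd.piv l - 1))⁻¹ := by
        rw [hsub, if_neg (by simp [(X_ne_scalar sd).symm]), hρ]; simp [hi, hj]
      have hr6 : ∀ i', ρ.cell sd.X i' = τ.cell sd.X i' := fun i' => by
        funext r c; simp [hρ]
      have hr7 : ∀ i', ρ.cell .f₀ i' = τ.cell .f₀ i' := fun i' => by
        funext r c; simp [hρ]
      have hr8 : (sd.op.exec μ).arr = τ.arr := by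
        funext a; rw [hfr'.arr _ (by cases sd <;> rfl), hr2]
      simp only [hr8, hop, hsub, X_ne_f₀, f₀_ne_X, false_and, if_false, true_and, if_true, hr1, hr2,
        hr3, hr4, hr5, hr6, hr7]
      refine ⟨hP', hInv _ _ _ _ hq h0, fun i' hi' => by rw [if_neg hi']⟩
  · simp [BExp.eval, hi, hj] at h1
    simp only [Prog.exec, Store.setReg_cell, Store.setReg_arr]
    exact ⟨hP.skip (by rw [← hl]; exact h1), h0, fun _ _ => trivial⟩

/-- Preservation of `Inv` is demanded only for `q < j`. That operations go from left to right is
what makes them compatible with the birth times. -/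
theorem exec_reduce (sd : Side) {σ : Store K Reg Arr Mat} {i₀ n J : ℕ}
    (Inv : (ℕ → ℕ → K) → (ℕ → ℕ → K) → Prop) (hi : σ.reg .i = i₀)
    (hn : σ.arr sd.dim (i₀ + 1) = n) (hJ : σ.arr sd.dim i₀ = J)
    (hInv : ∀ a f s q j, q < j → j < J → Inv a f → Inv (subColF n s q j a)
      (sd.opF (σ.reg sd.len) (σ.arr sd.alive) s q j f))
    (h0 : Inv (σ.cell sd.X i₀) (σ.cell .f₀ 0)) :
    Reduced ((sd.reduce.exec σ).cell sd.X i₀) ((sd.reduce.exec σ).arr sd.piv)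
      ((sd.reduce.exec σ).arr sd.low) n J ∧
    Inv ((sd.reduce.exec σ).cell sd.X i₀) ((sd.reduce.exec σ).cell .f₀ 0) ∧
    ∀ i', i' ≠ i₀ → (sd.reduce.exec σ).cell sd.X i' = σ.cell sd.X i' := by
  rw [reduce_eq, Prog.exec_seq]
  have hF := Frame.exec (.loop .l (at' sd.dim next) (.setArr sd.piv Reg.l 0)) σ
  have hpiv : ∀ l < n, ((Prog.loop .l (at' sd.dim next) (.setArr sd.piv Reg.l 0) : P).exec σ).arr
      sd.piv l = 0 := by
    refine Prog.exec_loop_induction (fun k τ => ∀ l < k, τ.arr sd.piv l = 0) (by simp [hi, hn])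
      (by simp) fun k hk τ _ hτ l hl => ?_
    simp only [Prog.exec, eval_reg, eval_zero, Store.setArr_arr, Store.setReg_reg, if_true,
      Store.setReg_arr, true_and]
    split_ifs with h
    exacts [rfl, hτ l (by omega)]
  set σ₁ := (Prog.loop .l (at' sd.dim next) (.setArr sd.piv Reg.l 0) : P).exec σ with hσ₁
  clear_value σ₁
  have f1 : σ₁.reg .i = i₀ := (hF.reg .i rfl).trans hi
  have f2 : σ₁.arr sd.dim = σ.arr sd.dim := hF.arr _ (by cases sd <;> rfl)
  have f3 : σ₁.arr sd.alive = σ.arr sd.alive := hF.arr _ (by cases sd <;> rfl)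
  have f4 : σ₁.reg sd.len = σ.reg sd.len := hF.reg _ (by cases sd <;> rfl)
  have f5 : σ₁.cell = σ.cell := funext fun Y => hF.cell Y rfl
  rw [← f3, ← f4] at hInv
  rw [← f5] at h0 ⊢
  refine Prog.exec_loop_induction (fun j τ => Reduced (τ.cell sd.X i₀) (τ.arr sd.piv)
      (τ.arr sd.low) n j ∧ Inv (τ.cell sd.X i₀) (τ.cell .f₀ 0) ∧
      ∀ i', i' ≠ i₀ → τ.cell sd.X i' = σ₁.cell sd.X i') (by simp [f1, f2, hJ])
    ⟨⟨fun l hl h => absurd (hpiv l hl) h, by omega, by omega⟩, h0, fun _ _ => rfl⟩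
    fun j hj τ hτF ⟨hτ1, hτ2, hτ3⟩ => ?_
  rw [Prog.exec_seq, Prog.exec_setArr]
  set ρ := (τ.setReg .j j).setArr sd.low _ _ with hρ
  have g1 : ρ.reg .i = i₀ := by
    rw [← f1, ← hτF.reg .i (by cases sd <;> rfl)]; rfl
  have g2 : ρ.arr sd.dim = σ.arr sd.dim := by
    rw [← f2, ← hτF.arr sd.dim (by cases sd <;> rfl)]
    funext x; cases sd <;> simp [hρ, dim, low]
  have g3 : ρ.arr sd.alive = σ₁.arr sd.alive := by
    rw [← hτF.arr sd.alive (by cases sd <;> rfl)]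
    funext x; cases sd <;> simp [hρ, alive, low]
  have g4 : ρ.reg sd.len = σ₁.reg sd.len := by
    rw [← hτF.reg sd.len (by cases sd <;> rfl)]; cases sd <;> rfl
  have g5 : ρ.reg .j = j := rfl
  have g6 : ρ.arr sd.low = fun x => if x = j then 0 else τ.arr sd.low x := by
    funext x; simp [hρ]
  have g7 : ρ.arr sd.piv = τ.arr sd.piv := by
    funext x; simp [hρ]
  have g8 : ρ.cell = τ.cell := rfl
  rw [← g8] at hτ1 hτ2 hτ3
  clear_value ρ
  obtain ⟨r1, r2, r3⟩ := Prog.exec_loop_induction (x := .k) (e := at' sd.dim next)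
    (s := sd.reduceBody) (σ := ρ)
    (fun k τ => PartlyReduced (τ.cell sd.X i₀) (τ.arr sd.piv)
      (τ.arr sd.low) n j k ∧ Inv (τ.cell sd.X i₀) (τ.cell .f₀ 0) ∧
      ∀ i', i' ≠ i₀ → τ.cell sd.X i' = σ₁.cell sd.X i') (N := n) (by simp [g1, g2, hn])
    ⟨by rw [g6, g7]; exact hτ1.partlyReduced, hτ2, hτ3⟩ fun k hk μ hμF ⟨hμ1, hμ2, hμ3⟩ => by
      have := exec_reduceBody sd (τ := μ.setReg .k k) (i₀ := i₀) (n := n) (J := j) (k := k) Inv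
        (by rw [← g1, ← hμF.reg .i (by cases sd <;> rfl)]; rfl)
        (by rw [← g5, ← hμF.reg .j (by cases sd <;> rfl)]; rfl) rfl hk
        (by rw [← hn, ← g2, ← hμF.arr sd.dim (by cases sd <;> rfl)]; rfl)
        (fun a f s q hq h => by
          have e1 : (μ.setReg .k k).reg sd.len = σ₁.reg sd.len := by
            rw [← g4, ← hμF.reg sd.len (by cases sd <;> rfl)]; cases sd <;> rfl
          have e2 : (μ.setReg .k k).arr sd.alive = σ₁.arr sd.alive := by
            rw [← g3, ← hμF.arr sd.alive (by cases sd <;> rfl)]; rfl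
          rw [e1, e2]
          exact hInv a f s q j hq hj h) hμ1 hμ2
      exact ⟨this.1, this.2.1, fun i' hi' => (this.2.2 i' hi').trans (hμ3 i' hi')⟩
  exact ⟨r1.reduced, r2, r3⟩

end Side

end PresPersMod

namespace PresPersMod

open FieldRAM

variable {K : Type u} [Field K]

/-! ### Change of bases -/

namespace Side

@[simp] theorem X_ne_C (sd : Side) : sd.X ≠ .C := by cases sd <;> decide
@[simp] theorem C_ne_X (sd : Side) : Mat.C ≠ sd.X := by cases sd <;> decide

def other : Side → Side | M => N | N => M

def scaleC : Side → P
  | M => scaleCol .C next (at' .dimN next) (en .A Reg.i Reg.l Reg.q) Reg.l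
  | N => scaleRow .C next (at' .dimM next) (en .B Reg.i Reg.l Reg.q)⁻¹ Reg.l

def opC : Side → P
  | M => addCol .C next (at' .dimN next) (en .A Reg.i Reg.r Reg.q) Reg.r Reg.l
  | N => subRow .C next (at' .dimM next) (en .B Reg.i Reg.r Reg.q) Reg.l Reg.r

/-- On the side of `M` a basis vector and its column of `C` scale alike, but on the side of `N` the
coordinates scale by the inverse. -/
def scaleCF (sd : Side) (n : ℕ) (s : K) (l : ℕ) : (ℕ → ℕ → K) → ℕ → ℕ → K :=
  match sd with
  | M => scaleColF n s l
  | N => scaleRowF n s⁻¹ l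

/-- If `s • e r` is added to the basis vector `e l` of `N (i + 1)`, the coordinate at `r` loses `s`
times the coordinate at `l`. Therefore source and target are exchanged. -/
def opCF (sd : Side) (n : ℕ) (s : K) (r l : ℕ) : (ℕ → ℕ → K) → ℕ → ℕ → K :=
  match sd with
  | M => addColF n s r l
  | N => subRowF n s l r

def changeBasis (sd : Side) : P :=
  .loop .k (at' sd.dim next) (
    .setReg .l (at' sd.dim next - (Reg.k + 1)) ;;
    .ite (.eq (at' sd.piv Reg.l) 0) .skip (
      .setReg .q (at' sd.piv Reg.l - 1) ;;
      scaleCol sd.X next (at' sd.dim (next + 1)) (en sd.X Reg.i Reg.l Reg.q) Reg.l ;;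
      sd.scaleC ;;
      .loop .r Reg.l (
        addCol sd.X next (at' sd.dim (next + 1)) (en sd.X Reg.i Reg.r Reg.q) Reg.r Reg.l ;;
        sd.opC)))

end Side

theorem changeBasisM_eq : changeBasisM = Side.M.changeBasis := rfl
theorem changeBasisN_eq : changeBasisN = Side.N.changeBasis := rfl

/-- One step of the change of basis on the columns of a matrix with `n₂` rows. -/
def colStep (n₂ n₁ : ℕ) (a : ℕ → ℕ → K) (piv : ℕ → ℕ) (k : ℕ) (f : ℕ → ℕ → K) : ℕ → ℕ → K :=
  if piv (n₁ - (k + 1)) = 0 then f else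
    iterate (fun r => addColF n₂ (a r (piv (n₁ - (k + 1)) - 1)) r (n₁ - (k + 1))) (n₁ - (k + 1))
      (scaleColF n₂ (a (n₁ - (k + 1)) (piv (n₁ - (k + 1)) - 1)) (n₁ - (k + 1)) f)

/-- One step of the change of basis on the matrix `C`. -/
def Side.cStep (sd : Side) (n₂ n₁ : ℕ) (a : ℕ → ℕ → K) (piv : ℕ → ℕ) (k : ℕ) (f : ℕ → ℕ → K) :
    ℕ → ℕ → K :=
  if piv (n₁ - (k + 1)) = 0 then f else
    iterate (fun r => sd.opCF n₂ (a r (piv (n₁ - (k + 1)) - 1)) r (n₁ - (k + 1))) (n₁ - (k + 1))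
      (sd.scaleCF n₂ (a (n₁ - (k + 1)) (piv (n₁ - (k + 1)) - 1)) (n₁ - (k + 1)) f)

variable [DecidableEq K]

namespace Side

theorem exec_scaleC (sd : Side) (τ : Store K Reg Arr Mat) (Y : Mat) (i' : ℕ) :
    (sd.scaleC.exec τ).cell Y i' = if Y = .C ∧ i' = τ.reg .i + 1 then
      sd.scaleCF (τ.arr sd.other.dim (τ.reg .i + 1))
        (τ.cell sd.X (τ.reg .i) (τ.reg .l) (τ.reg .q)) (τ.reg .l) (τ.cell Y i')
      else τ.cell Y i' := by
  cases sd
  · refine exec_scaleCol ⟨rfl, fun ρ hρ => ?_, fun ρ hρ => ?_, fun ρ hρ => ?_, fun ρ hρ => ?_⟩ Y i'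
    all_goals simp [hρ.reg .i (by simp), hρ.reg .l (by simp), hρ.reg .q (by simp),
      hρ.cell .A (τ.reg .i) (by simp), X]
  · refine exec_scaleRow ⟨rfl, fun ρ hρ => ?_, fun ρ hρ => ?_, fun ρ hρ => ?_, fun ρ hρ => ?_⟩ Y i'
    all_goals simp [hρ.reg .i (by simp), hρ.reg .l (by simp), hρ.reg .q (by simp),
      hρ.cell .B (τ.reg .i) (by simp), X]

theorem exec_opC (sd : Side) (τ : Store K Reg Arr Mat) (Y : Mat) (i' : ℕ) :
    (sd.opC.exec τ).cell Y i' = if Y = .C ∧ i' = τ.reg .i + 1 then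
      sd.opCF (τ.arr sd.other.dim (τ.reg .i + 1))
        (τ.cell sd.X (τ.reg .i) (τ.reg .r) (τ.reg .q)) (τ.reg .r) (τ.reg .l) (τ.cell Y i')
      else τ.cell Y i' := by
  cases sd
  · refine exec_addCol ⟨rfl, fun ρ hρ => ?_, fun ρ hρ => ?_, fun ρ hρ => ?_, fun ρ hρ => ?_⟩ Y i'
    all_goals simp [hρ.reg .i (by simp), hρ.reg .l (by simp), hρ.reg .q (by simp),
      hρ.reg .r (by simp), hρ.cell .A (τ.reg .i) (by simp), X]
  · refine exec_subRow ⟨rfl, fun ρ hρ => ?_, fun ρ hρ => ?_, fun ρ hρ => ?_, fun ρ hρ => ?_⟩ Y i'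
    all_goals simp [hρ.reg .i (by simp), hρ.reg .l (by simp), hρ.reg .q (by simp),
      hρ.reg .r (by simp), hρ.cell .B (τ.reg .i) (by simp), X]

theorem exec_scaleX (sd : Side) (τ : Store K Reg Arr Mat) (Y : Mat) (i' : ℕ) :
    ((scaleCol sd.X next (at' sd.dim (next + 1)) (en sd.X Reg.i Reg.l Reg.q) Reg.l).exec τ).cell
      Y i' = if Y = sd.X ∧ i' = τ.reg .i + 1 then
      scaleColF (τ.arr sd.dim (τ.reg .i + 1 + 1))
        (τ.cell sd.X (τ.reg .i) (τ.reg .l) (τ.reg .q)) (τ.reg .l) (τ.cell Y i')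
      else τ.cell Y i' := by
  refine exec_scaleCol ⟨rfl, fun ρ hρ => ?_, fun ρ hρ => ?_, fun ρ hρ => ?_, fun ρ hρ => ?_⟩ Y i'
  all_goals simp [hρ.reg .i (by simp), hρ.reg .l (by simp), hρ.reg .q (by simp),
      hρ.cell sd.X (τ.reg .i) (by simp)]

theorem exec_addX (sd : Side) (τ : Store K Reg Arr Mat) (Y : Mat) (i' : ℕ) :
    ((addCol sd.X next (at' sd.dim (next + 1)) (en sd.X Reg.i Reg.r Reg.q) Reg.r Reg.l).exec
      τ).cell Y i' = if Y = sd.X ∧ i' = τ.reg .i + 1 then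
      addColF (τ.arr sd.dim (τ.reg .i + 1 + 1))
        (τ.cell sd.X (τ.reg .i) (τ.reg .r) (τ.reg .q)) (τ.reg .r) (τ.reg .l) (τ.cell Y i')
      else τ.cell Y i' := by
  refine exec_addCol ⟨rfl, fun ρ hρ => ?_, fun ρ hρ => ?_, fun ρ hρ => ?_, fun ρ hρ => ?_⟩ Y i'
  all_goals simp [hρ.reg .i (by simp), hρ.reg .l (by simp), hρ.reg .q (by simp),
      hρ.reg .r (by simp), hρ.cell sd.X (τ.reg .i) (by simp)]

/-- All coefficients are read at index `i` and everything is written at index `i + 1`. The program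
thus acts on the two matrices by iterated functions whose coefficients are those of the initial
memory. -/
theorem exec_changeBasis (sd : Side) {σ : Store K Reg Arr Mat} {i₀ n₁ : ℕ}
    (hi : σ.reg .i = i₀) (hn : σ.arr sd.dim (i₀ + 1) = n₁) :
    (sd.changeBasis.exec σ).cell sd.X (i₀ + 1) =
      iterate (colStep (σ.arr sd.dim (i₀ + 1 + 1)) n₁ (σ.cell sd.X i₀) (σ.arr sd.piv)) n₁
        (σ.cell sd.X (i₀ + 1)) ∧
    (sd.changeBasis.exec σ).cell .C (i₀ + 1) =
      iterate (sd.cStep (σ.arr sd.other.dim (i₀ + 1)) n₁ (σ.cell sd.X i₀) (σ.arr sd.piv)) n₁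
        (σ.cell .C (i₀ + 1)) ∧
    ∀ Y i', i' ≠ i₀ + 1 → (sd.changeBasis.exec σ).cell Y i' = σ.cell Y i' := by
  refine Prog.exec_loop_induction (fun k τ => τ.cell sd.X (i₀ + 1) =
      iterate (colStep (σ.arr sd.dim (i₀ + 1 + 1)) n₁ (σ.cell sd.X i₀) (σ.arr sd.piv)) k
        (σ.cell sd.X (i₀ + 1)) ∧
    τ.cell .C (i₀ + 1) =
      iterate (sd.cStep (σ.arr sd.other.dim (i₀ + 1)) n₁ (σ.cell sd.X i₀) (σ.arr sd.piv)) k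
        (σ.cell .C (i₀ + 1)) ∧
    ∀ Y i', i' ≠ i₀ + 1 → τ.cell Y i' = σ.cell Y i') (by simp [hi, hn])
    ⟨rfl, rfl, fun _ _ _ => rfl⟩ fun k hk τ hF ⟨h1, h2, h3⟩ => ?_
  have f1 : τ.reg .i = i₀ := (hF.reg _ (by cases sd <;> rfl)).trans hi
  have f2 : τ.arr = σ.arr := funext fun a => hF.arr _ (by cases sd <;> rfl)
  rw [iterate_succ, iterate_succ, ← h1, ← h2]
  simp only [← f2] at hn ⊢
  have h4 : σ.cell sd.X i₀ = τ.cell sd.X i₀ := (h3 _ _ (by omega)).symm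
  rw [h4]
  have h3' : ∀ (Y : Mat) (i' : ℕ), i' ≠ i₀ + 1 → σ.cell Y i' = τ.cell Y i' :=
    fun Y i' h => (h3 Y i' h).symm
  rw [Prog.exec_seq, Prog.exec_setReg, Prog.exec_ite]
  have hl : IExp.eval (τ.setReg .k k) (at' sd.dim next - (Reg.k + 1) : I) = n₁ - (k + 1) := by
    simp [f1, hn]
  rw [hl]
  unfold colStep cStep
  generalize n₁ - (k + 1) = l
  have hev : BExp.eval ((τ.setReg .k k).setReg .l l) (.eq (at' sd.piv Reg.l) 0) =
      decide (τ.arr sd.piv l = 0) := by simp [BExp.eval]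
  rw [hev]
  by_cases hp : τ.arr sd.piv l = 0
  · simp only [hp, decide_true, if_true, Prog.exec, Store.setReg_cell, true_and]
    exact h3
  simp only [hp, decide_false, if_false, Bool.false_eq_true]
  rw [Prog.exec_seq, Prog.exec_seq, Prog.exec_seq, Prog.exec_setReg]
  have hq : IExp.eval ((τ.setReg .k k).setReg .l l) (at' sd.piv Reg.l - 1 : I) =
      τ.arr sd.piv l - 1 := by simp
  rw [hq]
  generalize τ.arr sd.piv l - 1 = q
  obtain ⟨ρ, hρ⟩ : ∃ ρ, ((τ.setReg .k k).setReg .l l).setReg .q q = ρ := ⟨_, rfl⟩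
  have e1 : ρ.cell = τ.cell := by rw [← hρ]; rfl
  have e2 : ρ.arr = τ.arr := by rw [← hρ]; rfl
  have e3 : ρ.reg .i = i₀ := by rw [← hρ]; simp [f1]
  have e4 : ρ.reg .l = l := by rw [← hρ]; simp
  have e5 : ρ.reg .q = q := by rw [← hρ]; simp
  rw [hρ]
  clear hρ
  have hs := exec_scaleX sd ρ
  have hsF := Frame.exec (scaleCol sd.X next (at' sd.dim (next + 1))
    (en sd.X Reg.i Reg.l Reg.q) Reg.l) ρ
  generalize (scaleCol sd.X next (at' sd.dim (next + 1))
    (en sd.X Reg.i Reg.l Reg.q) Reg.l).exec ρ = ρ₁ at *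
  have hs' := exec_scaleC sd ρ₁
  have hsF' := Frame.exec sd.scaleC ρ₁
  generalize sd.scaleC.exec ρ₁ = ρ₂ at *
  have hr : ∀ y, y = .i ∨ y = .l ∨ y = .q → ρ₁.reg y = ρ.reg y ∧ ρ₂.reg y = ρ.reg y := by
    intro y hy
    have : ρ₁.reg y = ρ.reg y := by
      rcases hy with rfl | rfl | rfl <;> exact hsF.reg _ (by cases sd <;> rfl)
    refine ⟨this, this ▸ ?_⟩
    rcases hy with rfl | rfl | rfl <;> exact hsF'.reg _ (by cases sd <;> rfl)
  have ha : ρ₁.arr = τ.arr := (funext fun a => hsF.arr _ (by cases sd <;> rfl)).trans e2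
  have ha2 : ρ₂.arr = τ.arr := (funext fun a => hsF'.arr _ (by cases sd <;> rfl)).trans ha
  obtain ⟨hri, hri2⟩ := hr .i (by simp)
  obtain ⟨hrl, hrl2⟩ := hr .l (by simp)
  obtain ⟨hrq, hrq2⟩ := hr .q (by simp)
  rw [e3] at hri hri2
  rw [e4] at hrl hrl2
  rw [e5] at hrq hrq2
  simp only [hri, hrl, hrq, ha, e1, e2, e3, e4, e5] at hs hs'
  refine Prog.exec_loop_induction (N := l) (fun r μ =>
    μ.cell sd.X (i₀ + 1) = iterate (fun r => addColF (τ.arr sd.dim (i₀ + 1 + 1))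
      (τ.cell sd.X i₀ r q) r l) r (scaleColF (τ.arr sd.dim (i₀ + 1 + 1)) (τ.cell sd.X i₀ l q) l
        (τ.cell sd.X (i₀ + 1))) ∧
    μ.cell .C (i₀ + 1) = iterate (fun r => sd.opCF (τ.arr sd.other.dim (i₀ + 1))
      (τ.cell sd.X i₀ r q) r l) r (sd.scaleCF (τ.arr sd.other.dim (i₀ + 1)) (τ.cell sd.X i₀ l q) l
        (τ.cell .C (i₀ + 1))) ∧
    ∀ Y i', i' ≠ i₀ + 1 → μ.cell Y i' = σ.cell Y i') (by simp [hrl2])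
    ⟨by simp [hs', hs, iterate], by simp [hs', hs, iterate],
      fun Y i' hi' => by simp [hs', hs, hi', h3' Y i' hi']⟩
    fun r hr μ hμF ⟨k1, k2, k3⟩ => ?_
  have m1 : μ.reg .i = i₀ := (hμF.reg _ (by cases sd <;> rfl)).trans hri2
  have m2 : μ.reg .l = l := (hμF.reg _ (by cases sd <;> rfl)).trans hrl2
  have m3 : μ.reg .q = q := (hμF.reg _ (by cases sd <;> rfl)).trans hrq2
  have m4 : μ.arr = τ.arr := (funext fun a => hμF.arr _ (by cases sd <;> rfl)).trans ha2
  have m5 : μ.cell sd.X i₀ = τ.cell sd.X i₀ := (k3 _ _ (by omega)).trans (h3' _ _ (by omega))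
  rw [iterate_succ, iterate_succ, ← k1, ← k2, Prog.exec_seq]
  have ht := exec_addX sd (μ.setReg .r r)
  have htF := Frame.exec (addCol sd.X next (at' sd.dim (next + 1))
    (en sd.X Reg.i Reg.r Reg.q) Reg.r Reg.l) (μ.setReg .r r)
  generalize (addCol sd.X next (at' sd.dim (next + 1))
    (en sd.X Reg.i Reg.r Reg.q) Reg.r Reg.l).exec (μ.setReg .r r) = μ' at *
  have n1 : μ'.reg .i = i₀ := (htF.reg _ (by cases sd <;> rfl)).trans m1
  have n2 : μ'.reg .l = l := (htF.reg _ (by cases sd <;> rfl)).trans m2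
  have n3 : μ'.reg .q = q := (htF.reg _ (by cases sd <;> rfl)).trans m3
  have n4 : μ'.reg .r = r := (htF.reg _ (by cases sd <;> rfl)).trans rfl
  have n5 : μ'.arr = τ.arr := (funext fun a => htF.arr _ (by cases sd <;> rfl)).trans m4
  have ht' := exec_opC sd μ'
  simp only [n1, n2, n3, n4, n5] at ht'
  simp [m1, m2, m3, m4, m5] at ht
  have ht0 : μ'.cell sd.X i₀ = τ.cell sd.X i₀ := by rw [ht, if_neg (by omega), m5]
  simp only [ht0] at ht'
  refine ⟨by simp [ht', ht], by simp [ht', ht], fun Y i' hi' => by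
    simp [ht', ht, hi', k3 Y i' hi']⟩

end Side

end PresPersMod

namespace PresPersMod

open FieldRAM

variable {K : Type u} [Field K]

/-! ### Update of the bars -/

/-- The continued bars. -/
structure KeptBars (i₀ J : ℕ) (low al de al' de' ord' : ℕ → ℕ) (c₀ : ℕ) : Prop where
  le : c₀ ≤ J
  kept : ∀ s < c₀, ∃ j < J, low j ≠ 0 ∧ al' s = al j ∧ ord' s = low j - 1
  lt : ∀ s s', s < s' → s' < c₀ → al' s < al' s'
  exists_kept : ∀ j < J, low j ≠ 0 → ∃ s < c₀, al' s = al j ∧ ord' s = low j - 1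
  unchanged : ∀ s, J ≤ s → al' s = al s
  ended : ∀ j < J, low j = 0 → de' (al j) = i₀ + 1
  not_ended : ∀ x, (∀ j < J, low j = 0 → al j ≠ x) → de' x = de x

/-- The new bars. -/
structure NewBars (i₀ n : ℕ) (piv al bi de ord : ℕ → ℕ) (num c₀ : ℕ)
    (al' bi' de' ord' : ℕ → ℕ) (num' cnt : ℕ) : Prop where
  count : num + cnt = num' + c₀
  le : num ≤ num'
  old : ∀ s < c₀, al' s = al s ∧ ord' s = ord s
  new : ∀ s, c₀ ≤ s → s < cnt → al' s + c₀ = num + s ∧ ord' s < n ∧ piv (ord' s) = 0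
  lt : ∀ s s', c₀ ≤ s → s < s' → s' < cnt → ord' s < ord' s'
  exists_new : ∀ l < n, piv l = 0 → ∃ s, c₀ ≤ s ∧ s < cnt ∧ ord' s = l
  old_times : ∀ x < num, de' x = de x ∧ bi' x = bi x
  new_times : ∀ x, num ≤ x → x < num' → de' x = 0 ∧ bi' x = i₀ + 1

theorem KeptBars.death {i₀ J : ℕ} {low al de al' de' ord' : ℕ → ℕ} {c₀ : ℕ}
    (h : KeptBars i₀ J low al de al' de' ord' c₀)
    (hal : ∀ j < J + 1, ∀ j' < J + 1, al j = al j' → j = j')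
    (h0 : low J = 0) :
    KeptBars i₀ (J + 1) low al de al' (fun x => if x = al J then i₀ + 1 else de' x) ord' c₀ := by
  refine ⟨by have := h.le; omega, fun s hs => ?_, h.lt, fun j hj hne => ?_,
    fun s hs => h.unchanged s (by omega), fun j hj hz => ?_, fun x hx => ?_⟩
  · obtain ⟨j, hj, hh⟩ := h.kept s hs
    exact ⟨j, by omega, hh⟩
  · rcases Nat.lt_succ_iff_lt_or_eq.1 hj with hj | rfl
    · exact h.exists_kept j hj hne
    · exact absurd h0 hne
  · rcases Nat.lt_succ_iff_lt_or_eq.1 hj with hj | rfl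
    · split_ifs
      exacts [rfl, h.ended j hj hz]
    · simp
  · rw [if_neg (fun hh => hx J (by omega) h0 hh.symm)]
    exact h.not_ended x fun j hj => hx j (by omega)

/-- Bars are copied in their old order, so the new list stays increasing. -/
theorem KeptBars.continue {i₀ J : ℕ} {low al de al' de' ord' : ℕ → ℕ} {c₀ : ℕ}
    (h : KeptBars i₀ J low al de al' de' ord' c₀) (hal : ∀ j < J, al j < al J)
    (h0 : low J ≠ 0) :
    KeptBars i₀ (J + 1) low al de (fun x => if x = c₀ then al J else al' x) de'
      (fun x => if x = c₀ then low J - 1 else ord' x) (c₀ + 1) := by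
  have hle := h.le
  refine ⟨by omega, fun s hs => ?_, fun s s' hs hs' => ?_, fun j hj hne => ?_,
    fun s hs => ?_, fun j hj hz => ?_, fun x hx => h.not_ended x fun j hj => hx j (by omega)⟩
  · rcases Nat.lt_succ_iff_lt_or_eq.1 hs with hs | rfl
    · obtain ⟨j, hj, hh⟩ := h.kept s hs
      rw [if_neg hs.ne, if_neg hs.ne]
      exact ⟨j, by omega, hh⟩
    · exact ⟨J, by omega, h0, by simp, by simp⟩
  · rw [if_neg (by omega)]
    split_ifs with h1
    · obtain ⟨j, hj, -, hh, -⟩ := h.kept s (by omega)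
      rw [hh]
      exact hal j hj
    · exact h.lt s s' hs (by omega)
  · rcases Nat.lt_succ_iff_lt_or_eq.1 hj with hj | rfl
    · obtain ⟨s, hs, hh⟩ := h.exists_kept j hj hne
      exact ⟨s, by omega, by rwa [if_neg hs.ne, if_neg hs.ne]⟩
    · exact ⟨c₀, by omega, by simp⟩
  · rw [if_neg (by omega)]
    exact h.unchanged s (by omega)
  · rcases Nat.lt_succ_iff_lt_or_eq.1 hj with hj | rfl
    · exact h.ended j hj hz
    · exact absurd hz h0

theorem NewBars.skip {i₀ n : ℕ} {piv al bi de ord : ℕ → ℕ} {num c₀ : ℕ}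
    {al' bi' de' ord' : ℕ → ℕ} {num' cnt : ℕ}
    (h : NewBars i₀ n piv al bi de ord num c₀ al' bi' de' ord' num' cnt) (hp : piv n ≠ 0) :
    NewBars i₀ (n + 1) piv al bi de ord num c₀ al' bi' de' ord' num' cnt := by
  refine ⟨h.count, h.le, h.old, fun s hs hs' => ?_, h.lt, fun l hl h0 => ?_, h.old_times,
    h.new_times⟩
  · obtain ⟨h1, h2, h3⟩ := h.new s hs hs'
    exact ⟨h1, by omega, h3⟩
  · refine h.exists_new l ?_ h0
    rcases Nat.lt_succ_iff_lt_or_eq.1 hl with hl | rfl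
    exacts [hl, absurd h0 hp]

/-- The number of bars and the next free position advance together, which is why `count` persists.
-/
theorem NewBars.append {i₀ n : ℕ} {piv al bi de ord : ℕ → ℕ} {num c₀ : ℕ}
    {al' bi' de' ord' : ℕ → ℕ} {num' cnt : ℕ}
    (h : NewBars i₀ n piv al bi de ord num c₀ al' bi' de' ord' num' cnt) (hp : piv n = 0) :
    NewBars i₀ (n + 1) piv al bi de ord num c₀ (fun x => if x = cnt then num' else al' x)
      (fun x => if x = num' then i₀ + 1 else bi' x) (fun x => if x = num' then 0 else de' x)
      (fun x => if x = cnt then n else ord' x) (num' + 1) (cnt + 1) := by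
  have h1 := h.count
  have h2 := h.le
  refine ⟨by omega, by omega, fun s hs => ?_, fun s hs hs' => ?_, fun s s' hs hss hs' => ?_,
    fun l hl h0 => ?_, fun x hx => ?_, fun x hx hx' => ?_⟩
  · rw [if_neg (by omega), if_neg (by omega)]
    exact h.old s hs
  · split_ifs with h3
    · exact ⟨by omega, by omega, hp⟩
    · obtain ⟨h4, h5, h6⟩ := h.new s hs (by omega)
      exact ⟨h4, by omega, h6⟩
  · rw [if_neg (by omega)]
    split_ifs with h3
    · exact (h.new s hs (by omega)).2.1
    · exact h.lt s s' hs hss (by omega)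
  · rcases Nat.lt_succ_iff_lt_or_eq.1 hl with hl | rfl
    · obtain ⟨s, hs, hs', hh⟩ := h.exists_new l hl h0
      exact ⟨s, hs, by omega, by rwa [if_neg (by omega)]⟩
    · exact ⟨cnt, by omega, by omega, by simp⟩
  · rw [if_neg (by omega), if_neg (by omega)]
    exact h.old_times x hx
  · split_ifs with h3
    · simp
    · exact h.new_times x hx (by omega)

variable [DecidableEq K]

namespace Side

theorem exec_keepBars (sd : Side) {σ : Store K Reg Arr Mat} {i₀ J : ℕ}
    (hi : σ.reg .i = i₀) (hJ : σ.arr sd.dim i₀ = J) (hc : σ.reg .cnt = 0)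
    (hal : ∀ j j', j < j' → j' < J → σ.arr sd.alive j < σ.arr sd.alive j') :
    KeptBars i₀ J (σ.arr sd.low) (σ.arr sd.alive) (σ.arr sd.death)
      ((sd.keepBars.exec σ).arr sd.alive) ((sd.keepBars.exec σ).arr sd.death)
      ((sd.keepBars.exec σ).arr sd.ord) ((sd.keepBars.exec σ).reg .cnt) := by
  refine Prog.exec_loop_induction (fun j (τ : Store K Reg Arr Mat) =>
    KeptBars i₀ j (σ.arr sd.low) (σ.arr sd.alive)
    (σ.arr sd.death) (τ.arr sd.alive) (τ.arr sd.death) (τ.arr sd.ord) (τ.reg .cnt))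
    (by simp [hi, hJ]) ?_ fun j hj τ hF hτ => ?_
  · rw [hc]
    exact ⟨le_rfl, by omega, by omega, by omega, fun _ _ => rfl, by omega, fun _ _ => rfl⟩
  have f1 : τ.arr sd.low = σ.arr sd.low := hF.arr _ (by cases sd <;> rfl)
  have f2 : τ.reg .i = i₀ := (hF.reg _ (by cases sd <;> rfl)).trans hi
  -- The list of living bars is overwritten while it is read. This is harmless because the write
  -- position never exceeds `j`.
  have f3 : τ.arr sd.alive j = σ.arr sd.alive j := hτ.unchanged j le_rfl
  rw [Prog.exec_ite]
  split_ifs with h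
  · simp [BExp.eval, f1] at h
    have := hτ.death (fun a ha b hb hab => by
      by_contra hne
      rcases lt_or_gt_of_ne hne with hlt | hlt
      · have := hal a b hlt (by omega); omega
      · have := hal b a hlt (by omega); omega) h
    rw [← f3] at this
    convert this using 1
    · funext x; cases sd <;> simp [Prog.exec, Side.alive, Side.death]
    · funext x; cases sd <;> simp [Prog.exec, Side.alive, Side.death, f2]
      all_goals rfl
    · funext x; cases sd <;> simp [Prog.exec, Side.ord, Side.death]
    · simp [Prog.exec]
  · simp [BExp.eval, f1] at h
    have := hτ.continue (fun a ha => hal a j ha hj) h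
    rw [← f3, show σ.arr sd.low j = τ.arr sd.low j by rw [f1]] at this
    convert this using 1
    · funext x; cases sd <;> simp [Prog.exec, Side.alive, Side.ord]
    · funext x; cases sd <;> simp [Prog.exec, Side.alive, Side.death, Side.ord]
    · funext x; cases sd <;> simp [Prog.exec, Side.ord, Side.alive, Side.low]
    · simp [Prog.exec]

theorem exec_newBars (sd : Side) {σ : Store K Reg Arr Mat} {i₀ n : ℕ}
    (hi : σ.reg .i = i₀) (hn : σ.arr sd.dim (i₀ + 1) = n) :
    NewBars i₀ n (σ.arr sd.piv) (σ.arr sd.alive) (σ.arr sd.birth) (σ.arr sd.death)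
      (σ.arr sd.ord) (σ.reg sd.num) (σ.reg .cnt)
      ((sd.newBars.exec σ).arr sd.alive) ((sd.newBars.exec σ).arr sd.birth)
      ((sd.newBars.exec σ).arr sd.death) ((sd.newBars.exec σ).arr sd.ord)
      ((sd.newBars.exec σ).reg sd.num) ((sd.newBars.exec σ).reg .cnt) := by
  refine Prog.exec_loop_induction (fun l (τ : Store K Reg Arr Mat) =>
    NewBars i₀ l (σ.arr sd.piv) (σ.arr sd.alive)
    (σ.arr sd.birth) (σ.arr sd.death) (σ.arr sd.ord) (σ.reg sd.num) (σ.reg .cnt)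
    (τ.arr sd.alive) (τ.arr sd.birth) (τ.arr sd.death) (τ.arr sd.ord) (τ.reg sd.num)
    (τ.reg .cnt)) (by simp [hi, hn]) ?_ fun l hl τ hF hτ => ?_
  · exact ⟨rfl, le_rfl, fun _ _ => ⟨rfl, rfl⟩, by omega, by omega, by omega,
      fun _ _ => ⟨rfl, rfl⟩, by omega⟩
  have f1 : τ.arr sd.piv = σ.arr sd.piv := hF.arr _ (by cases sd <;> rfl)
  have f2 : τ.reg .i = i₀ := (hF.reg _ (by cases sd <;> rfl)).trans hi
  rw [Prog.exec_ite]
  split_ifs with h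
  · simp [BExp.eval, f1] at h
    convert hτ.append h using 1
    · funext x
      cases sd <;> simp [Prog.exec, Side.alive, Side.ord, Side.birth, Side.death, Side.num]
    · funext x; cases sd <;> simp [Prog.exec, Side.alive, Side.ord, Side.birth, Side.death,
        Side.num, f2]
      all_goals rfl
    · funext x
      cases sd <;> simp [Prog.exec, Side.alive, Side.ord, Side.birth, Side.death, Side.num]
      all_goals rfl
    · funext x
      cases sd <;> simp [Prog.exec, Side.alive, Side.ord, Side.birth, Side.death, Side.num]
    · cases sd <;> simp [Prog.exec, Side.num]
    · cases sd <;> simp [Prog.exec, Side.num]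
  · simp [BExp.eval, f1] at h
    cases sd <;> exact hτ.skip h

theorem exec_updateBars (sd : Side) {σ : Store K Reg Arr Mat} {i₀ J n : ℕ}
    (hi : σ.reg .i = i₀) (hJ : σ.arr sd.dim i₀ = J) (hn : σ.arr sd.dim (i₀ + 1) = n)
    (hal : ∀ j j', j < j' → j' < J → σ.arr sd.alive j < σ.arr sd.alive j') :
    ∃ (al' de' ord' : ℕ → ℕ) (c₀ cnt : ℕ),
      KeptBars i₀ J (σ.arr sd.low) (σ.arr sd.alive) (σ.arr sd.death) al' de' ord' c₀ ∧
      NewBars i₀ n (σ.arr sd.piv) al' (σ.arr sd.birth) de' ord' (σ.reg sd.num) c₀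
        ((sd.updateBars.exec σ).arr sd.alive) ((sd.updateBars.exec σ).arr sd.birth)
        ((sd.updateBars.exec σ).arr sd.death) ((sd.updateBars.exec σ).arr sd.ord)
        ((sd.updateBars.exec σ).reg sd.num) cnt := by
  rw [updateBars, Prog.exec_seq, Prog.exec_seq, Prog.exec_setReg]
  have h1 := exec_keepBars sd (σ := σ.setReg .cnt (IExp.eval σ 0)) hi hJ rfl hal
  have hF := Frame.exec sd.keepBars (σ.setReg .cnt (IExp.eval σ 0))
  have h2 := exec_newBars sd (σ := sd.keepBars.exec (σ.setReg .cnt (IExp.eval σ 0))) (i₀ := i₀)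
    (n := n) ((hF.reg _ (by cases sd <;> rfl)).trans hi)
    (by rw [hF.arr _ (by cases sd <;> rfl)]; exact hn)
  rw [hF.arr sd.piv (by cases sd <;> rfl), hF.arr sd.birth (by cases sd <;> rfl),
    hF.reg sd.num (by cases sd <;> rfl)] at h2
  have e : (σ.setReg .cnt (IExp.eval σ 0)).reg sd.num = σ.reg sd.num := by cases sd <;> rfl
  rw [e] at h2
  exact ⟨_, _, _, _, _, h1, h2⟩

end Side

/-- What the update of the bars does. -/
structure BarUpdate (i₀ J n : ℕ) (piv low al bi de : ℕ → ℕ) (num : ℕ)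
    (al' bi' de' ord' : ℕ → ℕ) (num' c₀ : ℕ) : Prop where
  le : c₀ ≤ n
  count : num + n = num' + c₀
  kept : ∀ s < c₀, ∃ j < J, low j ≠ 0 ∧ al' s = al j ∧ ord' s = low j - 1
  exists_kept : ∀ j < J, low j ≠ 0 → ∃ s < c₀, al' s = al j ∧ ord' s = low j - 1
  new : ∀ s, c₀ ≤ s → s < n → al' s + c₀ = num + s ∧ piv (ord' s) = 0
  lt : ∀ s s', s < s' → s' < n → al' s < al' s'
  bijOn : Set.BijOn ord' (Set.Iio n) (Set.Iio n)
  ended : ∀ j < J, low j = 0 → de' (al j) = i₀ + 1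
  not_ended : ∀ x < num, (∀ j < J, low j = 0 → al j ≠ x) → de' x = de x
  birth : ∀ x < num, bi' x = bi x
  new_times : ∀ x, num ≤ x → x < num' → de' x = 0 ∧ bi' x = i₀ + 1

/-- Every row of the reduced matrix occurs once in the new order: pivot rows through the column that
they belong to, the others directly. The new list of bars is increasing since continued bars have
numbers below the old `num` and new bars do not. -/
theorem Side.barUpdate (sd : Side) {σ : Store K Reg Arr Mat} {i₀ J n : ℕ} {a : ℕ → ℕ → K}
    (hi : σ.reg .i = i₀) (hJ : σ.arr sd.dim i₀ = J) (hn : σ.arr sd.dim (i₀ + 1) = n)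
    (hal : ∀ j j', j < j' → j' < J → σ.arr sd.alive j < σ.arr sd.alive j')
    (hal' : ∀ j < J, σ.arr sd.alive j < σ.reg sd.num)
    (hR : Reduced a (σ.arr sd.piv) (σ.arr sd.low) n J) :
    ∃ c₀, BarUpdate i₀ J n (σ.arr sd.piv) (σ.arr sd.low) (σ.arr sd.alive) (σ.arr sd.birth)
      (σ.arr sd.death) (σ.reg sd.num)
        ((sd.updateBars.exec σ).arr sd.alive) ((sd.updateBars.exec σ).arr sd.birth)
        ((sd.updateBars.exec σ).arr sd.death) ((sd.updateBars.exec σ).arr sd.ord)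
        ((sd.updateBars.exec σ).reg sd.num) c₀ := by
  obtain ⟨al, de, ord, c₀, cnt, h, h'⟩ := sd.exec_updateBars hi hJ hn hal
  generalize sd.updateBars.exec σ = τ at *
  have hcc : c₀ ≤ cnt := by have := h'.count; have := h'.le; omega
  have hlow : ∀ s < c₀, ∃ j < J, σ.arr sd.piv (τ.arr sd.ord s) = j + 1 ∧ al s = σ.arr sd.alive j ∧
      τ.arr sd.ord s < n := by
    intro s hs
    obtain ⟨j, hj, h1, h2, h3⟩ := h.kept s hs
    obtain ⟨l, hl, h4, h5, -⟩ := hR.lowest j hj h1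
    have : τ.arr sd.ord s = l := by rw [(h'.old s hs).2, h3]; omega
    exact ⟨j, hj, by rw [this, h5], h2, by rw [this]; exact hl⟩
  -- On continued positions `piv` is nonzero and recovers the column, and on new positions it is
  -- zero and the rows increase. This gives injectivity.
  have hbij : Set.BijOn (τ.arr sd.ord) (Set.Iio cnt) (Set.Iio n) := by
    refine ⟨fun s hs => ?_, fun s hs s' hs' hss => ?_, fun l hl => ?_⟩
    · by_cases hsc : s < c₀
      · exact (hlow s hsc).choose_spec.2.2.2
      · exact (h'.new s (by omega) hs).2.1
    · have aux : ∀ s s', s < cnt → s' < cnt → s < s' → τ.arr sd.ord s ≠ τ.arr sd.ord s' := by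
        intro s s' hs hs' hlt heq
        by_cases h1 : s' < c₀
        · obtain ⟨j, -, h2, h3, -⟩ := hlow s (by omega)
          obtain ⟨j', -, h4, h5, -⟩ := hlow s' h1
          have := h.lt s s' hlt h1
          rw [heq, h4] at h2
          obtain rfl : j' = j := by omega
          omega
        · have h2 := (h'.new s' (by omega) hs').2.2
          by_cases h3 : s < c₀
          · obtain ⟨j, -, h4, -⟩ := hlow s h3
            rw [heq] at h4
            omega
          · have := h'.lt s s' (by omega) hlt hs'
            omega
      by_contra hne
      rcases lt_or_gt_of_ne hne with hlt | hlt
      · exact aux s s' hs hs' hlt hss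
      · exact aux s' s hs' hs hlt hss.symm
    · by_cases hp : σ.arr sd.piv l = 0
      · obtain ⟨s, -, hs, hh⟩ := h'.exists_new l hl hp
        exact ⟨s, hs, hh⟩
      · obtain ⟨j, hj, h1, h2⟩ := hR.pivot l hl hp
        obtain ⟨s, hs, h3, h4⟩ := h.exists_kept j hj (by omega)
        exact ⟨s, hs.trans_le hcc, by rw [(h'.old s hs).2, h4]; omega⟩
  -- The number of filled positions follows from the bijection by counting.
  have hcnt : cnt = n := by
    simpa using Finset.card_nbij (s := Finset.range cnt) (t := Finset.range n) (τ.arr sd.ord)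
      (fun s hs => Finset.mem_range.2 (hbij.mapsTo (Finset.mem_range.1 hs)))
      (by simpa [Finset.coe_range] using hbij.injOn) (by simpa [Finset.coe_range] using hbij.surjOn)
  subst hcnt
  refine ⟨c₀, hcc, h'.count, fun s hs => ?_, fun j hj hne => ?_, fun s hs hs' => ?_,
    fun s s' hs hs' => ?_, hbij, fun j hj h0 => ?_, fun x hx hxe => ?_, fun x hx => ?_,
    h'.new_times⟩
  · rw [(h'.old s hs).1, (h'.old s hs).2]
    exact h.kept s hs
  · obtain ⟨s, hs, h1⟩ := h.exists_kept j hj hne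
    exact ⟨s, hs, by rwa [(h'.old s hs).1, (h'.old s hs).2]⟩
  · have := h'.new s hs hs'
    exact ⟨this.1, this.2.2⟩
  · by_cases h1 : s' < c₀
    · rw [(h'.old s (by omega)).1, (h'.old s' h1).1]
      exact h.lt s s' hs h1
    · have h2 := (h'.new s' (by omega) hs').1
      by_cases h3 : s < c₀
      · obtain ⟨j, hj, -, h4', -⟩ := hlow s h3
        rw [(h'.old s h3).1, h4']
        have := hal' j hj
        omega
      · have := (h'.new s (by omega) (by omega)).1
        omega
  · rw [(h'.old_times _ (hal' j hj)).1]
    exact h.ended j hj h0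
  · rw [(h'.old_times _ hx).1]
    exact h.not_ended x hxe
  · exact (h'.old_times x hx).2

end PresPersMod

namespace PresPersMod

open FieldRAM

variable {K : Type u} [Field K] [DecidableEq K]

/-! ### Sorting of the bases, extension of `f₀`, initialization -/

/-- A double loop that overwrites a matrix. -/
theorem exec_matrixLoop {X : Mat} {nr nc i : I} {w : E} {σ : Store K Reg Arr Mat} {Nr Nc i₀ : ℕ}
    {val : ℕ → ℕ → K} (hnr : nr.eval σ = Nr)
    (h : ∀ τ : Store K Reg Arr Mat, (∀ y, y ≠ .r → y ≠ .s → τ.reg y = σ.reg y) → τ.arr = σ.arr →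
      (∀ Y j, ¬ (Y = X ∧ j = i₀) → τ.cell Y j = σ.cell Y j) →
      i.eval τ = i₀ ∧ nc.eval τ = Nc ∧ w.eval τ = val (τ.reg .r) (τ.reg .s)) (Y : Mat) (i' : ℕ) :
    ((Prog.loop .r nr (.loop .s nc (.setCell X i Reg.r Reg.s w)) : P).exec σ).cell Y i' =
      if Y = X ∧ i' = i₀ then fun r c => if r < Nr ∧ c < Nc then val r c else σ.cell Y i' r c
      else σ.cell Y i' := by
  revert Y i'
  refine Prog.exec_loop_induction (fun k τ => ∀ Y i', τ.cell Y i' =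
      if Y = X ∧ i' = i₀ then fun r c => if r < k ∧ c < Nc then val r c else σ.cell Y i' r c
      else σ.cell Y i') hnr (by simp) fun k hk τ hF hτ Y i' => ?_
  have hreg : ∀ y, y ≠ .r → y ≠ .s → τ.reg y = σ.reg y := fun y hr hs =>
    hF.reg y (by simp [Prog.wReg, hr, hs])
  have harr : τ.arr = σ.arr := funext fun a => hF.arr a rfl
  have hcell : ∀ Y j, ¬ (Y = X ∧ j = i₀) → τ.cell Y j = σ.cell Y j := fun Y j hY => by
    rw [hτ, if_neg hY]
  rw [Prog.exec_rowLoop (N := Nc) (h (τ.setReg .r k) (fun y hr hs => by simp [hr, hreg y hr hs])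
    harr hcell).2.1 i₀ k (fun c => val k c)]
  · split_ifs with hY
    · funext r c
      rw [Store.setReg_cell, hτ, if_pos hY]
      by_cases h1 : r = k
      · subst h1
        by_cases h2 : c < Nc <;> simp [h2]
      · have : r < k + 1 ↔ r < k := by omega
        simp [h1, this]
    · rw [Store.setReg_cell, hcell Y i' hY]
  · intro c hc ρ hρ hs _
    have hr : ρ.reg .r = k := (hρ.reg .r (by decide)).trans (by simp)
    have := h ρ (fun y hr hs => (hρ.reg y hs).trans (by simp [hr, hreg y hr hs]))
      (hρ.arr.trans harr) fun Y j hY => (hρ.cell Y j hY).trans (hcell Y j hY)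
    refine ⟨this.1, by simpa using hr, ?_⟩
    rw [this.2.2, hr, hs]

/-- The detour through the temporary matrix avoids reading entries that have been overwritten
already. -/
theorem exec_permute {X : Mat} (hX : X ≠ .tmp) {nr nc row col : I} {σ : Store K Reg Arr Mat}
    {Nr Nc i₀ : ℕ} {ρ γ : ℕ → ℕ} (hi : σ.reg .i = i₀)
    (h : ∀ τ : Store K Reg Arr Mat, (∀ y, y ≠ .r → y ≠ .s → τ.reg y = σ.reg y) → τ.arr = σ.arr →
      nr.eval τ = Nr ∧ nc.eval τ = Nc ∧ row.eval τ = ρ (τ.reg .r) ∧ col.eval τ = γ (τ.reg .s))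
    (Y : Mat) (hY : Y ≠ .tmp) (i' : ℕ) :
    ((permute X nr nc row col).exec σ).cell Y i' = if Y = X ∧ i' = i₀ + 1 then
      fun r c => if r < Nr ∧ c < Nc then σ.cell Y i' (ρ r) (γ c) else σ.cell Y i' r c
      else σ.cell Y i' := by
  rw [permute, Prog.exec_seq]
  have h1 := exec_matrixLoop (X := .tmp) (nr := nr) (nc := nc) (i := 0) (w := en X next row col)
    (σ := σ) (Nr := Nr) (Nc := Nc) (i₀ := 0)
    (val := fun r c => σ.cell X (i₀ + 1) (ρ r) (γ c))
    (h σ (fun _ _ _ => rfl) rfl).1 fun τ hreg harr hcell => by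
      obtain ⟨h1, h2, h3, h4⟩ := h τ hreg harr
      refine ⟨rfl, h2, ?_⟩
      simp [h3, h4, hreg .i (by decide) (by decide), hi, hcell X (i₀ + 1) (by simp [hX])]
  have hF := Frame.exec (Prog.loop .r nr (.loop .s nc (.setCell .tmp 0 Reg.r Reg.s
    (en X next row col))) : P) σ
  generalize (Prog.loop .r nr (.loop .s nc (.setCell .tmp 0 Reg.r Reg.s
    (en X next row col))) : P).exec σ = τ at *
  have hreg : ∀ y, y ≠ .r → y ≠ .s → τ.reg y = σ.reg y := fun y hr hs =>
    hF.reg y (by simp [Prog.wReg, hr, hs])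
  have harr : τ.arr = σ.arr := funext fun a => hF.arr a rfl
  rw [exec_matrixLoop (X := X) (Nr := Nr) (Nc := Nc) (i₀ := i₀ + 1)
    (val := fun r c => τ.cell .tmp 0 r c) (h τ hreg harr).1 fun μ hreg' harr' hcell => by
      obtain ⟨h1, h2, h3, h4⟩ := h μ (fun y hr hs => (hreg' y hr hs).trans (hreg y hr hs))
        (harr'.trans harr)
      refine ⟨by simp [hreg' .i (by decide) (by decide), hreg .i (by decide) (by decide), hi],
        h2, ?_⟩
      simp [hcell .tmp 0 (by simp [hX.symm])]]
  simp only [h1, hY, false_and, if_false, and_self, if_true]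
  split_ifs with hYX
  · obtain ⟨rfl, rfl⟩ := hYX
    funext r c
    split_ifs with hrc
    · rfl
    · rfl
  · rfl

theorem exec_sortBases {σ : Store K Reg Arr Mat} {i₀ : ℕ} (hi : σ.reg .i = i₀) (Y : Mat)
    (hY : Y ≠ .tmp) (i' : ℕ) :
    (sortBases.exec σ).cell Y i' =
      if Y = .A ∧ i' = i₀ + 1 then fun r c => if r < σ.arr .dimM (i₀ + 1 + 1) ∧
        c < σ.arr .dimM (i₀ + 1) then σ.cell Y i' r (σ.arr .ordM c) else σ.cell Y i' r c
      else if Y = .B ∧ i' = i₀ + 1 then fun r c => if r < σ.arr .dimN (i₀ + 1 + 1) ∧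
        c < σ.arr .dimN (i₀ + 1) then σ.cell Y i' r (σ.arr .ordN c) else σ.cell Y i' r c
      else if Y = .C ∧ i' = i₀ + 1 then fun r c => if r < σ.arr .dimN (i₀ + 1) ∧
        c < σ.arr .dimM (i₀ + 1) then σ.cell Y i' (σ.arr .ordN r) (σ.arr .ordM c)
        else σ.cell Y i' r c
      else σ.cell Y i' := by
  rw [sortBases, Prog.exec_seq, Prog.exec_seq]
  have a1 := exec_permute (X := .A) (by decide) (nr := at' .dimM (next + 1))
    (nc := at' .dimM next) (row := Reg.r) (col := at' .ordM Reg.s) (σ := σ) (ρ := fun r => r)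
    (γ := σ.arr .ordM) (Nr := σ.arr .dimM (i₀ + 1 + 1)) (Nc := σ.arr .dimM (i₀ + 1)) hi
    fun τ hreg harr => by simp [hreg .i (by decide) (by decide), harr, hi]
  have f1 := Frame.exec (permute .A (at' .dimM (next + 1)) (at' .dimM next) Reg.r
    (at' .ordM Reg.s)) σ
  generalize (permute .A (at' .dimM (next + 1)) (at' .dimM next) Reg.r
    (at' .ordM Reg.s)).exec σ = σ₁ at *
  have i1 : σ₁.reg .i = i₀ := (f1.reg _ rfl).trans hi
  have r1 : σ₁.arr = σ.arr := funext fun a => f1.arr _ rfl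
  have a2 := exec_permute (X := .B) (by decide) (nr := at' .dimN (next + 1))
    (nc := at' .dimN next) (row := Reg.r) (col := at' .ordN Reg.s) (σ := σ₁) (ρ := fun r => r)
    (γ := σ.arr .ordN) (Nr := σ.arr .dimN (i₀ + 1 + 1)) (Nc := σ.arr .dimN (i₀ + 1)) i1
    fun τ hreg harr => by simp [hreg .i (by decide) (by decide), harr, i1, r1]
  have f2 := Frame.exec (permute .B (at' .dimN (next + 1)) (at' .dimN next) Reg.r
    (at' .ordN Reg.s)) σ₁
  generalize (permute .B (at' .dimN (next + 1)) (at' .dimN next) Reg.r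
    (at' .ordN Reg.s)).exec σ₁ = σ₂ at *
  have i2 : σ₂.reg .i = i₀ := (f2.reg _ rfl).trans i1
  have r2 : σ₂.arr = σ.arr := (funext fun a => f2.arr _ rfl).trans r1
  have a3 := exec_permute (X := .C) (by decide) (nr := at' .dimN next)
    (nc := at' .dimM next) (row := at' .ordN Reg.r) (col := at' .ordM Reg.s) (σ := σ₂)
    (ρ := σ.arr .ordN)
    (γ := σ.arr .ordM) (Nr := σ.arr .dimN (i₀ + 1)) (Nc := σ.arr .dimM (i₀ + 1)) i2
    fun τ hreg harr => by simp [hreg .i (by decide) (by decide), harr, i2, r2]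
  rw [a3 Y hY, a2 Y hY, a1 Y hY]
  by_cases h1 : i' = i₀ + 1
  · cases Y <;> simp [h1] at hY ⊢
  · simp [h1]

/-- The first two loops clear the new columns and rows, the third fills in the new columns at the
living rows. Injectivity of the list of living rows ensures that no filled entry is overwritten. -/
theorem exec_extend {σ : Store K Reg Arr Mat} {i₀ : ℕ} (hi : σ.reg .i = i₀)
    (hinj : ∀ s s', s < s' → s' < σ.arr .dimN (i₀ + 1) → σ.arr .aliveN s ≠ σ.arr .aliveN s')
    (hle : σ.reg .oldCols ≤ σ.reg .numCols) (hle' : σ.reg .oldRows ≤ σ.reg .numRows) :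
    (∀ Y i', Y ≠ .f₀ → (extend.exec σ).cell Y i' = σ.cell Y i') ∧
    (∀ r < σ.reg .oldRows, ∀ c < σ.reg .oldCols,
      (extend.exec σ).cell .f₀ 0 r c = σ.cell .f₀ 0 r c) ∧
    (∀ r, σ.reg .oldRows ≤ r → r < σ.reg .numRows → ∀ c < σ.reg .oldCols,
      (extend.exec σ).cell .f₀ 0 r c = 0) ∧
    (∀ s < σ.arr .dimN (i₀ + 1), ∀ j < σ.reg .numCols - σ.reg .oldCols,
      (extend.exec σ).cell .f₀ 0 (σ.arr .aliveN s) (σ.reg .oldCols + j) = σ.cell .C (i₀ + 1) s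
        (σ.arr .dimM (i₀ + 1) - (σ.reg .numCols - σ.reg .oldCols) + j)) ∧
    (∀ r < σ.reg .numRows, (∀ s < σ.arr .dimN (i₀ + 1), σ.arr .aliveN s ≠ r) →
      ∀ c, σ.reg .oldCols ≤ c → c < σ.reg .numCols → (extend.exec σ).cell .f₀ 0 r c = 0) := by
  rw [extend, Prog.exec_seq, Prog.exec_seq]
  have a1 : ∀ r c, ((Prog.loop .j (Reg.numCols - Reg.oldCols) (.loop .s Reg.numRows
      (.setCell .f₀ 0 Reg.s (Reg.oldCols + Reg.j) 0)) : P).exec σ).cell .f₀ 0 r c =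
      if r < σ.reg .numRows ∧ σ.reg .oldCols ≤ c ∧
        c < σ.reg .oldCols + (σ.reg .numCols - σ.reg .oldCols) then 0
      else σ.cell .f₀ 0 r c := by
    refine Prog.exec_loop_induction (fun k (τ : Store K Reg Arr Mat) => ∀ r c, τ.cell .f₀ 0 r c =
      if r < σ.reg .numRows ∧ σ.reg .oldCols ≤ c ∧ c < σ.reg .oldCols + k then 0
      else σ.cell .f₀ 0 r c) (by simp) (fun r c => (if_neg (by omega)).symm)
      fun k hk τ hF hτ r c => ?_
    rw [Prog.exec_colLoop (N := σ.reg .numRows) (by simp [hF.reg .numRows rfl]) 0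
      (σ.reg .oldCols + k)
      (fun _ => 0)]
    · simp only [if_true, Store.setReg_cell, and_self]
      rw [hτ]
      split_ifs <;> first | rfl | omega
    · intro s _ ρ hρ _ _
      refine ⟨rfl, ?_, rfl⟩
      simp [hρ.reg .oldCols (by decide), hρ.reg .j (by decide), hF.reg .oldCols rfl]
  have f1 := Frame.exec (Prog.loop .j (Reg.numCols - Reg.oldCols) (.loop .s Reg.numRows
      (.setCell .f₀ 0 Reg.s (Reg.oldCols + Reg.j) 0)) : P) σ
  generalize (Prog.loop .j (Reg.numCols - Reg.oldCols) (.loop .s Reg.numRows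
      (.setCell .f₀ 0 Reg.s (Reg.oldCols + Reg.j) 0)) : P).exec σ = σ₁ at *
  have a2 : ∀ r c, ((Prog.loop .j (Reg.numRows - Reg.oldRows) (.loop .s Reg.numCols
      (.setCell .f₀ 0 (Reg.oldRows + Reg.j) Reg.s 0)) : P).exec σ₁).cell .f₀ 0 r c =
      if c < σ.reg .numCols ∧ σ.reg .oldRows ≤ r ∧
        r < σ.reg .oldRows + (σ.reg .numRows - σ.reg .oldRows) then 0
      else σ₁.cell .f₀ 0 r c := by
    refine Prog.exec_loop_induction (fun k (τ : Store K Reg Arr Mat) => ∀ r c, τ.cell .f₀ 0 r c =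
      if c < σ.reg .numCols ∧ σ.reg .oldRows ≤ r ∧ r < σ.reg .oldRows + k then 0
      else σ₁.cell .f₀ 0 r c) (by simp [f1.reg .numRows rfl, f1.reg .oldRows rfl])
      (fun r c => (if_neg (by omega)).symm) fun k hk τ hF hτ r c => ?_
    rw [Prog.exec_rowLoop (N := σ.reg .numCols) (by simp [hF.reg .numCols rfl, f1.reg .numCols rfl])
      0 (σ.reg .oldRows + k) (fun _ => 0)]
    · simp only [if_true, Store.setReg_cell, and_self]
      rw [hτ]
      split_ifs <;> first | rfl | omega
    · intro s _ ρ hρ _ _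
      refine ⟨rfl, ?_, rfl⟩
      simp [hρ.reg .oldRows (by decide), hρ.reg .j (by decide), hF.reg .oldRows rfl,
        f1.reg .oldRows rfl]
  have f2 := Frame.exec (Prog.loop .j (Reg.numRows - Reg.oldRows) (.loop .s Reg.numCols
      (.setCell .f₀ 0 (Reg.oldRows + Reg.j) Reg.s 0)) : P) σ₁
  generalize (Prog.loop .j (Reg.numRows - Reg.oldRows) (.loop .s Reg.numCols
      (.setCell .f₀ 0 (Reg.oldRows + Reg.j) Reg.s 0)) : P).exec σ₁ = σ₂ at *
  have hc2 : ∀ Y, Y ≠ .f₀ → σ₂.cell Y = σ.cell Y := fun Y hY =>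
    (f2.cell Y (by simp [Prog.wCell, hY])).trans (f1.cell Y (by simp [Prog.wCell, hY]))
  have ha2 : σ₂.arr = σ.arr := funext fun a => (f2.arr a rfl).trans (f1.arr a rfl)
  have hr2 : ∀ y, y ≠ .j → y ≠ .s → σ₂.reg y = σ.reg y := fun y hj hs =>
    (f2.reg y (by simp [Prog.wReg, hj, hs])).trans (f1.reg y (by simp [Prog.wReg, hj, hs]))
  obtain ⟨h1, h2, h3⟩ := Prog.exec_loop_induction (x := .j)
    (e := ((Reg.numCols : I) - (Reg.oldCols : I) : I))
    (s := .loop .s (at' .dimN next) (.setCell .f₀ 0 (at' .aliveN Reg.s) (Reg.oldCols + Reg.j)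
      (en .C next Reg.s (at' .dimM next - (Reg.numCols - Reg.oldCols) + Reg.j)))) (σ := σ₂)
    (fun k (τ : Store K Reg Arr Mat) =>
      (∀ r c, (c < σ.reg .oldCols ∨ σ.reg .oldCols + k ≤ c) →
        τ.cell .f₀ 0 r c = σ₂.cell .f₀ 0 r c) ∧
      (∀ s < σ.arr .dimN (i₀ + 1), ∀ j < k, τ.cell .f₀ 0 (σ.arr .aliveN s) (σ.reg .oldCols + j) =
        σ.cell .C (i₀ + 1) s
          (σ.arr .dimM (i₀ + 1) - (σ.reg .numCols - σ.reg .oldCols) + j)) ∧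
      (∀ r c, (∀ s < σ.arr .dimN (i₀ + 1), σ.arr .aliveN s ≠ r) →
        τ.cell .f₀ 0 r c = σ₂.cell .f₀ 0 r c))
    (N := σ.reg .numCols - σ.reg .oldCols)
    (by simp [hr2 .numCols (by decide) (by decide), hr2 .oldCols (by decide) (by decide)])
    ⟨fun _ _ _ => rfl, by omega, fun _ _ _ => rfl⟩ fun k hk τ hF ⟨t1, t2, t3⟩ => by
      have ha : τ.arr = σ.arr := (funext fun a => hF.arr a rfl).trans ha2
      have hr : ∀ y, y ≠ .j → y ≠ .s → τ.reg y = σ.reg y := fun y hj hs =>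
        (hF.reg y (by simp [Prog.wReg, hj, hs])).trans (hr2 y hj hs)
      have hC : τ.cell .C = σ.cell .C := (hF.cell .C rfl).trans (hc2 .C (by decide))
      have hi' : τ.reg .i = i₀ := (hr .i (by decide) (by decide)).trans hi
      obtain ⟨u1, u2⟩ := Prog.exec_loop_setCell (x := .s) (e := at' .dimN next) (X := .f₀) (i := 0)
        (r := at' .aliveN Reg.s) (c := ((Reg.oldCols : I) + (Reg.j : I) : I)) (w := en .C next Reg.s
          (at' .dimM next - (Reg.numCols - Reg.oldCols) + Reg.j)) (σ := τ.setReg .j k)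
        (N := σ.arr .dimN (i₀ + 1)) (by simp [ha, hi']) 0 (σ.arr .aliveN)
        (fun _ => σ.reg .oldCols + k) (fun s => σ.cell .C (i₀ + 1) s
          (σ.arr .dimM (i₀ + 1) - (σ.reg .numCols - σ.reg .oldCols) + k))
        (fun s hs ρ hreg hx harr hcell => by
          have hcC : ρ.cell .C = σ.cell .C := by
            rw [← hC]
            funext j a b
            exact hcell _ _ _ _ fun _ _ => by simp
          have q1 := hr .oldCols (by decide) (by decide)
          have q2 := hr .numCols (by decide) (by decide)
          simp [hreg .oldCols (by decide), hreg .numCols (by decide), hreg .j (by decide),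
            hreg .i (by decide), hx, harr, ha, q1, q2, hi', hcC])
        (fun s s' h h' hh => hinj s s' h h' hh.1)
      refine ⟨fun r c hc => ?_, fun s hs j hj => ?_, fun r c hrc => ?_⟩
      · rw [u2 _ _ _ _ fun _ _ hh => by omega]
        exact t1 r c (by omega)
      · rcases Nat.lt_succ_iff_lt_or_eq.1 hj with hj | rfl
        · rw [u2 _ _ _ _ fun _ _ hh => by omega]
          exact t2 s hs j hj
        · exact u1 s hs
      · rw [u2 _ _ _ _ fun s hs hh => hrc s hs hh.2.2.1.symm]
        exact t3 r c hrc
  have f3 := Frame.exec (Prog.loop .j (Reg.numCols - Reg.oldCols) (.loop .s (at' .dimN next)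
    (.setCell .f₀ 0 (at' .aliveN Reg.s) (Reg.oldCols + Reg.j)
      (en .C next Reg.s (at' .dimM next - (Reg.numCols - Reg.oldCols) + Reg.j)))) : P) σ₂
  generalize (Prog.loop .j (Reg.numCols - Reg.oldCols) (.loop .s (at' .dimN next)
    (.setCell .f₀ 0 (at' .aliveN Reg.s) (Reg.oldCols + Reg.j)
      (en .C next Reg.s (at' .dimM next - (Reg.numCols - Reg.oldCols) + Reg.j)))) : P).exec σ₂ = σ₃
    at *
  refine ⟨fun Y i' hY => ?_, fun r hr c hc => ?_, fun r hr hr' c hc => ?_, h2, fun r hr hr' c hc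
    hc' => ?_⟩
  · rw [f3.cell Y (by simp [Prog.wCell, hY]), hc2 Y hY]
  · rw [h1 r c (by omega), a2, if_neg (by omega), a1, if_neg (by omega)]
  · rw [h1 r c (by omega), a2, if_pos (by omega)]
  · rw [h3 r c hr', a2, a1]
    split_ifs <;> first | rfl | omega

/-- The memory after the initialization. -/
theorem exec_start (σ : Store K Reg Arr Mat) :
    (start.exec σ).reg .numCols = σ.arr .dimM 0 ∧ (start.exec σ).reg .numRows = σ.arr .dimN 0 ∧
    (∀ j < σ.arr .dimM 0, (start.exec σ).arr .aliveM j = j ∧ (start.exec σ).arr .birthCol j = 0 ∧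
      (start.exec σ).arr .deathCol j = 0) ∧
    (∀ j < σ.arr .dimN 0, (start.exec σ).arr .aliveN j = j ∧ (start.exec σ).arr .birthRow j = 0 ∧
      (start.exec σ).arr .deathRow j = 0) ∧
    (∀ r < σ.arr .dimN 0, ∀ c < σ.arr .dimM 0,
      (start.exec σ).cell .f₀ 0 r c = σ.cell .C 0 r c) := by
  rw [start, Prog.exec_seq, Prog.exec_seq, Prog.exec_seq, Prog.exec_seq, Prog.exec_setReg,
    Prog.exec_setReg]
  obtain ⟨σ₁, hσ₁⟩ : ∃ σ₁, σ₁ = (σ.setReg .numCols (IExp.eval σ (at' .dimM 0))).setReg .numRows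
    (IExp.eval (σ.setReg .numCols (IExp.eval σ (at' .dimM 0))) (at' .dimN 0)) := ⟨_, rfl⟩
  have b1 : σ₁.reg .numCols = σ.arr .dimM 0 := by simp [hσ₁]
  have b2 : σ₁.reg .numRows = σ.arr .dimN 0 := by simp [hσ₁]
  have b3 : σ₁.arr = σ.arr := by rw [hσ₁]; rfl
  have b4 : σ₁.cell = σ.cell := by rw [hσ₁]; rfl
  rw [← hσ₁]
  clear hσ₁
  have a1 := Prog.exec_loop_induction (x := .j) (e := at' .dimM 0) (s :=
    (.setArr .aliveM Reg.j Reg.j ;; .setArr .birthCol Reg.j 0 ;; .setArr .deathCol Reg.j 0))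
    (σ := σ₁) (fun k (τ : Store K Reg Arr Mat) => ∀ j < k, τ.arr .aliveM j = j ∧
      τ.arr .birthCol j = 0 ∧ τ.arr .deathCol j = 0) (N := σ.arr .dimM 0) (by simp [b3])
    (by omega) fun k hk τ hF hτ j hj => by
      simp only [Prog.exec, eval_reg, eval_zero, Store.setArr_arr, Store.setReg_arr,
        Store.setArr_reg, Store.setReg_reg, if_true, reduceCtorEq, false_and, if_false, true_and]
      split_ifs with h
      · exact ⟨h.symm, rfl, rfl⟩
      · exact hτ j (by omega)
  have f1 := Frame.exec (.loop .j (at' .dimM 0) (.setArr .aliveM Reg.j Reg.j ;;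
    .setArr .birthCol Reg.j 0 ;; .setArr .deathCol Reg.j 0) : P) σ₁
  generalize (Prog.loop .j (at' .dimM 0) (.setArr .aliveM Reg.j Reg.j ;;
    .setArr .birthCol Reg.j 0 ;; .setArr .deathCol Reg.j 0) : P).exec σ₁ = σ₂ at *
  have a2 := Prog.exec_loop_induction (x := .j) (e := at' .dimN 0) (s :=
    (.setArr .aliveN Reg.j Reg.j ;; .setArr .birthRow Reg.j 0 ;; .setArr .deathRow Reg.j 0))
    (σ := σ₂) (fun k (τ : Store K Reg Arr Mat) => ∀ j < k, τ.arr .aliveN j = j ∧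
      τ.arr .birthRow j = 0 ∧ τ.arr .deathRow j = 0) (N := σ.arr .dimN 0)
    (by simp [f1.arr .dimN rfl, b3]) (by omega) fun k hk τ hF hτ j hj => by
      simp only [Prog.exec, eval_reg, eval_zero, Store.setArr_arr, Store.setReg_arr,
        Store.setArr_reg, Store.setReg_reg, if_true, reduceCtorEq, false_and, if_false, true_and]
      split_ifs with h
      · exact ⟨h.symm, rfl, rfl⟩
      · exact hτ j (by omega)
  have f2 := Frame.exec (.loop .j (at' .dimN 0) (.setArr .aliveN Reg.j Reg.j ;;
    .setArr .birthRow Reg.j 0 ;; .setArr .deathRow Reg.j 0) : P) σ₂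
  generalize (Prog.loop .j (at' .dimN 0) (.setArr .aliveN Reg.j Reg.j ;;
    .setArr .birthRow Reg.j 0 ;; .setArr .deathRow Reg.j 0) : P).exec σ₂ = σ₃ at *
  have c1 : σ₃.arr .dimM = σ.arr .dimM := by rw [f2.arr _ rfl, f1.arr _ rfl, b3]
  have c2 : σ₃.arr .dimN = σ.arr .dimN := by rw [f2.arr _ rfl, f1.arr _ rfl, b3]
  have c3 : σ₃.cell = σ.cell := funext fun Y => by rw [f2.cell _ rfl, f1.cell _ rfl, b4]
  have a3 := exec_matrixLoop (X := .f₀) (nr := at' .dimN 0) (nc := at' .dimM 0) (i := 0)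
    (w := en .C 0 Reg.r Reg.s) (σ := σ₃) (Nr := σ.arr .dimN 0) (Nc := σ.arr .dimM 0) (i₀ := 0)
    (val := σ.cell .C 0) (by simp [c2]) fun τ hreg harr hcell => by
      simp [harr, c1, hcell .C 0 (by decide), c3]
  have f3 := Frame.exec (.loop .r (at' .dimN 0) (.loop .s (at' .dimM 0)
    (.setCell .f₀ 0 Reg.r Reg.s (en .C 0 Reg.r Reg.s))) : P) σ₃
  generalize (Prog.loop .r (at' .dimN 0) (.loop .s (at' .dimM 0)
    (.setCell .f₀ 0 Reg.r Reg.s (en .C 0 Reg.r Reg.s))) : P).exec σ₃ = σ₄ at *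
  refine ⟨?_, ?_, fun j hj => ?_, fun j hj => ?_, fun r hr c hc => ?_⟩
  · rw [f3.reg _ rfl, f2.reg _ rfl, f1.reg _ rfl, b1]
  · rw [f3.reg _ rfl, f2.reg _ rfl, f1.reg _ rfl, b2]
  · rw [f3.arr _ rfl, f2.arr _ rfl, f3.arr _ rfl, f2.arr _ rfl, f3.arr _ rfl, f2.arr _ rfl]
    exact a1 j hj
  · rw [f3.arr _ rfl, f3.arr _ rfl, f3.arr _ rfl]
    exact a2 j hj
  · rw [a3, if_pos ⟨rfl, rfl⟩, if_pos ⟨hr, hc⟩]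

end PresPersMod

/-! ## Bars up to an index -/

namespace Persistence

variable {K : Type u} [Field K] {V : ℕ → Type v} [∀ i, AddCommGroup (V i)] [∀ i, Module K (V i)]

/-- The images of an element of `V i` under the maps of the persistence module `V`. -/
def push (T : ∀ i, V i →ₗ[K] V (i + 1)) {i : ℕ} (x : V i) : ∀ k, V k
  | 0 => Pi.single (M := V) i x 0
  | k + 1 => Pi.single (M := V) i x (k + 1) + T k (push T x k)

variable {T : ∀ i, V i →ₗ[K] V (i + 1)}

theorem push_of_lt {i : ℕ} (x : V i) {k : ℕ} (hk : k < i) : push T x k = 0 := by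
  induction k with
  | zero => exact Pi.single_eq_of_ne (by omega) x
  | succ k ih => rw [push, ih (by omega), Pi.single_eq_of_ne (by omega), map_zero, add_zero]

theorem push_self {i : ℕ} (x : V i) : push T x i = x := by
  cases i with
  | zero => exact Pi.single_eq_same 0 x
  | succ i => rw [push, push_of_lt x (by omega), Pi.single_eq_same, map_zero, add_zero]

theorem push_succ {i : ℕ} (x : V i) {k : ℕ} (hk : i ≤ k) : T k (push T x k) = push T x (k + 1) := by
  rw [push, Pi.single_eq_of_ne (by omega), zero_add]

/-- `num` bars with birth times `bi` and death times `de` (where `0` stands for `∞`) that decompose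
`V` up to the index `i`; `al` enumerates the bars that are alive at `i`, and `G c` is the generator
of the bar `c`. -/
structure Bars (T : ∀ i, V i →ₗ[K] V (i + 1)) (d : ℕ → ℕ) (i num : ℕ) (bi de al : ℕ → ℕ)
    (G : ℕ → ∀ k, V k) : Prop where
  birth_le : ∀ c < num, bi c ≤ i
  birth_mono : ∀ c c', c ≤ c' → c' < num → bi c ≤ bi c'
  death : ∀ c < num, de c = 0 ∨ bi c < de c ∧ de c ≤ i
  alive_lt : ∀ j < d i, al j < num
  alive_mono : ∀ j j', j < j' → j' < d i → al j < al j'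
  immortal : ∀ c < num, de c = 0 ↔ ∃ j < d i, al j = c
  map : ∀ c < num, ∀ k, bi c ≤ k → T k (G c k) = G c (k + 1)
  before : ∀ c < num, ∀ k < bi c, G c k = 0
  after : ∀ c < num, de c ≠ 0 → ∀ k, de c ≤ k → G c k = 0
  span : ∀ k ≤ i, ⊤ ≤ Submodule.span K ((fun c => G c k) '' Set.Iio num)
  card : ∀ k ≤ i, ((Finset.range num).filter
    fun c => bi c ≤ k ∧ (de c = 0 ∨ k < de c)).card = d k

/-- The coefficients `f` express `φ` in terms of bars. -/
structure Relates {W : ℕ → Type v} [∀ i, AddCommGroup (W i)] [∀ i, Module K (W i)]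
    (φ : ∀ i, V i →ₗ[K] W i) (nc nr : ℕ) (biC biR : ℕ → ℕ) (f : ℕ → ℕ → K)
    (G : ℕ → ∀ k, V k) (H : ℕ → ∀ k, W k) : Prop where
  birth : ∀ r < nr, ∀ c < nc, f r c ≠ 0 → biR r ≤ biC c
  map : ∀ c < nc, ∀ k, biC c ≤ k → φ k (G c k) = ∑ r ∈ Finset.range nr, f r c • H r k

/-- Subtract `s` times the bar `q` from the bar `j`. -/
def subBar (bi : ℕ → ℕ) (s : K) (q j : ℕ) (G : ℕ → ∀ k, V k) : ℕ → ∀ k, V k :=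
  fun c k => if c = j ∧ bi c ≤ k then G c k - s • G q k else G c k

namespace Bars

variable {d : ℕ → ℕ} {i num : ℕ} {bi de al : ℕ → ℕ} {G : ℕ → ∀ k, V k}

theorem alive_inj (h : Bars T d i num bi de al G) {j j' : ℕ} (hj : j < d i) (hj' : j' < d i)
    (hh : al j = al j') : j = j' := by
  rcases lt_trichotomy j j' with h1 | h1 | h1
  · exact absurd hh (h.alive_mono _ _ h1 hj').ne
  · exact h1
  · exact absurd hh (h.alive_mono _ _ h1 hj).ne'

theorem subBar (h : Bars T d i num bi de al G) (s : K) {q j : ℕ} (hq : q < j) (hj : j < d i) :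
    Bars T d i num bi de al (subBar bi s (al q) (al j) G) := by
  have hqj := h.alive_mono q j hq hj
  have hjn := h.alive_lt j hj
  have hb := h.birth_mono _ _ hqj.le hjn
  refine ⟨h.birth_le, h.birth_mono, h.death, h.alive_lt, h.alive_mono, h.immortal,
    fun c hc k hk => ?_, fun c hc k hk => ?_, fun c hc h0 k hk => ?_, fun k hk => ?_, h.card⟩
  · unfold Persistence.subBar
    rw [if_congr (and_iff_left hk) rfl rfl,
      if_congr (and_iff_left (by omega : bi c ≤ k + 1)) rfl rfl]
    split_ifs with h1
    · subst h1
      rw [map_sub, map_smul, h.map _ hc k hk, h.map _ (by omega) k (by omega)]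
    · exact h.map c hc k hk
  · rw [Persistence.subBar, if_neg (by omega), h.before c hc k hk]
  · rw [Persistence.subBar, if_neg, h.after c hc h0 k hk]
    rintro ⟨rfl, -⟩
    exact h0 ((h.immortal _ hc).2 ⟨j, hj, rfl⟩)
  · refine (h.span k hk).trans (Submodule.span_le.2 ?_)
    rintro _ ⟨c, hc, rfl⟩
    have hmem : ∀ c < num, Persistence.subBar bi s (al q) (al j) G c k ∈ Submodule.span K
        ((fun c => Persistence.subBar bi s (al q) (al j) G c k) '' Set.Iio num) :=
      fun c hc => Submodule.subset_span ⟨c, hc, rfl⟩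
    have h1 := hmem c hc
    by_cases hcj : c = al j ∧ bi c ≤ k
    · have h2 := hmem (al q) (by omega)
      rw [Persistence.subBar, if_pos hcj] at h1
      rw [Persistence.subBar, if_neg (by omega)] at h2
      simpa using Submodule.add_mem _ h1 (Submodule.smul_mem _ s h2)
    · rwa [Persistence.subBar, if_neg hcj] at h1

end Bars

namespace Relates

open PresPersMod

variable {W : ℕ → Type v} [∀ i, AddCommGroup (W i)] [∀ i, Module K (W i)]
  {φ : ∀ i, V i →ₗ[K] W i} {nc nr : ℕ} {biC biR : ℕ → ℕ} {f : ℕ → ℕ → K}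
  {G : ℕ → ∀ k, V k} {H : ℕ → ∀ k, W k}

/-- Linearity of `φ` gives the formula. The condition on births holds because a row with an entry in
column `q` is born no later than `q`, hence no later than `j`. -/
theorem subCol (h : Relates φ nc nr biC biR f G H) (s : K) {q j : ℕ} (hq : q < nc)
    (hb : biC q ≤ biC j) :
    Relates φ nc nr biC biR (subColF nr s q j f) (subBar biC s q j G) H := by
  refine ⟨fun r hr c hc hne => ?_, fun c hc k hk => ?_⟩
  · rw [subColF] at hne
    split_ifs at hne with h1
    · obtain ⟨-, rfl⟩ := h1
      by_cases h2 : f r c = 0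
      · have h3 : f r q ≠ 0 := fun h3 => hne (by simp [h2, h3])
        exact (h.birth r hr q hq h3).trans hb
      · exact h.birth r hr c hc h2
    · exact h.birth r hr c hc hne
  · rw [subBar, if_congr (and_iff_left hk) rfl rfl]
    split_ifs with h1
    · subst h1
      rw [map_sub, map_smul, h.map c hc k hk, h.map q hq k (hb.trans hk), Finset.smul_sum,
        ← Finset.sum_sub_distrib]
      refine Finset.sum_congr rfl fun r hr => ?_
      rw [subColF, if_pos ⟨Finset.mem_range.1 hr, rfl⟩, sub_smul, mul_smul]
    · rw [h.map c hc k hk]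
      refine Finset.sum_congr rfl fun r hr => ?_
      rw [subColF, if_neg (fun hh => h1 hh.2)]

/-- Rewriting `H j` as `(H j - s • H q) + s • H q` moves `s` times the coefficient of `j` to that of
`q`. -/
theorem addRow (h : Relates φ nc nr biC biR f G H) (s : K) {q j : ℕ} (hq : q < nr) (hj : j < nr)
    (hqj : q ≠ j) (hb : biR q ≤ biR j) :
    Relates φ nc nr biC biR (addRowF nc s j q f) G (subBar biR s q j H) := by
  refine ⟨fun r hr c hc hne => ?_, fun c hc k hk => ?_⟩
  · rw [addRowF] at hne
    split_ifs at hne with h1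
    · obtain ⟨-, rfl⟩ := h1
      by_cases h2 : f r c = 0
      · have h3 : f j c ≠ 0 := fun h3 => hne (by simp [h2, h3])
        exact hb.trans (h.birth j hj c hc h3)
      · exact h.birth r hr c hc h2
    · exact h.birth r hr c hc hne
  · rw [h.map c hc k hk]
    have e : ∀ r ∈ Finset.range nr, addRowF nc s j q f r c • subBar biR s q j H r k =
        f r c • H r k + ((if r = q then (s * f j c) • H q k else 0) -
          if r = j then (s * f j c) • H q k else 0) := by
      intro r hr
      rw [Finset.mem_range] at hr
      rw [addRowF, subBar]
      by_cases h1 : r = q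
      · subst h1
        simp [hc, hqj, add_smul]
      · by_cases h2 : r = j
        · subst h2
          by_cases h3 : biR r ≤ k
          · simp [h1, h3, smul_smul, mul_comm, sub_eq_add_neg]
          · have : f r c = 0 := by
              by_contra h4
              exact h3 ((h.birth r hj c hc h4).trans hk)
            simp [this, h1]
        · simp [h1, h2]
    rw [Finset.sum_congr rfl e, Finset.sum_add_distrib, Finset.sum_sub_distrib]
    simp [hq, hj]

end Relates

end Persistence

/-! ## Bars at the next index -/

namespace Persistence

open PresPersMod

variable {K : Type u} [Field K] {V : ℕ → Type v} [∀ i, AddCommGroup (V i)] [∀ i, Module K (V i)]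
  {T : ∀ i, V i →ₗ[K] V (i + 1)}

/-- The basis after the row reduction of the reduced matrix `a` with `n` rows. -/
def rowReducedBasis {E : Type*} [AddCommGroup E] [Module K E] (n : ℕ) (a : ℕ → ℕ → K)
    (piv : ℕ → ℕ) (e : ℕ → E) (l : ℕ) : E :=
  if piv l = 0 then e l else ∑ r ∈ Finset.range n, a r (piv l - 1) • e r

/-- The old bars together with the new bars, which are generated by elements of the basis `e`. -/
def appendBars (T : ∀ i, V i →ₗ[K] V (i + 1)) {i : ℕ} (G : ℕ → ∀ k, V k) (num c₀ : ℕ)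
    (ord : ℕ → ℕ) (e : ℕ → V (i + 1)) : ℕ → ∀ k, V k :=
  fun c => if c < num then G c else push T (e (ord (c - num + c₀)))

variable {d : ℕ → ℕ} {i num : ℕ} {bi de al : ℕ → ℕ} {G : ℕ → ∀ k, V k}
  {a : ℕ → ℕ → K} {piv low : ℕ → ℕ} {e : ℕ → V (i + 1)}
  {al' bi' de' ord' : ℕ → ℕ} {num' c₀ : ℕ}

/-- A continued bar arrives at `i + 1` as its reduced column, which is the new basis vector of its
pivot row. A new bar starts with the unchanged basis vector of a non-pivot row. -/
theorem appendBars_alive (h : Bars T d i num bi de al G)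
    (ha : ∀ j < d i, T i (G (al j) i) = ∑ r ∈ Finset.range (d (i + 1)), a r j • e r)
    (hR : Reduced a piv low (d (i + 1)) (d i))
    (hU : BarUpdate i (d i) (d (i + 1)) piv low al bi de num al' bi' de' ord' num' c₀)
    {s : ℕ} (hs : s < d (i + 1)) :
    appendBars T G num c₀ ord' e (al' s) (i + 1) =
      rowReducedBasis (d (i + 1)) a piv e (ord' s) := by
  rw [appendBars, rowReducedBasis]
  by_cases h1 : s < c₀
  · obtain ⟨j, hj, h0, h2, h3⟩ := hU.kept s h1
    obtain ⟨l, hl, h4, h5, -⟩ := hR.lowest j hj h0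
    have h6 : ord' s = l := by omega
    have hb := h.birth_le _ (h.alive_lt j hj)
    rw [h2, if_pos (h.alive_lt j hj), h6, h5, if_neg (by omega), ← h.map _ (h.alive_lt j hj) i hb,
      ha j hj]
    rfl
  · obtain ⟨h2, h3⟩ := hU.new s (by omega) hs
    rw [if_neg (by omega), if_pos h3, push_self]
    congr 2
    omega

/-- Spanning at `i + 1` holds because the living bars form a triangular modification of the basis
`e`. At earlier indices nothing changes: deaths are set to `i + 1` and new bars are born at `i + 1`,
so neither affects the count there. -/
theorem Bars.append (h : Bars T d i num bi de al G)
    (he : ⊤ ≤ Submodule.span K (e '' Set.Iio (d (i + 1))))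
    (ha : ∀ j < d i, T i (G (al j) i) = ∑ r ∈ Finset.range (d (i + 1)), a r j • e r)
    (hR : Reduced a piv low (d (i + 1)) (d i))
    (hU : BarUpdate i (d i) (d (i + 1)) piv low al bi de num al' bi' de' ord' num' c₀) :
    Bars T d (i + 1) num' bi' de' al' (appendBars T G num c₀ ord' e) := by
  have hcount := hU.count
  have hle := hU.le
  have hold : ∀ {c}, c < num → appendBars T G num c₀ ord' e c = G c := fun hc => if_pos hc
  have hnew : ∀ {c}, ¬ c < num → appendBars T G num c₀ ord' e c =
      push T (e (ord' (c - num + c₀))) := fun hc => if_neg hc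
  have hdead : ∀ j < d i, low j = 0 → ∀ k, i + 1 ≤ k → G (al j) k = 0 := by
    intro j hj h0 k hk
    have hb := h.birth_le _ (h.alive_lt j hj)
    induction k, hk using Nat.le_induction with
    | base =>
      rw [← h.map _ (h.alive_lt j hj) i hb, ha j hj]
      exact Finset.sum_eq_zero fun r hr => by
        rw [hR.zero j hj h0 r (Finset.mem_range.1 hr), zero_smul]
    | succ k hk ih => rw [← h.map _ (h.alive_lt j hj) k (by omega), ih, map_zero]
  -- An old bar either dies now, having been immortal so far, or keeps its death time.
  have htimes : ∀ c < num, (∃ j < d i, low j = 0 ∧ al j = c ∧ de c = 0 ∧ de' c = i + 1) ∨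
      de' c = de c ∧ ∀ j < d i, al j = c → low j ≠ 0 := by
    intro c hc
    by_cases hh : ∃ j < d i, low j = 0 ∧ al j = c
    · obtain ⟨j, hj, h0, rfl⟩ := hh
      exact .inl ⟨j, hj, h0, rfl, (h.immortal _ hc).2 ⟨j, hj, rfl⟩, hU.ended j hj h0⟩
    · push Not at hh
      exact .inr ⟨hU.not_ended c hc hh, fun j hj hjc h0 => hh j hj h0 hjc⟩
  have himm : ∀ c < num', de' c = 0 ↔ ∃ j < d (i + 1), al' j = c := by
    intro c hc
    constructor
    · intro h0
      by_cases h1 : c < num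
      · rcases htimes c h1 with ⟨j, hj, -, -, -, h2⟩ | ⟨h2, h3⟩
        · omega
        · obtain ⟨j, hj, h4⟩ := (h.immortal c h1).1 (by omega)
          obtain ⟨s, hs, h5, -⟩ := hU.exists_kept j hj (h3 j hj h4)
          exact ⟨s, by omega, by omega⟩
      · refine ⟨c - num + c₀, by omega, ?_⟩
        have := (hU.new (c - num + c₀) (by omega) (by omega)).1
        omega
    · rintro ⟨s, hs, rfl⟩
      by_cases h1 : s < c₀
      · obtain ⟨j, hj, h0, h2, -⟩ := hU.kept s h1
        rcases htimes (al' s) (by rw [h2]; exact h.alive_lt j hj) with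
          ⟨j', hj', h3, h4, -, -⟩ | ⟨h3, -⟩
        · rw [h.alive_inj hj' hj (h4.trans h2)] at h3
          exact absurd h3 h0
        · rw [h3, h2]
          exact (h.immortal _ (h.alive_lt j hj)).2 ⟨j, hj, rfl⟩
      · have := (hU.new s (by omega) hs).1
        exact (hU.new_times (al' s) (by omega) hc).1
  have hlt : ∀ s < d (i + 1), al' s < num' := by
    intro s hs
    by_cases h1 : s < c₀
    · obtain ⟨j, hj, -, h2, -⟩ := hU.kept s h1
      have := h.alive_lt j hj
      omega
    · have := (hU.new s (by omega) hs).1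
      omega
  refine ⟨fun c hc => ?_, fun c c' hcc hc' => ?_, fun c hc => ?_, hlt, hU.lt, himm,
    fun c hc k hk => ?_, fun c hc k hk => ?_, fun c hc h0 k hk => ?_, fun k hk => ?_,
    fun k hk => ?_⟩
  · by_cases h1 : c < num
    · have := h.birth_le c h1
      rw [hU.birth c h1]
      omega
    · exact (hU.new_times c (by omega) hc).2.le
  · by_cases h1 : c' < num
    · rw [hU.birth c (by omega), hU.birth c' h1]
      exact h.birth_mono c c' hcc h1
    · rw [(hU.new_times c' (by omega) hc').2]
      by_cases h2 : c < num
      · rw [hU.birth c h2]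
        exact (h.birth_le c h2).trans (Nat.le_succ i)
      · exact (hU.new_times c (by omega) (by omega)).2.le
  · by_cases h1 : c < num
    · rw [hU.birth c h1]
      have := h.birth_le c h1
      rcases htimes c h1 with ⟨-, -, -, -, -, h2⟩ | ⟨h2, -⟩
      · omega
      · have := h.death c h1
        omega
    · exact .inl (hU.new_times c (by omega) hc).1
  · by_cases h1 : c < num
    · rw [hU.birth c h1] at hk
      rw [hold h1]
      exact h.map c h1 k hk
    · rw [(hU.new_times c (by omega) hc).2] at hk
      rw [hnew h1, push_succ _ hk]
  · by_cases h1 : c < num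
    · rw [hU.birth c h1] at hk
      rw [hold h1]
      exact h.before c h1 k hk
    · rw [(hU.new_times c (by omega) hc).2] at hk
      rw [hnew h1, push_of_lt _ hk]
  · by_cases h1 : c < num
    · rw [hold h1]
      rcases htimes c h1 with ⟨j, hj, h2, rfl, -, h3⟩ | ⟨h2, -⟩
      · exact hdead j hj h2 k (by omega)
      · exact h.after c h1 (by omega) k (by omega)
    · exact absurd (hU.new_times c (by omega) hc).1 h0
  · rcases Nat.le_succ_iff_eq_or_le.1 hk with rfl | hk
    · refine he.trans (Submodule.span_le.2 ?_)
      rintro _ ⟨l, hl, rfl⟩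
      rw [Set.mem_Iio] at hl
      have hmem : ∀ s < d (i + 1), rowReducedBasis (d (i + 1)) a piv e (ord' s) ∈
          Submodule.span K ((fun c => appendBars T G num c₀ ord' e c (i + 1)) '' Set.Iio num') :=
        fun s hs => Submodule.subset_span ⟨al' s, hlt s hs, appendBars_alive h ha hR hU hs⟩
      -- For a pivot row, the new basis vector is a combination of `e r` with `r < l` plus a nonzero
      -- multiple of `e l`. The former are in the span by induction, hence so is `e l`.
      induction l using Nat.strong_induction_on with
      | _ l ih =>
      obtain ⟨s, hs, rfl⟩ := hU.bijOn.surjOn hl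
      have h1 := hmem s hs
      rw [rowReducedBasis] at h1
      split_ifs at h1 with h2
      · exact h1
      · obtain ⟨j, hj, h3, h4⟩ := hR.pivot _ hl h2
        obtain ⟨l', hl', h5, -, h6, h7⟩ := hR.lowest j hj (by omega)
        obtain rfl : l' = ord' s := by omega
        have h8 : ∑ r ∈ Finset.range (d (i + 1)), a r (piv (ord' s) - 1) • e r =
            ∑ r ∈ Finset.range (ord' s), a r j • e r + a (ord' s) j • e (ord' s) := by
          rw [h3, Nat.add_sub_cancel, ← Finset.sum_range_succ]
          refine (Finset.sum_subset (Finset.range_mono hl) fun r hr hr' => ?_).symm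
          simp only [Finset.mem_range] at hr hr'
          rw [h7 r hr (by omega), zero_smul]
        rw [h8] at h1
        have h9 := (Submodule.add_mem_iff_right _ (Submodule.sum_mem _ fun r hr =>
          Submodule.smul_mem _ (a r j) (ih r (Finset.mem_range.1 hr)
            ((Finset.mem_range.1 hr).trans hl)))).1 h1
        exact (Submodule.smul_mem_iff _ h6).1 h9
    · refine (h.span k hk).trans (Submodule.span_mono ?_)
      rintro _ ⟨c, hc, rfl⟩
      rw [Set.mem_Iio] at hc
      exact ⟨c, Set.mem_Iio.2 (by omega), by simp only [hold hc]⟩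
  · rcases Nat.le_succ_iff_eq_or_le.1 hk with rfl | hk
    · have : (Finset.range num').filter (fun c => bi' c ≤ i + 1 ∧ (de' c = 0 ∨ i + 1 < de' c)) =
          (Finset.range (d (i + 1))).image al' := by
        ext c
        simp only [Finset.mem_filter, Finset.mem_range, Finset.mem_image]
        constructor
        · rintro ⟨hc, -, h0⟩
          refine (himm c hc).1 (h0.resolve_right fun h1 => ?_)
          by_cases h2 : c < num
          · have := h.death c h2
            rcases htimes c h2 with ⟨-, -, -, -, -, h3⟩ | ⟨h3, -⟩ <;> omega
          · have := (hU.new_times c (by omega) hc).1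
            omega
        · rintro ⟨s, hs, rfl⟩
          refine ⟨hlt s hs, ?_, .inl ((himm _ (hlt s hs)).2 ⟨s, hs, rfl⟩)⟩
          by_cases h1 : al' s < num
          · rw [hU.birth _ h1]
            exact (h.birth_le _ h1).trans (Nat.le_succ i)
          · exact (hU.new_times _ (by omega) (hlt s hs)).2.le
      rw [this, Finset.card_image_of_injOn, Finset.card_range]
      intro s hs s' hs' hss
      simp only [Finset.coe_range, Set.mem_Iio] at hs hs'
      rcases lt_trichotomy s s' with h1 | h1 | h1
      · exact absurd hss (hU.lt _ _ h1 hs').ne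
      · exact h1
      · exact absurd hss (hU.lt _ _ h1 hs).ne'
    · rw [← h.card k hk]
      congr 1
      ext c
      simp only [Finset.mem_filter, Finset.mem_range]
      by_cases h1 : c < num
      · rw [hU.birth c h1]
        rcases htimes c h1 with ⟨-, -, -, -, h2, h3⟩ | ⟨h2, -⟩ <;> omega
      · by_cases h2 : c < num'
        · have := hU.new_times c (by omega) h2
          omega
        · omega

end Persistence

/-! ## Change of bases of matrices -/

namespace PresPersMod

open FieldRAM Persistence

variable {K : Type u} [Field K]

/-- The source columns lie to the left of `l` and are not touched in the process. -/
theorem iterate_addColF (n₂ l : ℕ) (α : ℕ → K) (s : K) (f : ℕ → ℕ → K) (N : ℕ) (hN : N ≤ l) :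
    iterate (fun r => addColF n₂ (α r) r l) N (scaleColF n₂ s l f) = fun r c =>
      if r < n₂ ∧ c = l then s * f r l + ∑ r' ∈ Finset.range N, α r' * f r r' else f r c := by
  induction N with
  | zero =>
    funext r c
    simp [iterate, scaleColF]
  | succ N ih =>
    rw [iterate_succ, ih (by omega)]
    funext r c
    have h : N ≠ l := by omega
    by_cases h1 : r < n₂ ∧ c = l
    · simp only [addColF, h1, h, and_true, and_false, if_true, if_false, Finset.sum_range_succ]
      ring
    · simp only [addColF, h1, if_false]

/-- The change of basis on columns. -/
theorem iterate_colStep {n₂ n₁ J : ℕ} {a : ℕ → ℕ → K} {piv low : ℕ → ℕ}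
    (hR : Reduced a piv low n₁ J) (f : ℕ → ℕ → K) {r c : ℕ} (hr : r < n₂) (hc : c < n₁) :
    iterate (colStep n₂ n₁ a piv) n₁ f r c = rowReducedBasis n₁ a piv (fun l => f r l) c := by
  -- Columns are replaced from the last to the first, so the columns left of `l` that enter column
  -- `l` are still the old ones. The full sum defining the new basis vector stops at `l`, because
  -- the reduced column vanishes below its pivot.
  have key : ∀ k ≤ n₁, ∀ c < n₁, iterate (colStep n₂ n₁ a piv) k f r c =
      if n₁ ≤ c + k then rowReducedBasis n₁ a piv (fun l => f r l) c else f r c := by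
    intro k
    induction k with
    | zero => exact fun _ c hc => (if_neg (by omega)).symm
    | succ k ih =>
      intro hk c hc
      rw [iterate_succ, colStep]
      obtain ⟨l, hl⟩ : ∃ l, l = n₁ - (k + 1) := ⟨_, rfl⟩
      rw [← hl]
      have ih := ih (by omega)
      split_ifs with h1 h2 h2
      · rw [ih c hc]
        split_ifs with h3
        · rfl
        · obtain rfl : c = l := by omega
          rw [rowReducedBasis, if_pos h1]
      · rw [ih c hc, if_neg (by omega)]
      · rw [iterate_addColF _ _ _ _ _ _ le_rfl]
        by_cases h3 : c = l
        · subst h3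
          obtain ⟨j, hj, h4, h5⟩ := hR.pivot _ hc h1
          obtain ⟨l', hl', h6, -, -, h7⟩ := hR.lowest j hj (by omega)
          obtain rfl : l' = c := by omega
          simp only [hr, and_self, if_true]
          rw [rowReducedBasis, if_neg h1, ih l' hc, if_neg (by omega), h4, Nat.add_sub_cancel,
            ← Finset.sum_subset (Finset.range_mono (Nat.succ_le_of_lt hc)) fun r' hr' hr'' => by
              simp only [Finset.mem_range] at hr' hr''
              rw [h7 r' hr' (by omega), zero_smul],
            Finset.sum_range_succ, add_comm, smul_eq_mul]
          congr 1
          refine Finset.sum_congr rfl fun r' hr' => ?_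
          rw [Finset.mem_range] at hr'
          rw [ih r' (by omega), if_neg (by omega), smul_eq_mul]
        · simp only [h3, and_false, if_false]
          rw [ih c hc, if_pos (by omega)]
      · rw [iterate_addColF _ _ _ _ _ _ le_rfl]
        have h3 : c ≠ l := by omega
        simp only [h3, and_false, if_false]
        rw [ih c hc, if_neg (by omega)]
  rw [key n₁ le_rfl c hc, if_pos (by omega)]

theorem iterate_subRowF (n₂ l : ℕ) (α : ℕ → K) (s : K) (f : ℕ → ℕ → K) (N : ℕ) (hN : N ≤ l) :
    iterate (fun r => subRowF n₂ (α r) l r) N (scaleRowF n₂ s l f) = fun r c =>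
      if c < n₂ ∧ r = l then s * f l c else
        if c < n₂ ∧ r < N then f r c - α r * (s * f l c) else f r c := by
  induction N with
  | zero =>
    funext r c
    simp [iterate, scaleRowF]
  | succ N ih =>
    rw [iterate_succ, ih (by omega)]
    funext r c
    have h : N ≠ l := by omega
    by_cases h0 : c < n₂
    · by_cases h1 : r = N
      · subst h1
        simp [subRowF, h0, h]
      · have h2 : r < N + 1 ↔ r < N := by omega
        simp [subRowF, h0, h1, h2]
    · simp [subRowF, h0]

/-- The change of basis on rows. -/
theorem iterate_cStep {E : Type*} [AddCommGroup E] [Module K E] {n₂ n₁ J : ℕ} {a : ℕ → ℕ → K}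
    {piv low : ℕ → ℕ} (hR : Reduced a piv low n₁ J) (f : ℕ → ℕ → K) (e : ℕ → E) {c : ℕ}
    (hc : c < n₂) :
    ∑ r ∈ Finset.range n₁, iterate (Side.N.cStep n₂ n₁ a piv) n₁ f r c •
      rowReducedBasis n₁ a piv e r = ∑ r ∈ Finset.range n₁, f r c • e r := by
  -- The vector is expanded in the mixed basis whose last `k` members have been replaced already.
  -- Each step changes basis and coordinates together and leaves the vector fixed.
  have key : ∀ k ≤ n₁, ∑ r ∈ Finset.range n₁, iterate (Side.N.cStep n₂ n₁ a piv) k f r c •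
      (if n₁ ≤ r + k then rowReducedBasis n₁ a piv e r else e r) =
        ∑ r ∈ Finset.range n₁, f r c • e r := by
    intro k
    induction k with
    | zero =>
      refine fun _ => Finset.sum_congr rfl fun r hr => ?_
      rw [Finset.mem_range] at hr
      rw [if_neg (by omega), iterate]
    | succ k ih =>
      intro hk
      rw [← ih (by omega), iterate_succ, Side.cStep]
      generalize iterate (Side.N.cStep n₂ n₁ a piv) k f = g
      obtain ⟨l, hl⟩ : ∃ l, l = n₁ - (k + 1) := ⟨_, rfl⟩
      rw [← hl]
      have hln : l < n₁ := by omega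
      split_ifs with h1
      · refine Finset.sum_congr rfl fun r hr => ?_
        congr 1
        split_ifs with h2 h3 h3
        · rfl
        · obtain rfl : r = l := by rw [Finset.mem_range] at hr; omega
          rw [rowReducedBasis, if_pos h1]
        · omega
        · rfl
      · obtain ⟨j, hj, h4, h5⟩ := hR.pivot _ hln h1
        obtain ⟨l', hl', h6, -, h8, h7⟩ := hR.lowest j hj (by omega)
        obtain rfl : l' = l := by omega
        have hb : rowReducedBasis n₁ a piv e l' =
            ∑ r ∈ Finset.range l', a r j • e r + a l' j • e l' := by
          rw [rowReducedBasis, if_neg h1, h4, Nat.add_sub_cancel,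
            ← Finset.sum_subset (Finset.range_mono (Nat.succ_le_of_lt hln)) fun r' hr' hr'' => by
              simp only [Finset.mem_range] at hr' hr''
              rw [h7 r' hr' (by omega), zero_smul], Finset.sum_range_succ]
        change ∑ r ∈ _, iterate (fun r => subRowF n₂ (a r (piv l' - 1)) l' r) l'
          (scaleRowF n₂ (a l' (piv l' - 1))⁻¹ l' g) r c • _ = _
        rw [iterate_subRowF _ _ _ _ _ _ le_rfl, h4, Nat.add_sub_cancel]
        -- This is the coordinate of the new basis vector. Subtracting `t • a r j` from the rows `r
        -- < l'` compensates its other terms.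
        obtain ⟨t, ht⟩ : ∃ t, t = (a l' j)⁻¹ * g l' c := ⟨_, rfl⟩
        have ht' : t * a l' j = g l' c := by rw [ht]; field_simp
        have hs : ∀ r ∈ Finset.range n₁, (if c < n₂ ∧ r = l' then (a l' j)⁻¹ * g l' c else
            if c < n₂ ∧ r < l' then g r c - a r j * ((a l' j)⁻¹ * g l' c) else g r c) •
            (if n₁ ≤ r + (k + 1) then rowReducedBasis n₁ a piv e r else e r) =
            g r c • (if n₁ ≤ r + k then rowReducedBasis n₁ a piv e r else e r) +
            ((if r = l' then t • rowReducedBasis n₁ a piv e l' - g l' c • e l' else 0) -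
              if r < l' then t • a r j • e r else 0) := by
          intro r hr
          rw [Finset.mem_range] at hr
          rw [← ht]
          simp only [hc, true_and]
          rcases lt_trichotomy r l' with h | h | h
          · rw [if_neg h.ne, if_pos h, if_neg (by omega), if_neg (by omega), if_neg h.ne, if_pos h,
              sub_smul, smul_smul, mul_comm t]
            abel
          · subst h
            rw [if_pos rfl, if_pos (by omega), if_neg (by omega), if_pos rfl, if_neg (by omega)]
            abel
          · rw [if_neg h.ne', if_neg (by omega), if_pos (by omega), if_pos (by omega),
              if_neg h.ne', if_neg (by omega)]
            simp
        rw [Finset.sum_congr rfl hs, Finset.sum_add_distrib, Finset.sum_sub_distrib,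
          Finset.sum_ite_eq', if_pos (Finset.mem_range.2 hln), ← Finset.sum_filter]
        have hf : (Finset.range n₁).filter (fun r => r < l') = Finset.range l' := by
          ext r; simp only [Finset.mem_filter, Finset.mem_range]; omega
        rw [hf, hb, smul_add, Finset.smul_sum, smul_smul, ht']
        abel
  rw [← key n₁ le_rfl]
  refine Finset.sum_congr rfl fun r hr => ?_
  rw [if_pos (by omega)]

end PresPersMod

namespace PresPersMod

open FieldRAM Persistence

variable {K : Type u} [Field K] [DecidableEq K]

/-! ### The second half of a step -/

/-- Everything in a step that follows the column reductions. -/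
def advance (σ : Store K Reg Arr Mat) : Store K Reg Arr Mat :=
  extend.exec (sortBases.exec (Side.N.updateBars.exec (Side.M.updateBars.exec
    ((Prog.setReg .oldRows Reg.numRows : P).exec ((Prog.setReg .oldCols Reg.numCols : P).exec
      (changeBasisN.exec (changeBasisM.exec σ)))))))

theorem exec_step_eq_advance (σ : Store K Reg Arr Mat) :
    step.exec σ = advance (Side.N.reduce.exec (Side.M.reduce.exec σ)) := exec_step σ

/-- The matrix `C (i + 1)` after the changes of bases. -/
def transformC (σ : Store K Reg Arr Mat) (D : Side → ℕ → ℕ) (i : ℕ) : ℕ → ℕ → K :=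
  iterate (Side.N.cStep (D .M (i + 1)) (D .N (i + 1)) (σ.cell .B i) (σ.arr .pivN)) (D .N (i + 1))
    (iterate (colStep (D .N (i + 1)) (D .M (i + 1)) (σ.cell .A i) (σ.arr .pivM)) (D .M (i + 1))
      (σ.cell .C (i + 1)))

/-- The memory `τ` results from `σ` by moving from `i` to `i + 1` after the column reductions. -/
structure Advanced (D : Side → ℕ → ℕ) (i : ℕ) (σ τ : Store K Reg Arr Mat) (c : Side → ℕ) :
    Prop where
  dim : ∀ sd : Side, τ.arr sd.dim = σ.arr sd.dim
  bars : ∀ sd : Side, BarUpdate i (D sd i) (D sd (i + 1)) (σ.arr sd.piv) (σ.arr sd.low)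
    (σ.arr sd.alive) (σ.arr sd.birth) (σ.arr sd.death) (σ.reg sd.num) (τ.arr sd.alive)
    (τ.arr sd.birth) (τ.arr sd.death) (τ.arr sd.ord) (τ.reg sd.num) (c sd)
  next : ∀ sd : Side, ∀ r < D sd (i + 1 + 1), ∀ s < D sd (i + 1), τ.cell sd.X (i + 1) r s =
    iterate (colStep (D sd (i + 1 + 1)) (D sd (i + 1)) (σ.cell sd.X i) (σ.arr sd.piv))
      (D sd (i + 1)) (σ.cell sd.X (i + 1)) r (τ.arr sd.ord s)
  later : ∀ sd : Side, ∀ k, i + 1 < k → τ.cell sd.X k = σ.cell sd.X k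
  later_C : ∀ k, i + 1 < k → τ.cell .C k = σ.cell .C k
  old : ∀ r < σ.reg .numRows, ∀ s < σ.reg .numCols, τ.cell .f₀ 0 r s = σ.cell .f₀ 0 r s
  newRow : ∀ r, σ.reg .numRows ≤ r → r < τ.reg .numRows → ∀ s < σ.reg .numCols,
    τ.cell .f₀ 0 r s = 0
  newCol : ∀ r < D .N (i + 1), ∀ j, σ.reg .numCols + j < τ.reg .numCols →
    τ.cell .f₀ 0 (τ.arr .aliveN r) (σ.reg .numCols + j) =
      transformC σ D i (τ.arr .ordN r) (τ.arr .ordM (c .M + j))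
  newCol_dead : ∀ r < τ.reg .numRows, (∀ s < D .N (i + 1), τ.arr .aliveN s ≠ r) →
    ∀ s, σ.reg .numCols ≤ s → s < τ.reg .numCols → τ.cell .f₀ 0 r s = 0

theorem BarUpdate.num_le {i₀ J n : ℕ} {piv low al bi de : ℕ → ℕ} {num : ℕ}
    {al' bi' de' ord' : ℕ → ℕ} {num' c₀ : ℕ}
    (h : BarUpdate i₀ J n piv low al bi de num al' bi' de' ord' num' c₀) : num ≤ num' := by
  have := h.le
  have := h.count
  omega

/-- The effects of the separate parts are composed. Between them the frame rule transports each
datum to the part where it is used. -/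
theorem advanced {D : Side → ℕ → ℕ} {i : ℕ} {σ : Store K Reg Arr Mat} (hi : σ.reg .i = i)
    (hD : ∀ sd : Side, σ.arr sd.dim = D sd)
    (hal : ∀ sd : Side, ∀ j j', j < j' → j' < D sd i → σ.arr sd.alive j < σ.arr sd.alive j')
    (hal' : ∀ sd : Side, ∀ j < D sd i, σ.arr sd.alive j < σ.reg sd.num)
    (hR : ∀ sd : Side, Reduced (σ.cell sd.X i) (σ.arr sd.piv) (σ.arr sd.low) (D sd (i + 1))
      (D sd i)) : ∃ c, Advanced D i σ (advance σ) c := by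
  unfold advance
  rw [changeBasisM_eq, changeBasisN_eq]
  obtain ⟨a1, a2, a3⟩ := Side.M.exec_changeBasis hi (congrFun (hD .M) (i + 1))
  have f1 := Frame.exec Side.M.changeBasis σ
  generalize Side.M.changeBasis.exec σ = σ₁ at *
  have i1 : σ₁.reg .i = i := (f1.reg _ rfl).trans hi
  have d1 : ∀ a, σ₁.arr a = σ.arr a := fun a => f1.arr _ rfl
  obtain ⟨b1, b2, b3⟩ := Side.N.exec_changeBasis i1 (by rw [d1, hD])
  have f2 := Frame.exec Side.N.changeBasis σ₁
  generalize Side.N.changeBasis.exec σ₁ = σ₂ at *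
  have d2 : ∀ a, σ₂.arr a = σ.arr a := fun a => (f2.arr _ rfl).trans (d1 a)
  obtain ⟨σ₃, h3⟩ : ∃ x, x = (Prog.setReg .oldCols Reg.numCols : P).exec σ₂ := ⟨_, rfl⟩
  rw [← h3]
  obtain ⟨σ₄, h4⟩ : ∃ x, x = (Prog.setReg .oldRows Reg.numRows : P).exec σ₃ := ⟨_, rfl⟩
  rw [← h4]
  have d4 : ∀ a, σ₄.arr a = σ.arr a := fun a => by rw [← d2, h4, h3]; rfl
  have c4 : σ₄.cell = σ₂.cell := by rw [h4, h3]; rfl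
  have r4 : ∀ sd : Side, σ₄.reg sd.num = σ.reg sd.num := fun sd => by
    rw [h4, h3, ← f1.reg _ (by cases sd <;> rfl), ← f2.reg _ (by cases sd <;> rfl)]
    cases sd <;> rfl
  have oc4 : σ₄.reg .oldCols = σ.reg .numCols := by
    rw [h4, h3, ← f1.reg _ rfl, ← f2.reg _ rfl]; rfl
  have or4 : σ₄.reg .oldRows = σ.reg .numRows := by
    rw [h4, h3, ← f1.reg _ rfl, ← f2.reg _ rfl]; rfl
  have i4 : σ₄.reg .i = i := by
    rw [h4, h3, ← i1, ← f2.reg _ rfl]; rfl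
  clear h3 h4
  have hU : ∃ c₀, _ := Side.M.barUpdate (a := σ.cell Side.M.X i) i4 (by rw [d4, hD])
    (by rw [d4, hD]) (by rw [d4]; exact hal .M) (by rw [d4, r4]; exact hal' .M)
    (by rw [d4, d4]; exact hR .M)
  have f5 := Frame.exec Side.M.updateBars σ₄
  generalize Side.M.updateBars.exec σ₄ = σ₅ at *
  have d5 : ∀ a, a = Side.N.dim ∨ a = Side.N.alive ∨ a = Side.N.birth ∨ a = Side.N.death ∨
      a = Side.N.piv ∨ a = Side.N.low ∨ a = Side.M.dim → σ₅.arr a = σ.arr a := by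
    intro a ha
    rw [← d4]
    rcases ha with rfl | rfl | rfl | rfl | rfl | rfl | rfl <;> exact f5.arr _ rfl
  have r5 : σ₅.reg Side.N.num = σ.reg Side.N.num := (f5.reg _ rfl).trans (r4 .N)
  have i5 : σ₅.reg .i = i := (f5.reg _ rfl).trans i4
  have hU' : ∃ c₀, _ := Side.N.barUpdate (σ := σ₅) (a := σ.cell Side.N.X i) i5
    (by rw [d5 _ (by simp), hD]) (by rw [d5 _ (by simp), hD])
    (by rw [d5 _ (by simp)]; exact hal .N) (by rw [d5 _ (by simp), r5]; exact hal' .N)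
    (by rw [d5 _ (by simp), d5 _ (by simp)]; exact hR .N)
  have f6 := Frame.exec Side.N.updateBars σ₅
  generalize Side.N.updateBars.exec σ₅ = σ₆ at *
  have d6 : ∀ a, a = Side.N.dim ∨ a = Side.M.dim → σ₆.arr a = σ.arr a := by
    intro a ha
    rw [← d5 a (by tauto)]
    rcases ha with rfl | rfl <;> exact f6.arr _ rfl
  have d6' : ∀ a, a = Side.M.alive ∨ a = Side.M.birth ∨ a = Side.M.death ∨ a = Side.M.ord →
      σ₆.arr a = σ₅.arr a := by
    intro a ha
    rcases ha with rfl | rfl | rfl | rfl <;> exact f6.arr _ rfl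
  have i6 : σ₆.reg .i = i := (f6.reg _ rfl).trans i5
  have c6 : σ₆.cell = σ₂.cell :=
    ((funext fun X => f6.cell X rfl).trans (funext fun X => f5.cell X rfl)).trans c4
  have g := exec_sortBases i6
  have f7 := Frame.exec sortBases σ₆
  generalize sortBases.exec σ₆ = σ₇ at *
  have d7 : σ₇.arr = σ₆.arr := funext fun a => f7.arr _ rfl
  obtain ⟨cM, hM⟩ := hU
  obtain ⟨cN, hN⟩ := hU'
  rw [← d6' _ (by simp), ← d6' _ (by simp), ← d6' _ (by simp), ← d6' _ (by simp),
    ← f6.reg Side.M.num rfl, ← f7.reg Side.M.num rfl, ← d7] at hM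
  simp only [d4, r4] at hM
  rw [← f7.reg Side.N.num rfl, ← d7, d5 _ (by simp), d5 _ (by simp), d5 _ (by simp),
    d5 _ (by simp), d5 _ (by simp), r5] at hN
  have i7 : σ₇.reg .i = i := (f7.reg _ rfl).trans i6
  have oc7 : σ₇.reg .oldCols = σ.reg .numCols := by
    rw [f7.reg _ rfl, f6.reg _ rfl, f5.reg _ rfl, oc4]
  have or7 : σ₇.reg .oldRows = σ.reg .numRows := by
    rw [f7.reg _ rfl, f6.reg _ rfl, f5.reg _ rfl, or4]
  have hDM : σ₇.arr .dimM = D .M := by rw [d7, ← hD]; exact d6 _ (by simp [Side.dim])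
  have hDN : σ₇.arr .dimN = D .N := by rw [d7, ← hD]; exact d6 _ (by simp [Side.dim])
  have hMle := hM.num_le
  have hNle := hN.num_le
  obtain ⟨e1, e2, e3, e4, e5⟩ := exec_extend i7
    (fun s s' hs hs' => (hN.lt s s' hs (by rwa [hDN] at hs')).ne)
    (oc7.trans_le hMle) (or7.trans_le hNle)
  have f8 := Frame.exec extend σ₇
  generalize extend.exec σ₇ = τ at *
  have d8 : τ.arr = σ₇.arr := funext fun a => f8.arr _ rfl
  have rM : σ₇.reg Side.M.num = τ.reg Side.M.num := (f8.reg _ rfl).symm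
  have rN : σ₇.reg Side.N.num = τ.reg Side.N.num := (f8.reg _ rfl).symm
  have hb : ∀ Y k, σ₆.cell Y k = σ₂.cell Y k := fun Y k => by rw [c6]
  have hMc := hM.count
  have hc1 : σ₆.arr .dimM = D .M := by rw [← d7, hDM]
  have hc2 : σ₆.arr .dimN = D .N := by rw [← d7, hDN]
  -- On the side of `M` the step on `C` unfolds to `colStep`, so `rfl` closes the comparison with
  -- `transformC`.
  have hCeq : σ₂.cell .C (i + 1) = transformC σ D i := by
    have h1 : σ.arr Side.M.other.dim = D .N := hD .N
    have h2 : σ.arr Side.N.other.dim = D .M := hD .M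
    rw [b2, a2, a3 _ i (by omega), d1, d1, h1, h2]
    rfl
  rw [rM, ← d8] at hM
  rw [rN, ← d8] at hN
  have hC7 : ∀ r < D .N (i + 1), ∀ s < D .M (i + 1), σ₇.cell .C (i + 1) r s =
      transformC σ D i (τ.arr .ordN r) (τ.arr .ordM s) := by
    intro r hr s hs
    rw [g .C (by decide) (i + 1)]
    simp only [reduceCtorEq, false_and, if_false, true_and, if_true, hc1, hc2, hr, hs, hb, hCeq,
      d8, d7]
  refine ⟨fun sd => match sd with | .M => cM | .N => cN, ⟨fun sd => ?_, fun sd => ?_, fun sd => ?_,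
    fun sd k hk => ?_, fun k hk => ?_, fun r hr s hs => ?_, fun r hr hr' s hs => ?_,
    fun r hr j hj => ?_, fun r hr hr' s hs hs' => ?_⟩⟩
  · rw [hD, d8]
    cases sd
    exacts [hDM, hDN]
  · cases sd
    exacts [hM, hN]
  · intro r hr s hs
    cases sd
    · rw [e1 _ _ (by decide), g _ (by decide)]
      simp only [Side.X, true_and, if_true, hc1, hr, hs, hb]
      have : σ₂.cell .A (i + 1) = σ₁.cell .A (i + 1) := congrFun (f2.cell .A rfl) _
      have h1 := a1
      rw [hD] at h1
      rw [this, d8, d7]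
      exact congrFun (congrFun h1 _) _
    · rw [e1 _ _ (by decide), g _ (by decide)]
      simp only [Side.X, reduceCtorEq, false_and, if_false, true_and, if_true, hc2, hr, hs, hb]
      have h1 : σ₁.cell Side.N.X = σ.cell Side.N.X := f1.cell _ rfl
      have h2 := b1
      rw [h1, d1, d1, hD] at h2
      rw [d8, d7]
      exact congrFun (congrFun h2 _) _
  · rw [e1 _ _ (by cases sd <;> decide), g _ (by cases sd <;> decide), hb]
    simp only [show k ≠ i + 1 by omega, and_false, if_false]
    rw [b3 _ k (by omega), a3 _ k (by omega)]
  · rw [e1 _ _ (by decide), g _ (by decide), hb]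
    simp only [show k ≠ i + 1 by omega, and_false, if_false]
    rw [b3 _ k (by omega), a3 _ k (by omega)]
  · rw [e2 r (by omega) s (by omega), g _ (by decide), hb]
    simp only [reduceCtorEq, false_and, if_false]
    -- The matrix `f₀` is stored at first index `0`, and the changes of bases modify only index `i +
    -- 1`.
    rw [b3 _ 0 (by omega), a3 _ 0 (by omega)]
  · exact e3 r (by omega) (by rw [f8.reg _ rfl] at hr'; exact hr') s (by omega)
  · have h1 : τ.reg .numCols = σ₇.reg .numCols := f8.reg _ rfl
    have h2 := e4 r (by rwa [hDN]) j (by omega)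
    have hle := hM.le
    have hco : σ.reg .numCols + D .M (i + 1) = σ₇.reg .numCols + cM := hMc
    rw [oc7, hDM, show D .M (i + 1) - (σ₇.reg .numCols - σ.reg .numCols) = cM by omega,
      ← d8, hC7 r hr _ (by omega)] at h2
    exact h2
  · have h1 : τ.reg .numCols = σ₇.reg .numCols := f8.reg _ rfl
    have h2 : τ.reg .numRows = σ₇.reg .numRows := f8.reg _ rfl
    exact e5 r (by omega) (by rw [hDN, ← d8]; exact hr') s (by omega) (by omega)

end PresPersMod

/-! ### Row-reduced families under linear maps -/

namespace Persistence

variable {K : Type u} [Field K] {E E' : Type v} [AddCommGroup E] [Module K E] [AddCommGroup E']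
  [Module K E'] {n : ℕ} {a : ℕ → ℕ → K} {piv : ℕ → ℕ}

theorem map_rowReducedBasis (L : E →ₗ[K] E') (e : ℕ → E) (l : ℕ) :
    L (rowReducedBasis n a piv e l) = rowReducedBasis n a piv (fun l => L (e l)) l := by
  rw [rowReducedBasis, rowReducedBasis]
  split_ifs
  · rfl
  · rw [map_sum]
    exact Finset.sum_congr rfl fun r _ => map_smul _ _ _

/-- The row-reduced family depends linearly on the given one, with fixed coefficients. The same
combination can therefore be applied to the coordinates. -/
theorem rowReducedBasis_sum {n' : ℕ} {x : ℕ → E} {w : ℕ → E} {f : ℕ → ℕ → K}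
    (h : ∀ l < n, x l = ∑ r ∈ Finset.range n', f r l • w r) {l : ℕ} (hl : l < n) :
    rowReducedBasis n a piv x l =
      ∑ r ∈ Finset.range n', rowReducedBasis n a piv (fun l => f r l) l • w r := by
  simp only [rowReducedBasis]
  split_ifs
  · exact h l hl
  · simp only [smul_eq_mul, Finset.sum_smul]
    rw [Finset.sum_comm]
    refine Finset.sum_congr rfl fun r hr => ?_
    rw [h r (Finset.mem_range.1 hr), Finset.smul_sum]
    exact Finset.sum_congr rfl fun r' _ => by rw [mul_smul]

end Persistence

/-! ## The invariant of the algorithm -/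

namespace PresPersMod

open FieldRAM Persistence

variable {K : Type u} [Field K] [DecidableEq K]
  {V : ℕ → Type v} [∀ i, AddCommGroup (V i)] [∀ i, Module K (V i)]
  {W : ℕ → Type v} [∀ i, AddCommGroup (W i)] [∀ i, Module K (W i)]

/-- The bars at index `i`, and the matrices of the maps from `i` on, where the family `β k` stands
for the given basis at the index `k`. -/
structure SideInvariant (sd : Side) (T : ∀ i, V i →ₗ[K] V (i + 1)) (β : ∀ k, ℕ → V k) (d : ℕ → ℕ)
    (m i : ℕ) (σ : Store K Reg Arr Mat) (G : ℕ → ∀ k, V k) : Prop where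
  bars : Bars T d i (σ.reg sd.num) (σ.arr sd.birth) (σ.arr sd.death) (σ.arr sd.alive) G
  current : i < m → ∀ j < d i, T i (G (σ.arr sd.alive j) i) =
    ∑ r ∈ Finset.range (d (i + 1)), σ.cell sd.X i r j • β (i + 1) r
  later : ∀ k, i < k → k < m → ∀ j < d k, T k (β k j) =
    ∑ r ∈ Finset.range (d (k + 1)), σ.cell sd.X k r j • β (k + 1) r

/-- The living bars at `i + 1` are the row-reduced basis, so the next map on them is given by the
same combinations of columns of the next matrix. This is what the change of basis and the sorting
have produced. -/
theorem SideInvariant.advance {sd : Side} {T : ∀ i, V i →ₗ[K] V (i + 1)} {β : ∀ k, ℕ → V k}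
    {D : Side → ℕ → ℕ} {m i : ℕ} {σ τ : Store K Reg Arr Mat} {G : ℕ → ∀ k, V k} {c : Side → ℕ}
    (h : SideInvariant sd T β (D sd) m i σ G) (hi : i < m)
    (hβ : ⊤ ≤ Submodule.span K (β (i + 1) '' Set.Iio (D sd (i + 1))))
    (hR : Reduced (σ.cell sd.X i) (σ.arr sd.piv) (σ.arr sd.low) (D sd (i + 1)) (D sd i))
    (hA : Advanced D i σ τ c) :
    SideInvariant sd T β (D sd) m (i + 1) τ
      (appendBars T G (σ.reg sd.num) (c sd) (τ.arr sd.ord) (β (i + 1))) := by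
  refine ⟨h.bars.append hβ (h.current hi) hR (hA.bars sd), fun hm j hj => ?_,
    fun k hk hkm j hj => ?_⟩
  · have ho := (hA.bars sd).bijOn.mapsTo (Set.mem_Iio.2 hj)
    rw [appendBars_alive h.bars (h.current hi) hR (hA.bars sd) hj, map_rowReducedBasis,
      rowReducedBasis_sum (h.later (i + 1) (Nat.lt_succ_self i) hm) ho]
    refine Finset.sum_congr rfl fun r hr => ?_
    rw [Finset.mem_range] at hr
    rw [hA.next sd r hr j hj, iterate_colStep hR _ hr ho]
  · rw [hA.later sd k hk]
    exact h.later k (by omega) hkm j hj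

variable {T : ∀ i, V i →ₗ[K] V (i + 1)} {S : ∀ i, W i →ₗ[K] W (i + 1)} {φ : ∀ i, V i →ₗ[K] W i}
  {β : ∀ k, ℕ → V k} {γ : ∀ k, ℕ → W k} {D : Side → ℕ → ℕ} {m i : ℕ}
  {σ τ : Store K Reg Arr Mat} {G : ℕ → ∀ k, V k} {H : ℕ → ∀ k, W k} {c : Side → ℕ}

/-- `φ` in the new bases at the index `i + 1`. -/
theorem map_rowReducedBasis_eq_transformC
    (hC : ∀ l < D .M (i + 1), φ (i + 1) (β (i + 1) l) =
      ∑ r ∈ Finset.range (D .N (i + 1)), σ.cell .C (i + 1) r l • γ (i + 1) r)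
    (hM : Reduced (σ.cell .A i) (σ.arr .pivM) (σ.arr .lowM) (D .M (i + 1)) (D .M i))
    (hN : Reduced (σ.cell .B i) (σ.arr .pivN) (σ.arr .lowN) (D .N (i + 1)) (D .N i))
    {l : ℕ} (hl : l < D .M (i + 1)) :
    φ (i + 1) (rowReducedBasis (D .M (i + 1)) (σ.cell .A i) (σ.arr .pivM) (β (i + 1)) l) =
      ∑ r ∈ Finset.range (D .N (i + 1)), transformC σ D i r l •
        rowReducedBasis (D .N (i + 1)) (σ.cell .B i) (σ.arr .pivN) (γ (i + 1)) r := by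
  rw [transformC, iterate_cStep hN _ _ hl, map_rowReducedBasis, rowReducedBasis_sum hC hl]
  refine Finset.sum_congr rfl fun r hr => ?_
  rw [iterate_colStep hM _ (Finset.mem_range.1 hr) hl]

/-- The image of an old bar was expressed by old bars from its birth on, so its column gets zeros in
the new rows. The image of a new bar at its birth is expressed by the bars alive at `i + 1`, with
the transformed `C (i + 1)` as coefficients, and this persists by naturality. All rows are born by
`i + 1`, which is the birth of the new columns. -/
theorem Relates.advance (hφ : ∀ i x, φ (i + 1) (T i x) = S i (φ i x))
    (h : Relates φ (σ.reg .numCols) (σ.reg .numRows) (σ.arr .birthCol) (σ.arr .birthRow)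
      (σ.cell .f₀ 0) G H)
    (hC : ∀ l < D .M (i + 1), φ (i + 1) (β (i + 1) l) =
      ∑ r ∈ Finset.range (D .N (i + 1)), σ.cell .C (i + 1) r l • γ (i + 1) r)
    (hM : Reduced (σ.cell .A i) (σ.arr .pivM) (σ.arr .lowM) (D .M (i + 1)) (D .M i))
    (hN : Reduced (σ.cell .B i) (σ.arr .pivN) (σ.arr .lowN) (D .N (i + 1)) (D .N i))
    (hA : Advanced D i σ τ c) {G' : ℕ → ∀ k, V k} {H' : ℕ → ∀ k, W k}
    (hG' : Bars T (D .M) (i + 1) (τ.reg .numCols) (τ.arr .birthCol) (τ.arr .deathCol)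
      (τ.arr .aliveM) G')
    (hH' : Bars S (D .N) (i + 1) (τ.reg .numRows) (τ.arr .birthRow) (τ.arr .deathRow)
      (τ.arr .aliveN) H')
    (hG : ∀ x < σ.reg .numCols, G' x = G x) (hH : ∀ x < σ.reg .numRows, H' x = H x)
    (hGs : ∀ s < D .M (i + 1), G' (τ.arr .aliveM s) (i + 1) =
      rowReducedBasis (D .M (i + 1)) (σ.cell .A i) (σ.arr .pivM) (β (i + 1)) (τ.arr .ordM s))
    (hHs : ∀ s < D .N (i + 1), H' (τ.arr .aliveN s) (i + 1) =
      rowReducedBasis (D .N (i + 1)) (σ.cell .B i) (σ.arr .pivN) (γ (i + 1)) (τ.arr .ordN s)) :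
    Relates φ (τ.reg .numCols) (τ.reg .numRows) (τ.arr .birthCol) (τ.arr .birthRow)
      (τ.cell .f₀ 0) G' H' := by
  have hUM := hA.bars .M
  have hUN := hA.bars .N
  have hleM : σ.reg .numCols ≤ τ.reg .numCols := hUM.num_le
  have hleN : σ.reg .numRows ≤ τ.reg .numRows := hUN.num_le
  refine ⟨fun r hr x hx hne => ?_, fun x hx k hk => ?_⟩
  · by_cases h1 : x < σ.reg .numCols
    · by_cases h2 : r < σ.reg .numRows
      · rw [hA.old r h2 x h1] at hne
        have e1 : τ.arr .birthCol x = σ.arr .birthCol x := hUM.birth x h1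
        have e2 : τ.arr .birthRow r = σ.arr .birthRow r := hUN.birth r h2
        rw [e1, e2]
        exact h.birth r h2 x h1 hne
      · exact absurd (hA.newRow r (by omega) hr x h1) hne
    · exact (hH'.birth_le r hr).trans (hUM.new_times x (not_lt.1 h1) hx).2.ge
  · by_cases h1 : x < σ.reg .numCols
    · have e1 : τ.arr .birthCol x = σ.arr .birthCol x := hUM.birth x h1
      rw [e1] at hk
      rw [hG x h1, h.map x h1 k hk]
      refine (Finset.sum_congr rfl fun r hr => ?_).trans
        (Finset.sum_subset (Finset.range_mono hleN) fun r hr hr' => ?_)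
      · rw [Finset.mem_range] at hr
        rw [hA.old r hr x h1, hH r hr]
      · simp only [Finset.mem_range, not_lt] at hr hr'
        rw [hA.newRow r hr' hr x h1, zero_smul]
    · have e1 : τ.arr .birthCol x = i + 1 := (hUM.new_times x (not_lt.1 h1) hx).2
      rw [e1] at hk
      induction k, hk using Nat.le_induction with
      | base =>
        have hcount : σ.reg .numCols + D .M (i + 1) = τ.reg .numCols + c .M := hUM.count
        have hcle : c .M ≤ D .M (i + 1) := hUM.le
        obtain ⟨j, rfl⟩ := Nat.exists_eq_add_of_le (not_lt.1 h1)
        have hs : c .M + j < D .M (i + 1) := by omega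
        have e2 : τ.arr .aliveM (c .M + j) = σ.reg .numCols + j := by
          have : τ.arr .aliveM (c .M + j) + c .M = σ.reg .numCols + (c .M + j) :=
            (hUM.new (c .M + j) (by omega) hs).1
          omega
        have ho : τ.arr .ordM (c .M + j) < D .M (i + 1) := hUM.bijOn.mapsTo (Set.mem_Iio.2 hs)
        rw [← e2, hGs _ hs, map_rowReducedBasis_eq_transformC hC hM hN ho, e2]
        have hinj : Set.InjOn (τ.arr .aliveN) (Finset.range (D .N (i + 1))) := by
          intro s hs s' hs' hss
          simp only [Finset.coe_range, Set.mem_Iio] at hs hs'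
          exact hH'.alive_inj hs hs' hss
        have hsub : (Finset.range (D .N (i + 1))).image (τ.arr .aliveN) ⊆
            Finset.range (τ.reg .numRows) := by
          intro r hr
          obtain ⟨s, hs, rfl⟩ := Finset.mem_image.1 hr
          exact Finset.mem_range.2 (hH'.alive_lt s (Finset.mem_range.1 hs))
        -- Rows that are dead at `i + 1` have zero entries in the new columns. The others are
        -- enumerated by `aliveN`.
        rw [← Finset.sum_subset hsub fun r hr hr' => by
          rw [hA.newCol_dead r (Finset.mem_range.1 hr) (fun s hs hh => hr' (Finset.mem_image.2
            ⟨s, Finset.mem_range.2 hs, hh⟩)) _ (by omega) hx, zero_smul],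
          Finset.sum_image hinj]
        symm
        have hord : Set.BijOn (τ.arr .ordN) (Set.Iio (D .N (i + 1))) (Set.Iio (D .N (i + 1))) :=
          hUN.bijOn
        -- Both sides are the same expansion, once in the order of `f₀` and once in the order of the
        -- original basis.
        refine Finset.sum_nbij (τ.arr .ordN) (fun s hs => Finset.mem_range.2 (hord.mapsTo
          (Finset.mem_range.1 hs))) (by simpa using hord.injOn)
          (by simpa using hord.surjOn) fun s hs => ?_
        rw [Finset.mem_range] at hs
        rw [hA.newCol s hs j hx, hHs s hs]
      -- All rows are born by `i + 1 ≤ k`, so each of them is carried along by the map at `k`.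
      | succ k hk ih =>
        rw [← hG'.map x hx k (by omega), hφ, ih, map_sum]
        refine Finset.sum_congr rfl fun r hr => ?_
        rw [Finset.mem_range] at hr
        rw [map_smul, hH'.map r hr k ((hH'.birth_le r hr).trans hk)]

/-- The state of the computation at the index `i`. -/
structure Invariant (T : ∀ i, V i →ₗ[K] V (i + 1)) (S : ∀ i, W i →ₗ[K] W (i + 1))
    (φ : ∀ i, V i →ₗ[K] W i) (β : ∀ k, ℕ → V k) (γ : ∀ k, ℕ → W k) (D : Side → ℕ → ℕ) (m i : ℕ)
    (σ : Store K Reg Arr Mat) (G : ℕ → ∀ k, V k) (H : ℕ → ∀ k, W k) : Prop where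
  dim : ∀ sd : Side, σ.arr sd.dim = D sd
  sideM : SideInvariant .M T β (D .M) m i σ G
  sideN : SideInvariant .N S γ (D .N) m i σ H
  later : ∀ k, i < k → k ≤ m → ∀ l < D .M k, φ k (β k l) =
    ∑ r ∈ Finset.range (D .N k), σ.cell .C k r l • γ k r
  relates : Relates φ (σ.reg .numCols) (σ.reg .numRows) (σ.arr .birthCol) (σ.arr .birthRow)
    (σ.cell .f₀ 0) G H

/-- The matrix after an operation describes the map on modified bars, so the loop invariant asserts
the existence of suitable generators. The relation `R` carries what is known about `f₀`, so that one
proof serves both modules. -/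
theorem SideInvariant.reduce {sd : Side} {d : ℕ → ℕ} (h : SideInvariant sd T β d m i σ G)
    (hi : σ.reg .i = i) (him : i < m) (hd : σ.arr sd.dim = d)
    (R : (ℕ → ∀ k, V k) → (ℕ → ℕ → K) → Prop)
    (hR : ∀ G f s q j, q < j → j < d i → Bars T d i (σ.reg sd.num) (σ.arr sd.birth)
      (σ.arr sd.death) (σ.arr sd.alive) G → R G f →
      R (subBar (σ.arr sd.birth) s (σ.arr sd.alive q) (σ.arr sd.alive j) G)
        (sd.opF (σ.reg sd.len) (σ.arr sd.alive) s q j f))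
    (h0 : R G (σ.cell .f₀ 0)) :
    ∃ G', SideInvariant sd T β d m i (sd.reduce.exec σ) G' ∧
      R G' ((sd.reduce.exec σ).cell .f₀ 0) ∧
      Reduced ((sd.reduce.exec σ).cell sd.X i) ((sd.reduce.exec σ).arr sd.piv)
        ((sd.reduce.exec σ).arr sd.low) (d (i + 1)) (d i) := by
  obtain ⟨h1, ⟨G', h2, h3, h4⟩, h5⟩ := sd.exec_reduce (σ := σ) (fun a f => ∃ G', Bars T d i
      (σ.reg sd.num) (σ.arr sd.birth) (σ.arr sd.death) (σ.arr sd.alive) G' ∧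
      (∀ j < d i, T i (G' (σ.arr sd.alive j) i) =
        ∑ r ∈ Finset.range (d (i + 1)), a r j • β (i + 1) r) ∧ R G' f) hi (congrFun hd _)
    (congrFun hd _) (fun a f s q j hq hj ⟨G', h2, h3, h4⟩ => by
      refine ⟨_, h2.subBar s hq hj, fun j' hj' => ?_, hR G' f s q j hq hj h2 h4⟩
      have hb := h2.birth_le _ (h2.alive_lt j' hj')
      by_cases hjj : j' = j
      · subst hjj
        rw [subBar, if_pos ⟨rfl, hb⟩, map_sub, map_smul, h3 _ hj, h3 q (by omega),
          Finset.smul_sum, ← Finset.sum_sub_distrib]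
        refine Finset.sum_congr rfl fun r hr => ?_
        rw [subColF, if_pos ⟨Finset.mem_range.1 hr, rfl⟩, sub_smul, mul_smul]
      · rw [subBar, if_neg (fun hh => hjj (h2.alive_inj hj' hj hh.1)), h3 _ hj']
        refine Finset.sum_congr rfl fun r hr => ?_
        rw [subColF, if_neg (fun hh => hjj hh.2)])
    ⟨G, h.bars, h.current him, h0⟩
  have hF := Frame.exec sd.reduce σ
  generalize sd.reduce.exec σ = τ at *
  refine ⟨G', ⟨?_, fun _ => ?_, fun k hk => ?_⟩, h4, h1⟩
  · rw [hF.reg sd.num (by cases sd <;> rfl), hF.arr sd.birth (by cases sd <;> rfl),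
      hF.arr sd.death (by cases sd <;> rfl), hF.arr sd.alive (by cases sd <;> rfl)]
    exact h2
  · rw [hF.arr sd.alive (by cases sd <;> rfl)]
    exact h3
  · rw [h5 k (by omega)]
    exact h.later k hk

/-- The column reductions preserve the invariant. -/
theorem Invariant.reduce (h : Invariant T S φ β γ D m i σ G H) (hi : σ.reg .i = i) (him : i < m) :
    ∃ G' H', Invariant T S φ β γ D m i (Side.N.reduce.exec (Side.M.reduce.exec σ)) G' H' ∧
      ∀ sd : Side, Reduced ((Side.N.reduce.exec (Side.M.reduce.exec σ)).cell sd.X i)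
        ((Side.N.reduce.exec (Side.M.reduce.exec σ)).arr sd.piv)
        ((Side.N.reduce.exec (Side.M.reduce.exec σ)).arr sd.low) (D sd (i + 1)) (D sd i) := by
  obtain ⟨G', h1, h2, h3⟩ := h.sideM.reduce hi him (h.dim .M)
    (fun G f => Relates φ (σ.reg .numCols) (σ.reg .numRows) (σ.arr .birthCol) (σ.arr .birthRow)
      f G H) (fun G f s q j hq hj hb hr => hr.subCol s (hb.alive_lt q (hq.trans hj))
        (hb.birth_mono _ _ (hb.alive_mono q j hq hj).le (hb.alive_lt j hj))) h.relates
  have f1 := Frame.exec Side.M.reduce σ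
  generalize Side.M.reduce.exec σ = σ₁ at *
  have hN : SideInvariant .N S γ (D .N) m i σ₁ H := by
    obtain ⟨b1, b2, b3⟩ := h.sideN
    rw [← f1.reg Side.N.num rfl, ← f1.arr Side.N.birth rfl, ← f1.arr Side.N.death rfl,
      ← f1.arr Side.N.alive rfl] at b1
    rw [← f1.arr Side.N.alive rfl, ← f1.cell Side.N.X rfl] at b2
    rw [← f1.cell Side.N.X rfl] at b3
    exact ⟨b1, b2, b3⟩
  rw [← f1.reg .numCols rfl, ← f1.reg .numRows rfl, ← f1.arr .birthCol rfl,
    ← f1.arr .birthRow rfl] at h2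
  have i1 : σ₁.reg .i = i := (f1.reg _ rfl).trans hi
  obtain ⟨H', k1, k2, k3⟩ := hN.reduce i1 him ((f1.arr _ rfl).trans (h.dim .N))
    (fun H f => Relates φ (σ₁.reg .numCols) (σ₁.reg .numRows) (σ₁.arr .birthCol)
      (σ₁.arr .birthRow) f G' H) (fun H f s q j hq hj hb hr => hr.addRow s
        (hb.alive_lt q (hq.trans hj)) (hb.alive_lt j hj) (hb.alive_mono q j hq hj).ne
        (hb.birth_mono _ _ (hb.alive_mono q j hq hj).le (hb.alive_lt j hj))) h2
  have f2 := Frame.exec Side.N.reduce σ₁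
  generalize Side.N.reduce.exec σ₁ = σ₂ at *
  refine ⟨G', H', ⟨fun sd => ?_, ?_, k1, fun k hk => ?_, ?_⟩, fun sd => ?_⟩
  · rw [f2.arr _ (by cases sd <;> rfl), f1.arr _ (by cases sd <;> rfl), h.dim]
  · obtain ⟨b1, b2, b3⟩ := h1
    rw [← f2.reg Side.M.num rfl, ← f2.arr Side.M.birth rfl, ← f2.arr Side.M.death rfl,
      ← f2.arr Side.M.alive rfl] at b1
    rw [← f2.arr Side.M.alive rfl, ← f2.cell Side.M.X rfl] at b2
    rw [← f2.cell Side.M.X rfl] at b3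
    exact ⟨b1, b2, b3⟩
  · rw [f2.cell .C rfl, f1.cell .C rfl]
    exact h.later k hk
  · rw [← f2.reg .numCols rfl, ← f2.reg .numRows rfl, ← f2.arr .birthCol rfl,
      ← f2.arr .birthRow rfl] at k2
    exact k2
  · cases sd
    · rw [f2.arr Side.M.piv rfl, f2.arr Side.M.low rfl, f2.cell Side.M.X rfl]
      exact h3
    · exact k3

/-- A step of the algorithm takes the invariant at `i` to the invariant at `i + 1`. -/
theorem Invariant.step (hφ : ∀ i x, φ (i + 1) (T i x) = S i (φ i x))
    (hβ : ∀ k ≤ m, ⊤ ≤ Submodule.span K (β k '' Set.Iio (D .M k)))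
    (hγ : ∀ k ≤ m, ⊤ ≤ Submodule.span K (γ k '' Set.Iio (D .N k)))
    (h : Invariant T S φ β γ D m i σ G H) (hi : σ.reg .i = i) (him : i < m) :
    ∃ G' H', Invariant T S φ β γ D m (i + 1) (step.exec σ) G' H' := by
  obtain ⟨G₁, H₁, h1, hR⟩ := h.reduce hi him
  rw [exec_step_eq_advance]
  have i1 : (Side.N.reduce.exec (Side.M.reduce.exec σ)).reg .i = i := by
    rw [(Frame.exec Side.N.reduce _).reg _ rfl, (Frame.exec Side.M.reduce _).reg _ rfl, hi]
  generalize Side.N.reduce.exec (Side.M.reduce.exec σ) = σ₁ at *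
  obtain ⟨c, hA⟩ := advanced i1 h1.dim
    (fun sd => by cases sd; exacts [h1.sideM.bars.alive_mono, h1.sideN.bars.alive_mono])
    (fun sd => by cases sd; exacts [h1.sideM.bars.alive_lt, h1.sideN.bars.alive_lt]) hR
  generalize advance σ₁ = τ at *
  have hM := h1.sideM.advance him (hβ (i + 1) him) (hR .M) hA
  have hN := h1.sideN.advance him (hγ (i + 1) him) (hR .N) hA
  refine ⟨_, _, fun sd => (hA.dim sd).trans (h1.dim sd), hM, hN, fun k hk hkm => ?_,
    Relates.advance hφ h1.relates (h1.later (i + 1) (Nat.lt_succ_self i) him) (hR .M) (hR .N) hA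
      hM.bars hN.bars (fun x hx => if_pos hx) (fun x hx => if_pos hx)
      (fun s hs => appendBars_alive h1.sideM.bars (h1.sideM.current him) (hR .M) (hA.bars .M) hs)
      fun s hs => appendBars_alive h1.sideN.bars (h1.sideN.current him) (hR .N) (hA.bars .N) hs⟩
  rw [hA.later_C k hk]
  exact h1.later k (by omega) hkm

end PresPersMod

/-! ## Correctness -/

namespace Persistence

open PresPersMod FieldRAM

variable {K : Type u} [Field K] {V : ℕ → Type v} [∀ i, AddCommGroup (V i)] [∀ i, Module K (V i)]
  {T : ∀ i, V i →ₗ[K] V (i + 1)}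

theorem Bars.init {d : ℕ → ℕ} {num : ℕ} {bi de al : ℕ → ℕ} (hnum : num = d 0) {e : ℕ → V 0}
    (he : ⊤ ≤ Submodule.span K (e '' Set.Iio num)) (hal : ∀ j < num, al j = j)
    (hbi : ∀ j < num, bi j = 0) (hde : ∀ j < num, de j = 0) :
    Bars T d 0 num bi de al (fun c => push T (e c)) := by
  subst hnum
  refine ⟨fun c hc => (hbi c hc).le, fun c c' hcc hc' => ?_, fun c hc => .inl (hde c hc),
    fun j hj => (hal j hj).trans_lt hj, fun j j' hj hj' => ?_, fun c hc => ?_,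
    fun c hc k hk => push_succ _ (Nat.zero_le k), fun c hc k hk => ?_,
    fun c hc h0 => absurd (hde c hc) h0, fun k hk => ?_, fun k hk => ?_⟩
  · rw [hbi c (by omega), hbi c' hc']
  · rwa [hal j (by omega), hal j' hj']
  · exact ⟨fun _ => ⟨c, hc, hal c hc⟩, fun _ => hde c hc⟩
  · rw [hbi c hc] at hk
    omega
  · obtain rfl : k = 0 := by omega
    simpa only [push_self] using he
  · obtain rfl : k = 0 := by omega
    rw [Finset.filter_true_of_mem, Finset.card_range]
    intro c hc
    rw [Finset.mem_range] at hc
    exact ⟨(hbi c hc).le, .inl (hde c hc)⟩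

theorem decodeDeath_le_iff {n k : ℕ} : decodeDeath n ≤ (k : ℕ) ↔ n ≠ 0 ∧ n ≤ k := by
  rw [decodeDeath]
  split_ifs with h
  · simp [h]
  · simp [h]

theorem lt_decodeDeath_iff {n k : ℕ} : (k : ℕ∞) < decodeDeath n ↔ n = 0 ∨ k < n := by
  rw [← not_le, decodeDeath_le_iff]
  omega

/-- Bars up to the index from which on all maps are isomorphisms form a barcode. -/
theorem Bars.isBarBasis {d : ℕ → ℕ} {m num : ℕ} {bi de al : ℕ → ℕ} {G : ℕ → ∀ k, V k}
    (h : Bars T d m num bi de al G) (hd : ∀ k ≤ m, Module.finrank K (V k) = d k)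
    (hT : ∀ k, m ≤ k → Function.Bijective (T k)) :
    IsBarBasis T (fun c : Fin num => bi c) (fun c => decodeDeath (de c)) (fun c => G c) := by
  have atIndex : ∀ k ≤ m, LinearIndependent K (fun c : {c : Fin num // bi c ≤ k ∧
      (k : ℕ∞) < decodeDeath (de c)} => G c.1 k) ∧ ⊤ ≤ Submodule.span K
      (Set.range fun c : {c : Fin num // bi c ≤ k ∧ (k : ℕ∞) < decodeDeath (de c)} => G c.1 k) := by
    intro k hk
    have hs : ⊤ ≤ Submodule.span K (Set.range fun c : {c : Fin num // bi c ≤ k ∧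
        (k : ℕ∞) < decodeDeath (de c)} => G c.1 k) := by
      refine (h.span k hk).trans (Submodule.span_le.2 ?_)
      rintro _ ⟨c, hc, rfl⟩
      rw [Set.mem_Iio] at hc
      by_cases h1 : bi c ≤ k
      · by_cases h2 : (k : ℕ∞) < decodeDeath (de c)
        · exact Submodule.subset_span ⟨⟨⟨c, hc⟩, h1, h2⟩, rfl⟩
        · rw [not_lt, decodeDeath_le_iff] at h2
          simp only [h.after c hc h2.1 k h2.2]
          exact Submodule.zero_mem _
      · simp only [h.before c hc k (by omega)]
        exact Submodule.zero_mem _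
    -- A spanning family with as many members as the dimension is independent.
    refine ⟨linearIndependent_of_top_le_span_of_card_eq_finrank hs ?_, hs⟩
    rw [hd k hk, ← h.card k hk, Fintype.card_subtype]
    refine Finset.card_nbij (fun c => c.1) (fun c hc => ?_) (fun c _ c' _ hcc => Fin.ext hcc)
      fun c hc => ?_
    · rw [Finset.mem_coe, Finset.mem_filter, lt_decodeDeath_iff] at hc
      exact Finset.mem_coe.2 (Finset.mem_filter.2 ⟨Finset.mem_range.2 c.2, hc.2⟩)
    · rw [Finset.mem_coe, Finset.mem_filter, Finset.mem_range] at hc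
      exact ⟨⟨c, hc.1⟩, by simpa [lt_decodeDeath_iff] using hc.2, rfl⟩
  have key : ∀ k, LinearIndependent K (fun c : {c : Fin num // bi c ≤ k ∧
      (k : ℕ∞) < decodeDeath (de c)} => G c.1 k) ∧ ⊤ ≤ Submodule.span K
      (Set.range fun c : {c : Fin num // bi c ≤ k ∧ (k : ℕ∞) < decodeDeath (de c)} => G c.1 k) := by
    intro k
    rcases le_total k m with hk | hk
    · exact atIndex k hk
    · induction k, hk using Nat.le_induction with
      | base => exact atIndex m le_rfl
      | succ k hk ih =>
        -- All births and finite deaths occur at indices up to `m`, so the set of living bars is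
        -- constant from there on, and the isomorphism carries one basis to the next.
        have hiff : ∀ c : Fin num, (bi c ≤ k + 1 ∧ ((k + 1 : ℕ) : ℕ∞) < decodeDeath (de c)) ↔
            bi c ≤ k ∧ (k : ℕ∞) < decodeDeath (de c) := by
          intro c
          rw [lt_decodeDeath_iff, lt_decodeDeath_iff]
          have h1 := h.birth_le c c.2
          have h2 := h.death c c.2
          omega
        have hfam : (fun c : {c : Fin num // bi c ≤ k + 1 ∧ ((k + 1 : ℕ) : ℕ∞) <
            decodeDeath (de c)} => G c.1 (k + 1)) =
            (T k ∘ fun c : {c : Fin num // bi c ≤ k ∧ (k : ℕ∞) < decodeDeath (de c)} => G c.1 k) ∘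
              Equiv.subtypeEquivRight hiff := by
          funext c
          exact (h.map c.1 c.1.2 k ((h.birth_le _ c.1.2).trans hk)).symm
        rw [hfam]
        refine ⟨(ih.1.map' (T k) (LinearMap.ker_eq_bot.2 (hT k hk).1)).comp _
          (Equiv.injective _), ?_⟩
        rw [EquivLike.range_comp, Set.range_comp, Submodule.span_image]
        exact (LinearMap.range_eq_top.2 (hT k hk).2).ge.trans
          (LinearMap.range_eq_map (T k) ▸ Submodule.map_mono ih.2)
  refine ⟨fun c => ?_, fun c k hk => h.map c c.2 k hk, fun c k hk => ?_, fun k => (key k).1,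
    fun k => (key k).2⟩
  · rw [lt_decodeDeath_iff]
    have := h.death c c.2
    omega
  · rw [decodeDeath_le_iff] at hk
    exact h.after c c.2 hk.1 k hk.2

theorem stepMap_bijective {M : ℕ ⥤ FGModuleCat.{v} K} {m : ℕ} (h : IsStableFrom M m) (k : ℕ)
    (hk : m ≤ k) : Function.Bijective (stepMap M k) := by
  have := h k (k + 1) hk (Nat.le_succ k)
  exact ConcreteCategory.bijective_of_isIso (M.map (homOfLE (Nat.le_succ k)))

end Persistence

/-! ### The matrices of the input, and induction over the index -/

namespace PresPersMod

open FieldRAM Persistence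

variable {K : Type u} [Field K]

/-- A basis as a family indexed by the natural numbers. -/
def extendFamily {E : Type v} [AddCommGroup E] {n : ℕ} (b : Fin n → E) (j : ℕ) : E :=
  if h : j < n then b ⟨j, h⟩ else 0

theorem top_le_span_extendFamily {E : Type v} [AddCommGroup E] [Module K E] {n : ℕ}
    (b : Module.Basis (Fin n) K E) :
    ⊤ ≤ Submodule.span K (extendFamily b '' Set.Iio n) := by
  rw [← b.span_eq]
  refine Submodule.span_mono ?_
  rintro _ ⟨j, rfl⟩
  exact ⟨j, j.2, by simp [extendFamily]⟩

theorem map_extendFamily {E E' : Type v} [AddCommGroup E] [Module K E] [AddCommGroup E']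
    [Module K E'] {n n' : ℕ} (b : Module.Basis (Fin n) K E) (b' : Module.Basis (Fin n') K E')
    (L : E →ₗ[K] E') {a : ℕ → ℕ → K} {j : ℕ} (hj : j < n)
    (ha : ∀ r (hr : r < n'), a r j = LinearMap.toMatrix b b' L ⟨r, hr⟩ ⟨j, hj⟩) :
    L (extendFamily b j) = ∑ r ∈ Finset.range n', a r j • extendFamily b' r := by
  rw [Finset.sum_range, extendFamily, dif_pos hj, ← b'.sum_repr (L (b ⟨j, hj⟩))]
  refine Finset.sum_congr rfl fun r _ => ?_
  rw [ha r r.2, LinearMap.toMatrix_apply, extendFamily, dif_pos r.2]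

variable [DecidableEq K]

section Invariant

variable {V : ℕ → Type v} [∀ i, AddCommGroup (V i)] [∀ i, Module K (V i)]
  {W : ℕ → Type v} [∀ i, AddCommGroup (W i)] [∀ i, Module K (W i)]
  {T : ∀ i, V i →ₗ[K] V (i + 1)} {S : ∀ i, W i →ₗ[K] W (i + 1)} {φ : ∀ i, V i →ₗ[K] W i}
  {β : ∀ k, ℕ → V k} {γ : ∀ k, ℕ → W k} {D : Side → ℕ → ℕ} {m : ℕ} {σ : Store K Reg Arr Mat}

theorem Invariant.start (hφ : ∀ i x, φ (i + 1) (T i x) = S i (φ i x))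
    (hβ : ⊤ ≤ Submodule.span K (β 0 '' Set.Iio (D .M 0)))
    (hγ : ⊤ ≤ Submodule.span K (γ 0 '' Set.Iio (D .N 0)))
    (hD : ∀ sd : Side, σ.arr sd.dim = D sd)
    (hA : ∀ k < m, ∀ j < D .M k, T k (β k j) =
      ∑ r ∈ Finset.range (D .M (k + 1)), σ.cell .A k r j • β (k + 1) r)
    (hB : ∀ k < m, ∀ j < D .N k, S k (γ k j) =
      ∑ r ∈ Finset.range (D .N (k + 1)), σ.cell .B k r j • γ (k + 1) r)
    (hC : ∀ k ≤ m, ∀ l < D .M k, φ k (β k l) =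
      ∑ r ∈ Finset.range (D .N k), σ.cell .C k r l • γ k r) :
    Invariant T S φ β γ D m 0 (start.exec σ) (fun c => push T (β 0 c))
      (fun c => push S (γ 0 c)) := by
  obtain ⟨s1, s2, s3, s4, s5⟩ := exec_start σ
  have hF := Frame.exec PresPersMod.start σ
  generalize PresPersMod.start.exec σ = τ at *
  have hDM : σ.arr .dimM = D .M := hD .M
  have hDN : σ.arr .dimN = D .N := hD .N
  rw [hDM] at s1 s3 s5
  rw [hDN] at s2 s4 s5
  have hM : SideInvariant .M T β (D .M) m 0 τ (fun c => push T (β 0 c)) := by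
    refine ⟨Bars.init s1 (by rw [s1]; exact hβ)
      (fun j hj => (s3 j (hj.trans_eq s1)).1) (fun j hj => (s3 j (hj.trans_eq s1)).2.1)
      (fun j hj => (s3 j (hj.trans_eq s1)).2.2), fun h0 j hj => ?_, fun k hk hkm => ?_⟩
    · rw [push_self, hF.cell Side.M.X rfl, show τ.arr Side.M.alive j = j from (s3 j hj).1]
      exact hA 0 h0 j hj
    · rw [hF.cell Side.M.X rfl]
      exact hA k hkm
  have hN : SideInvariant .N S γ (D .N) m 0 τ (fun c => push S (γ 0 c)) := by
    refine ⟨Bars.init s2 (by rw [s2]; exact hγ)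
      (fun j hj => (s4 j (hj.trans_eq s2)).1) (fun j hj => (s4 j (hj.trans_eq s2)).2.1)
      (fun j hj => (s4 j (hj.trans_eq s2)).2.2), fun h0 j hj => ?_, fun k hk hkm => ?_⟩
    · rw [push_self, hF.cell Side.N.X rfl, show τ.arr Side.N.alive j = j from (s4 j hj).1]
      exact hB 0 h0 j hj
    · rw [hF.cell Side.N.X rfl]
      exact hB k hkm
  refine ⟨fun sd => (hF.arr _ (by cases sd <;> rfl)).trans (hD sd), hM, hN, fun k hk hkm => ?_,
    fun r hr c hc _ => ?_, fun c hc k hk => ?_⟩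
  · rw [hF.cell .C rfl]
    exact hC k hkm
  · rw [(s4 r (by omega)).2.1]
    exact Nat.zero_le _
  · clear hk
    induction k with
    | zero =>
      rw [push_self, hC 0 (Nat.zero_le m) c (by omega), s2]
      refine Finset.sum_congr rfl fun r hr => ?_
      rw [Finset.mem_range] at hr
      rw [push_self, s5 r hr c (by omega)]
    | succ k ih =>
      rw [← push_succ _ (Nat.zero_le k), hφ, ih, map_sum]
      refine Finset.sum_congr rfl fun r _ => ?_
      rw [map_smul, push_succ _ (Nat.zero_le k)]

theorem exists_invariant (hφ : ∀ i x, φ (i + 1) (T i x) = S i (φ i x))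
    (hβ : ∀ k ≤ m, ⊤ ≤ Submodule.span K (β k '' Set.Iio (D .M k)))
    (hγ : ∀ k ≤ m, ⊤ ≤ Submodule.span K (γ k '' Set.Iio (D .N k)))
    (hm : σ.reg .m = m) (hD : ∀ sd : Side, σ.arr sd.dim = D sd)
    (hA : ∀ k < m, ∀ j < D .M k, T k (β k j) =
      ∑ r ∈ Finset.range (D .M (k + 1)), σ.cell .A k r j • β (k + 1) r)
    (hB : ∀ k < m, ∀ j < D .N k, S k (γ k j) =
      ∑ r ∈ Finset.range (D .N (k + 1)), σ.cell .B k r j • γ (k + 1) r)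
    (hC : ∀ k ≤ m, ∀ l < D .M k, φ k (β k l) =
      ∑ r ∈ Finset.range (D .N k), σ.cell .C k r l • γ k r) :
    ∃ G H, Invariant T S φ β γ D m m (algorithm.exec σ) G H := by
  rw [algorithm, Prog.exec_seq]
  have h0 := Invariant.start hφ (hβ 0 (Nat.zero_le m)) (hγ 0 (Nat.zero_le m)) hD hA hB hC
  have hm' : (start.exec σ).reg .m = m := ((Frame.exec start σ).reg .m rfl).trans hm
  generalize start.exec σ = σ₁ at *
  refine Prog.exec_loop_induction (fun k (τ : Store K Reg Arr Mat) =>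
    ∃ G H, Invariant T S φ β γ D m k τ G H) hm' ⟨_, _, h0⟩ fun k hk τ _ ⟨G, H, h⟩ => ?_
  refine Invariant.step (i := k) (G := G) (H := H) hφ hβ hγ ?_ rfl hk
  -- Setting the loop register does not affect anything in the invariant, so its components can be
  -- reassembled unchanged for the new memory.
  obtain ⟨h1, ⟨h2, h3, h4⟩, ⟨h5, h6, h7⟩, h8, h9⟩ := h
  exact ⟨h1, ⟨h2, h3, h4⟩, ⟨h5, h6, h7⟩, h8, h9⟩

end Invariant

/-- From `m < n` one gets `1 ≤ n`, so the constants in `S + 1` and `3 * S + m` are absorbed into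
multiples of `n`. -/
theorem time_le_cube {a s t n m S : ℕ} (hS : S ≤ 2 * a * n) (hm : m < n) :
    s * ((S + 1) * (S + 1)) + 2 + m + t * ((3 * S + m) * ((S + 1) * (S + 1))) ≤
      (s * (1 + 2 * a) ^ 2 + 3 + t * ((1 + 6 * a) * (1 + 2 * a) ^ 2)) * n ^ 3 := by
  have h1 : S + 1 ≤ (1 + 2 * a) * n := by nlinarith
  have h2 : 3 * S + m ≤ (1 + 6 * a) * n := by nlinarith
  have h3 : 1 ≤ n := by omega
  have h4 : (S + 1) * (S + 1) ≤ (1 + 2 * a) ^ 2 * n ^ 2 := by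
    calc _ ≤ ((1 + 2 * a) * n) * ((1 + 2 * a) * n) := Nat.mul_le_mul h1 h1
      _ = _ := by ring
  have h5 : n ^ 2 ≤ n ^ 3 := Nat.pow_le_pow_right h3 (by omega)
  have h6 : n ≤ n ^ 3 := Nat.le_self_pow (by omega) n
  calc _ ≤ s * ((1 + 2 * a) ^ 2 * n ^ 3) + 3 * n ^ 3 +
        t * (((1 + 6 * a) * n) * ((1 + 2 * a) ^ 2 * n ^ 2)) := by
        have e1 := Nat.mul_le_mul_left s (h4.trans (Nat.mul_le_mul_left _ h5))
        have e2 := Nat.mul_le_mul_left t (Nat.mul_le_mul h2 h4)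
        omega
    _ = _ := by ring

end PresPersMod

/-! ### Correctness and running time combined -/

theorem theorem4p1 (a : ℕ) :
    ∃ κ : ℕ, ∀ (K : Type u) [Field K] [DecidableEq K] (M N : ℕ ⥤ FGModuleCat.{v} K) (φ : M ⟶ N)
      (m : ℕ) (_ : Persistence.IsStableFrom M m) (_ : Persistence.IsStableFrom N m)
      (dM dN : ℕ → ℕ) (βM : ∀ i, Module.Basis (Fin (dM i)) K (M.obj i))
      (βN : ∀ i, Module.Basis (Fin (dN i)) K (N.obj i)),
      (PresPersMod.output (PresPersMod.algorithm.exec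
        (Persistence.matrixInput φ m βM βN))).IsCanonicalPresentation φ ∧
      (PresPersMod.output (PresPersMod.algorithm.exec
        (Persistence.matrixInput φ m βM βN))).IsBarDecomposition φ ∧
      ∀ n : ℕ → ℕ, (∀ i ≤ m, dM i ≤ a * n i ∧ dN i ≤ a * n i) →
        m < ∑ i ∈ Finset.range (m + 1), n i →
        PresPersMod.algorithm.time (Persistence.matrixInput φ m βM βN) ≤
          κ * (∑ i ∈ Finset.range (m + 1), n i) ^ 3 := by
  -- The constant is the one of `time_le_cube` for the sizes of the two parts of the program. These
  -- sizes are syntactic, independent of the field and of the input.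
  refine ⟨(PresPersMod.start : PresPersMod.P).size * (1 + 2 * a) ^ 2 + 3 +
    (PresPersMod.step : PresPersMod.P).size * ((1 + 6 * a) * (1 + 2 * a) ^ 2), ?_⟩
  intro K _ _ M N φ m hM hN dM dN βM βN
  obtain ⟨σ, hσ⟩ : ∃ σ, σ = Persistence.matrixInput φ m βM βN := ⟨_, rfl⟩
  rw [← hσ]
  have hregm : σ.reg .m = m := by rw [hσ]; rfl
  have hregl : σ.reg .l = 0 := by rw [hσ]; rfl
  have hdimM : ∀ k, σ.arr .dimM k = if k ≤ m then dM k else 0 := fun k => by rw [hσ]; rfl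
  have hdimN : ∀ k, σ.arr .dimN k = if k ≤ m then dN k else 0 := fun k => by rw [hσ]; rfl
  have hA : ∀ k r c, σ.cell .A k r c = if h : k < m ∧ r < dM (k + 1) ∧ c < dM k then
      LinearMap.toMatrix (βM k) (βM (k + 1)) (Persistence.stepMap M k) ⟨r, h.2.1⟩ ⟨c, h.2.2⟩
      else 0 := fun k r c => by rw [hσ]; rfl
  have hB : ∀ k r c, σ.cell .B k r c = if h : k < m ∧ r < dN (k + 1) ∧ c < dN k then
      LinearMap.toMatrix (βN k) (βN (k + 1)) (Persistence.stepMap N k) ⟨r, h.2.1⟩ ⟨c, h.2.2⟩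
      else 0 := fun k r c => by rw [hσ]; rfl
  have hC : ∀ k r c, σ.cell .C k r c = if h : k ≤ m ∧ r < dN k ∧ c < dM k then
      LinearMap.toMatrix (βM k) (βN k) (Persistence.component φ k) ⟨r, h.2.1⟩ ⟨c, h.2.2⟩
      else 0 := fun k r c => by rw [hσ]; rfl
  clear hσ
  -- The stored dimensions are cut off after `m`. They agree with the true ones wherever the
  -- algorithm needs a basis.
  have eM : ∀ k ≤ m, σ.arr PresPersMod.Side.M.dim k = dM k := fun k hk =>
    (hdimM k).trans (if_pos hk)
  have eN : ∀ k ≤ m, σ.arr PresPersMod.Side.N.dim k = dN k := fun k hk =>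
    (hdimN k).trans (if_pos hk)
  obtain ⟨G, H, hinv⟩ := PresPersMod.exists_invariant (σ := σ) (m := m)
    (T := Persistence.stepMap M) (S := Persistence.stepMap N) (φ := Persistence.component φ)
    (β := fun k => PresPersMod.extendFamily (βM k)) (γ := fun k => PresPersMod.extendFamily (βN k))
    (D := fun sd => σ.arr sd.dim) (Persistence.component_stepMap φ)
    (fun k hk => by rw [eM k hk]; exact PresPersMod.top_le_span_extendFamily (βM k))
    (fun k hk => by rw [eN k hk]; exact PresPersMod.top_le_span_extendFamily (βN k))
    hregm (fun _ => rfl)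
    (fun k hk j hj => by
      rw [eM k hk.le] at hj
      rw [eM (k + 1) hk]
      exact PresPersMod.map_extendFamily _ _ _ hj fun r hr => by rw [hA, dif_pos ⟨hk, hr, hj⟩])
    (fun k hk j hj => by
      rw [eN k hk.le] at hj
      rw [eN (k + 1) hk]
      exact PresPersMod.map_extendFamily _ _ _ hj fun r hr => by rw [hB, dif_pos ⟨hk, hr, hj⟩])
    (fun k hk j hj => by
      rw [eM k hk] at hj
      rw [eN k hk]
      exact PresPersMod.map_extendFamily _ _ _ hj fun r hr => by rw [hC, dif_pos ⟨hk, hr, hj⟩])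
  have hG := hinv.sideM.bars.isBarBasis
    (fun k hk => by rw [eM k hk, Module.finrank_eq_card_basis (βM k), Fintype.card_fin])
    (Persistence.stepMap_bijective hM)
  have hH := hinv.sideN.bars.isBarBasis
    (fun k hk => by rw [eN k hk, Module.finrank_eq_card_basis (βN k), Fintype.card_fin])
    (Persistence.stepMap_bijective hN)
  have hrel := hinv.relates
  have hb : ∀ r c, (PresPersMod.output (PresPersMod.algorithm.exec σ)).f₀ r c ≠ 0 →
      (PresPersMod.output (PresPersMod.algorithm.exec σ)).birthRow r ≤
        (PresPersMod.output (PresPersMod.algorithm.exec σ)).birthCol c :=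
    fun r c => hrel.birth r r.2 c c.2
  have hmap : ∀ c k, (PresPersMod.output (PresPersMod.algorithm.exec σ)).birthCol c ≤ k →
      Persistence.component φ k (G c k) =
        ∑ r, (PresPersMod.output (PresPersMod.algorithm.exec σ)).f₀ r c • H r k :=
    fun c k hk => (hrel.map c c.2 k hk).trans (Finset.sum_range _)
  refine ⟨AnnotatedMatrix.isCanonicalPresentation hG hH hb hmap,
    AnnotatedMatrix.isBarDecomposition hG hH hb hmap, fun n hn hmn => ?_⟩
  refine (PresPersMod.time_algorithm_le (σ := σ) (D := fun k => σ.arr .dimM k + σ.arr .dimN k)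
    hregm hregl (fun _ => rfl) (fun k hk => ?_) rfl).trans (PresPersMod.time_le_cube ?_ hmn)
  · rw [hdimM, hdimN, if_neg (by omega), if_neg (by omega)]
  · rw [Finset.mul_sum]
    refine Finset.sum_le_sum fun k hk => ?_
    have hk' : k ≤ m := by rw [Finset.mem_range] at hk; omega
    have h1 := hn k hk'
    rw [hdimM, hdimN, if_pos hk', if_pos hk', mul_assoc]
    omega
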